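/- Let $n\ge 1$. All integrals over $\partial K$ are with respect to the $(n-1)$-dimensional Hausdorff measure, normalized so that it is Lebesgue measure on hyperplanes; $n_x$ is the unit outer normal of $K$ at $x\in\partial K$ (it is unique for almost every $x\in\partial K$), $|\cdot|$ is the volume (Lebesgue measure), $h_M(u)=\sup_{y\in M}\langle u,y\rangle$ is the support function, and, for $1\le k\le n$, $V_k(K,M)=\frac{(n-k)!}{n!}\frac{d^k}{dt^k}\big|_{t=0^+}|K+tM|$ (for $n=1$ the term $n(n-1)V_2$ below is read as $0$). (i) Let $K\subset\mathbb R^n$ be an origin-symmetric bounded convex set with non-empty interior, whose closure is strictly convex and whose boundary is of class $C^2$. Let $\mathrm{II}=dn_x$ be the second fundamental form of $\partial K$ and $H_x=\mathrm{tr}(\mathrm{II})$. For every $t\in\mathbb R$ and $v\in\mathbb R^n$, the function $f(x)=t\langle x,n_x\rangle+|\langle v,n_x\rangle|$ on $\partial K$ satisfies $$\int_{\partial K}\Big(H_x f^2-\langle \mathrm{II}^{-1}\nabla_{\partial K}f,\nabla_{\partial K}f\rangle+\frac{f^2}{\langle x,n_x\rangle}\Big)\le\frac1{|K|}\Big(\int_{\partial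 K}f\Big)^2 .$$ Here $\nabla_{\partial K}f$ exists and lies in the range of $\mathrm{II}$ almost everywhere, and $\mathrm{II}^{-1}\nabla_{\partial K}f$ is any tangent vector $w$ with $\mathrm{II}\,w=\nabla_{\partial K}f$; both integrands are integrable. (ii) Let $K\subset\mathbb R^n$ be any origin-symmetric bounded convex set with non-empty interior, let $v\in\mathbb R^n$ and $M=[-v,v]$. Then $t\mapsto|K+tM|$ is $C^2$ on $[0,\infty)$, $x\mapsto h_M(n_x)^2/\langle x,n_x\rangle$ is integrable on $\partial K$, and $$n(n-1)V_2(K,M)+\int_{\partial K}\frac{h_M^2(n_x)}{\langle x,n_x\rangle}\le\frac{n^2V_1(K,M)^2}{|K|}.$$ Equality holds if and only if $v=0$ or there are $s>0$ and an $(n-1)$-dimensional origin-symmetric convex set $C$ such that $\overline K=C+[-sv,sv]$, where $\overline K$ is the closure of $K$ (that is, $K$ itself if $K$ is compact). -/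

import Mathlib

open MeasureTheory Set Topology
open scoped Pointwise RealInnerProductSpace

namespace LogBM

noncomputable section

/-- Bounded origin-symmetric convex sets of `ℝⁿ` with non-empty interior. -/
structure IsSymmetricConvex {n : ℕ} (K : Set (EuclideanSpace ℝ (Fin n))) : Prop where
  symm : ∀ x ∈ K, -x ∈ K
  convex : Convex ℝ K
  bounded : Bornology.IsBounded K
  interior_nonempty : (interior K).Nonempty

/-- The boundary of `K` is a hypersurface of class `C²`: near each of its points it is the zero set
of a `C²` function with non-vanishing differential. -/
def HasC2Boundary {n : ℕ} (K : Set (EuclideanSpace ℝ (Fin n))) : Prop :=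
  ∀ x ∈ frontier K, ∃ ρ : EuclideanSpace ℝ (Fin n) → ℝ,
    ContDiffAt ℝ 2 ρ x ∧ fderiv ℝ ρ x ≠ 0 ∧ ∀ᶠ y in 𝓝 x, y ∈ frontier K ↔ ρ y = 0

/-- `u` is a unit outer normal vector of the convex set `K` at the boundary point `x`. -/
def IsUnitOuterNormal {n : ℕ} (K : Set (EuclideanSpace ℝ (Fin n)))
    (x u : EuclideanSpace ℝ (Fin n)) : Prop :=
  ‖u‖ = 1 ∧ ∀ y ∈ K, ⟪y - x, u⟫ ≤ 0

open Classical in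
/-- The unit outer normal `n_x`, at the regular boundary points `x` of `K`, that is, where it is
unique. (The other boundary points of a convex body form a null set; the value there is `0`.) -/
def outerNormal {n : ℕ} (K : Set (EuclideanSpace ℝ (Fin n)))
    (x : EuclideanSpace ℝ (Fin n)) : EuclideanSpace ℝ (Fin n) :=
  if h : ∃! u, IsUnitOuterNormal K x u then h.choose else 0

/-- The support function `h_K(u) = sup_{y ∈ K} ⟨u, y⟩`. -/
def supportFunction {n : ℕ} (K : Set (EuclideanSpace ℝ (Fin n)))
    (u : EuclideanSpace ℝ (Fin n)) : ℝ :=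
  sSup ((fun y => ⟪u, y⟫) '' K)

/-- The `(n-1)`-dimensional Hausdorff measure of `ℝⁿ`, normalized so that it is the Lebesgue
measure on hyperplanes, restricted to the boundary of `K`. -/
def boundaryMeasure {n : ℕ} (K : Set (EuclideanSpace ℝ (Fin n))) :
    Measure (EuclideanSpace ℝ (Fin n)) :=
  (Measure.euclideanHausdorffMeasure (n - 1)).restrict (frontier K)

/-- The tangent space `n_xᗮ` of `∂K` at `x`. -/
abbrev boundaryTangent {n : ℕ} (K : Set (EuclideanSpace ℝ (Fin n)))
    (x : EuclideanSpace ℝ (Fin n)) : Submodule ℝ (EuclideanSpace ℝ (Fin n)) :=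
  (Submodule.span ℝ {outerNormal K x})ᗮ

/-- The gradient `∇_{∂K} f (x)` in the tangent space: it represents the derivative of `f` along
`∂K`, as a linear form on the tangent space (on which that derivative is unique). -/
def boundaryGradient {n : ℕ} (K : Set (EuclideanSpace ℝ (Fin n)))
    (f : EuclideanSpace ℝ (Fin n) → ℝ) (x : EuclideanSpace ℝ (Fin n)) : boundaryTangent K x :=
  (InnerProductSpace.toDual ℝ (boundaryTangent K x)).symm
    ((fderivWithin ℝ f (frontier K) x).comp (boundaryTangent K x).subtypeL)

/-- The second fundamental form of `∂K` at `x`, as an operator on the tangent space: the derivative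
along `∂K` of the Gauss map `x ↦ n_x`. -/
def secondFundamentalForm {n : ℕ} (K : Set (EuclideanSpace ℝ (Fin n)))
    (x : EuclideanSpace ℝ (Fin n)) : boundaryTangent K x →L[ℝ] boundaryTangent K x :=
  ((boundaryTangent K x).orthogonalProjectionOnto.comp
    (fderivWithin ℝ (outerNormal K) (frontier K) x)).comp (boundaryTangent K x).subtypeL

/-- The mean curvature `H_x = tr(II)`. -/
def meanCurvature {n : ℕ} (K : Set (EuclideanSpace ℝ (Fin n)))
    (x : EuclideanSpace ℝ (Fin n)) : ℝ :=
  LinearMap.trace ℝ (boundaryTangent K x) (secondFundamentalForm K x).toLinearMap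

open Classical in
/-- `⟨A⁻¹ ξ, ξ⟩` for a self-adjoint operator `A` and `ξ` in its range, where `A⁻¹ ξ` is any solution
`w` of `A w = ξ`; the value does not depend on `w`, and `A` need not be injective. -/
def inverseForm {V : Type*} [NormedAddCommGroup V] [InnerProductSpace ℝ V]
    (A : V →L[ℝ] V) (ξ : V) : ℝ :=
  if h : ∃ w, A w = ξ then ⟪h.choose, ξ⟫ else 0

/-- `inverseForm` does not depend on the choice of the preimage. -/
theorem inverseForm_apply {V : Type*} [NormedAddCommGroup V] [InnerProductSpace ℝ V]
    (A : V →L[ℝ] V) (hA : ∀ v w, ⟪A v, w⟫ = ⟪v, A w⟫) (w : V) :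
    inverseForm A (A w) = ⟪w, A w⟫ := by
  have h : ∃ u, A u = A w := ⟨w, rfl⟩
  rw [inverseForm, dif_pos h, ← hA, h.choose_spec, hA]

/-- The integrand `H_x f² - ⟨II⁻¹ ∇f, ∇f⟩ + f² / ⟨x, n_x⟩` of the local Log-Brunn–Minkowski
inequality. -/
def localLogBMIntegrand {n : ℕ} (K : Set (EuclideanSpace ℝ (Fin n)))
    (f : EuclideanSpace ℝ (Fin n) → ℝ) (x : EuclideanSpace ℝ (Fin n)) : ℝ :=
  meanCurvature K x * f x ^ 2
    - inverseForm (secondFundamentalForm K x) (boundaryGradient K f x)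
    + f x ^ 2 / ⟪x, outerNormal K x⟫

/-- The mixed volume `V_k(K, M) = ((n-k)! / n!) · dᵏ/dtᵏ |K + tM|` at `t = 0⁺`, for `k ≤ n`. -/
def mixedVolume {n : ℕ} (k : ℕ) (K M : Set (EuclideanSpace ℝ (Fin n))) : ℝ :=
  ((n - k).factorial : ℝ) / (n.factorial : ℝ) *
    iteratedDerivWithin k (fun t : ℝ => volume.real (K + t • M)) (Ici 0) 0

end

end LogBM

/-! Let p be the gauge of K, q = ∇p and π(y) = y / p(y). At a regular boundary point n_x = q / |q|
and ⟨x, n_x⟩ = 1 / |q|, and the area of ∂K is the image under π of the measure n |q| dy on K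
(`boundaryMeasure_eq_map`): the integral of G over ∂K is n times that of |q| · G ∘ π over K. Put φ =
|⟨q, v⟩|, S = ∫_K φ and A = ∫_K φ². Since q is homogeneous of degree 0, ∫ f = n (t|K| + S) and ∫
h_M² / ⟨x, n_x⟩ = n A.

The core is A |K| ≤ n S². Subadditivity of p gives φ ≤ p(v), so A ≤ p(v) S (`integral_inner_sq_le`).
Moreover p(v) |K| ≤ n S (`gauge_mul_volume_le_integral`): geometrically, n S is twice the projection
of K along v, and chords parallel to v are at most 2|v| / p(v) long; the proof integrates by parts
against a linear form supporting p at v.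

For (ii), adding tM amounts to sweeping K along a segment, and by convexity the swept volume is
affine in the length. Hence V₂ = 0 and n V₁ = D, twice the sweep rate. The bounds n S ≤ D
(`integral_le_sweepRate`) and p(v) |K| ≤ D (`gauge_mul_volume_le`) yield n A ≤ p(v) D ≤ D² / |K|.
Equality with v ≠ 0 forces D = p(v) |K|; then two non-overlapping translates of K fill a sweep,
every interior point lies on a chord of maximal length, and K is a cylinder (`exists_cylinder`).
Conversely, on a cylinder φ takes only the values 0 and p(v) almost everywhere, and all bounds are
equalities.

For (i), |q| times the integrand is -div W plus terms without derivatives of q, where W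
(`curvatureField`) is locally Lipschitz off the origin, homogeneous of degree 0 and tangent to the
level sets of p. Its divergence integrates to zero (`integral_gauge_mul_divergence`). The left side
becomes n (n (t²|K| + 2tS) + A), the right side is n² (t|K| + S)² / |K|; all terms in t cancel and A
|K| ≤ n S² remains. -/

namespace LogBM

/-! ### The gauge, its gradient and the outer normal. -/

section GaugeBasics

variable {n : ℕ} {K : Set (EuclideanSpace ℝ (Fin n))}

/-- The gradient of the gauge of `K`. -/
noncomputable def gaugeGradient (K : Set (EuclideanSpace ℝ (Fin n)))
    (y : EuclideanSpace ℝ (Fin n)) : EuclideanSpace ℝ (Fin n) :=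
  gradient (gauge K) y

/-- The radial projection onto the boundary of `K`. -/
noncomputable def radialProj (K : Set (EuclideanSpace ℝ (Fin n)))
    (y : EuclideanSpace ℝ (Fin n)) : EuclideanSpace ℝ (Fin n) :=
  (gauge K y)⁻¹ • y

theorem IsSymmetricConvex.mem_nhds_zero (hK : IsSymmetricConvex K) : K ∈ 𝓝 0 := by
  obtain ⟨x, hx⟩ := hK.interior_nonempty
  have hneg : -x ∈ interior K := by
    have h1 : -interior K ⊆ K := fun y hy => by
      simpa using hK.symm _ (interior_subset hy)
    exact interior_maximal h1 isOpen_interior.neg (by simpa using hx)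
  have h0 : (0 : EuclideanSpace ℝ (Fin n)) ∈ interior K := by
    have := hK.convex.interior hx hneg (by norm_num : (0 : ℝ) ≤ 1 / 2)
      (by norm_num : (0 : ℝ) ≤ 1 / 2) (by norm_num)
    simpa using this
  exact mem_interior_iff_mem_nhds.1 h0

theorem IsSymmetricConvex.absorbent (hK : IsSymmetricConvex K) : Absorbent ℝ K :=
  absorbent_nhds_zero hK.mem_nhds_zero

theorem IsSymmetricConvex.gauge_neg (hK : IsSymmetricConvex K) (y : EuclideanSpace ℝ (Fin n)) :
    gauge K (-y) = gauge K y := _root_.gauge_neg hK.symm y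

theorem gauge_smul_nonneg {s : ℝ} (hs : 0 ≤ s) (y : EuclideanSpace ℝ (Fin n)) :
    gauge K (s • y) = s * gauge K y := by
  rw [gauge_smul_of_nonneg hs, smul_eq_mul]

theorem IsSymmetricConvex.gauge_add_le (hK : IsSymmetricConvex K)
    (x y : EuclideanSpace ℝ (Fin n)) : gauge K (x + y) ≤ gauge K x + gauge K y :=
  _root_.gauge_add_le hK.convex hK.absorbent x y

theorem IsSymmetricConvex.gauge_pos (hK : IsSymmetricConvex K) {y : EuclideanSpace ℝ (Fin n)} :
    0 < gauge K y ↔ y ≠ 0 :=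
  _root_.gauge_pos hK.absorbent ((NormedSpace.isVonNBounded_iff ℝ).2 hK.bounded)

theorem IsSymmetricConvex.continuous_gauge (hK : IsSymmetricConvex K) : Continuous (gauge K) :=
  _root_.continuous_gauge hK.convex hK.mem_nhds_zero

theorem IsSymmetricConvex.mem_frontier_iff (hK : IsSymmetricConvex K)
    {x : EuclideanSpace ℝ (Fin n)} : x ∈ frontier K ↔ gauge K x = 1 :=
  (gauge_eq_one_iff_mem_frontier hK.convex hK.mem_nhds_zero).symm

theorem IsSymmetricConvex.mem_closure_iff (hK : IsSymmetricConvex K)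
    {x : EuclideanSpace ℝ (Fin n)} : x ∈ closure K ↔ gauge K x ≤ 1 :=
  (gauge_le_one_iff_mem_closure hK.convex hK.mem_nhds_zero).symm

theorem IsSymmetricConvex.mem_interior_iff (hK : IsSymmetricConvex K)
    {x : EuclideanSpace ℝ (Fin n)} : x ∈ interior K ↔ gauge K x < 1 :=
  (gauge_lt_one_iff_mem_interior hK.convex hK.mem_nhds_zero).symm

theorem IsSymmetricConvex.exists_norm_bounds (hK : IsSymmetricConvex K) :
    ∃ r R : ℝ, 0 < r ∧ 0 < R ∧ (∀ y, r * gauge K y ≤ ‖y‖) ∧ ∀ y, ‖y‖ ≤ R * gauge K y := by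
  obtain ⟨r, hr, hrK⟩ := Metric.mem_nhds_iff.1 hK.mem_nhds_zero
  obtain ⟨R, hR, hRK⟩ := hK.bounded.subset_closedBall_lt 0 0
  refine ⟨r, R, hr, hR, fun y => mul_gauge_le_norm hrK, fun y => ?_⟩
  have := le_gauge_of_subset_closedBall hK.absorbent hR.le hRK (x := y)
  rwa [div_le_iff₀ hR, mul_comm] at this

theorem IsSymmetricConvex.gauge_radialProj (hK : IsSymmetricConvex K)
    {y : EuclideanSpace ℝ (Fin n)} (hy : y ≠ 0) : gauge K (radialProj K y) = 1 := by
  have h := hK.gauge_pos.2 hy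
  rw [radialProj, gauge_smul_nonneg (by positivity), inv_mul_cancel₀ h.ne']

theorem IsSymmetricConvex.radialProj_mem_frontier (hK : IsSymmetricConvex K)
    {y : EuclideanSpace ℝ (Fin n)} (hy : y ≠ 0) : radialProj K y ∈ frontier K :=
  hK.mem_frontier_iff.2 (hK.gauge_radialProj hy)

theorem IsSymmetricConvex.ne_zero_of_mem_frontier (hK : IsSymmetricConvex K)
    {x : EuclideanSpace ℝ (Fin n)} (hx : x ∈ frontier K) : x ≠ 0 := by
  rintro rfl
  have := hK.mem_frontier_iff.1 hx
  simp at this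

theorem radialProj_smul {s : ℝ} (hs : 0 < s) (y : EuclideanSpace ℝ (Fin n)) :
    radialProj K (s • y) = radialProj K y := by
  rw [radialProj, radialProj, gauge_smul_nonneg hs.le, smul_smul, mul_inv]
  congr 1
  field_simp

theorem IsSymmetricConvex.radialProj_of_mem_frontier (hK : IsSymmetricConvex K)
    {x : EuclideanSpace ℝ (Fin n)} (hx : x ∈ frontier K) : radialProj K x = x := by
  rw [radialProj, hK.mem_frontier_iff.1 hx, inv_one, one_smul]

theorem IsSymmetricConvex.gauge_smul_radialProj (hK : IsSymmetricConvex K)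
    (y : EuclideanSpace ℝ (Fin n)) : gauge K y • radialProj K y = y := by
  rcases eq_or_ne y 0 with rfl | hy
  · simp [radialProj]
  · rw [radialProj, smul_smul, mul_inv_cancel₀ (hK.gauge_pos.2 hy).ne', one_smul]

theorem IsSymmetricConvex.measurable_radialProj (hK : IsSymmetricConvex K) :
    Measurable (radialProj K) :=
  (hK.continuous_gauge.measurable.inv).smul measurable_id

theorem measurable_gaugeGradient : Measurable (gaugeGradient K) :=
  (InnerProductSpace.toDual ℝ _).symm.continuous.measurable.comp (measurable_fderiv ℝ _)

theorem hasGradientAt_gauge {y : EuclideanSpace ℝ (Fin n)}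
    (hy : DifferentiableAt ℝ (gauge K) y) : HasGradientAt (gauge K) (gaugeGradient K y) y :=
  hy.hasGradientAt

theorem hasDerivAt_gauge_line {y : EuclideanSpace ℝ (Fin n)}
    (hy : DifferentiableAt ℝ (gauge K) y) (z : EuclideanSpace ℝ (Fin n)) :
    HasDerivAt (fun t : ℝ => gauge K (y + t • z)) ⟪gaugeGradient K y, z⟫ 0 := by
  have h := (hasGradientAt_gauge hy).hasFDerivAt.hasLineDerivAt z
  simpa [HasLineDerivAt] using h

theorem inner_gaugeGradient_self {y : EuclideanSpace ℝ (Fin n)}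
    (hy : DifferentiableAt ℝ (gauge K) y) : ⟪gaugeGradient K y, y⟫ = gauge K y := by
  have h1 := hasDerivAt_gauge_line hy y
  have h2 : HasDerivAt (fun t : ℝ => (1 + t) * gauge K y) (gauge K y) 0 := by
    simpa using ((hasDerivAt_id (0 : ℝ)).const_add 1).mul_const (gauge K y)
  have h3 : (fun t : ℝ => gauge K (y + t • y)) =ᶠ[𝓝 0] fun t : ℝ => (1 + t) * gauge K y := by
    filter_upwards [lt_mem_nhds (by norm_num : (-1 : ℝ) < 0)] with t ht
    rw [← gauge_smul_nonneg (by linarith), add_smul, one_smul]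
  exact (h1.congr_of_eventuallyEq h3.symm).unique h2

/-- Subadditivity bounds the right difference quotients of the gauge in direction `z` by `gauge K
z`. Where the gauge is not differentiable the gradient is 0 by convention, so the bound needs no
exceptional set. -/
theorem IsSymmetricConvex.inner_gaugeGradient_le (hK : IsSymmetricConvex K)
    (y z : EuclideanSpace ℝ (Fin n)) : ⟪gaugeGradient K y, z⟫ ≤ gauge K z := by
  by_cases hy : DifferentiableAt ℝ (gauge K) y
  · have h1 := (hasDerivAt_gauge_line hy z).hasDerivWithinAt (s := Ioi 0)
    rw [hasDerivWithinAt_iff_tendsto_slope' self_notMem_Ioi] at h1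
    refine le_of_tendsto h1 ?_
    filter_upwards [self_mem_nhdsWithin] with t ht
    have ht : 0 < t := ht
    rw [slope_def_field, div_le_iff₀ (by simpa using ht)]
    have := hK.gauge_add_le y (t • z)
    rw [gauge_smul_nonneg ht.le] at this
    simp only [zero_smul, add_zero]
    linarith
  · have : gaugeGradient K y = 0 := by
      rw [gaugeGradient, gradient, fderiv_zero_of_not_differentiableAt hy, map_zero]
    simp [this, gauge_nonneg]

theorem IsSymmetricConvex.abs_inner_gaugeGradient_le (hK : IsSymmetricConvex K)
    (y z : EuclideanSpace ℝ (Fin n)) : |⟪gaugeGradient K y, z⟫| ≤ gauge K z := by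
  rw [abs_le']
  refine ⟨hK.inner_gaugeGradient_le y z, ?_⟩
  rw [← inner_neg_right, ← hK.gauge_neg]
  exact hK.inner_gaugeGradient_le y (-z)

theorem IsSymmetricConvex.gaugeGradient_ne_zero (hK : IsSymmetricConvex K)
    {y : EuclideanSpace ℝ (Fin n)} (hy : DifferentiableAt ℝ (gauge K) y) (h0 : y ≠ 0) :
    gaugeGradient K y ≠ 0 := by
  intro h
  have := inner_gaugeGradient_self hy
  rw [h, inner_zero_left] at this
  exact (hK.gauge_pos.2 h0).ne this

theorem hasFDerivAt_gauge_smul {y : EuclideanSpace ℝ (Fin n)} {s : ℝ} (hs : 0 < s)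
    {L : EuclideanSpace ℝ (Fin n) →L[ℝ] ℝ} (hy : HasFDerivAt (gauge K) L y) :
    HasFDerivAt (gauge K) L (s • y) := by
  have h1 : gauge K = fun z => s * gauge K (s⁻¹ • z) := by
    funext z
    rw [gauge_smul_nonneg (by positivity), mul_inv_cancel_left₀ hs.ne']
  rw [h1]
  have h2 : HasFDerivAt (gauge K) L (s⁻¹ • (s • y)) := by
    rwa [smul_smul, inv_mul_cancel₀ hs.ne', one_smul]
  have h3 : HasFDerivAt (fun z : EuclideanSpace ℝ (Fin n) => s⁻¹ • z)
      (s⁻¹ • ContinuousLinearMap.id ℝ _) (s • y) :=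
    (s⁻¹ • ContinuousLinearMap.id ℝ (EuclideanSpace ℝ (Fin n))).hasFDerivAt
  refine ((h2.comp _ h3).const_mul s).congr_fderiv ?_
  ext z
  simp [hs.ne']

theorem differentiableAt_gauge_smul_iff {y : EuclideanSpace ℝ (Fin n)} {s : ℝ} (hs : 0 < s) :
    DifferentiableAt ℝ (gauge K) (s • y) ↔ DifferentiableAt ℝ (gauge K) y := by
  refine ⟨fun h => ?_, fun h => (hasFDerivAt_gauge_smul hs h.hasFDerivAt).differentiableAt⟩
  have := (hasFDerivAt_gauge_smul (inv_pos.2 hs) h.hasFDerivAt).differentiableAt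
  rwa [smul_smul, inv_mul_cancel₀ hs.ne', one_smul] at this

theorem gaugeGradient_smul {s : ℝ} (hs : 0 < s) (y : EuclideanSpace ℝ (Fin n)) :
    gaugeGradient K (s • y) = gaugeGradient K y := by
  by_cases hy : DifferentiableAt ℝ (gauge K) y
  · rw [gaugeGradient, gaugeGradient, gradient, gradient,
      (hasFDerivAt_gauge_smul hs hy.hasFDerivAt).fderiv]
  · rw [gaugeGradient, gaugeGradient, gradient, gradient,
      fderiv_zero_of_not_differentiableAt hy,
      fderiv_zero_of_not_differentiableAt (mt (differentiableAt_gauge_smul_iff hs).1 hy)]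

theorem IsSymmetricConvex.gaugeGradient_radialProj (hK : IsSymmetricConvex K)
    {y : EuclideanSpace ℝ (Fin n)} (hy : y ≠ 0) :
    gaugeGradient K (radialProj K y) = gaugeGradient K y :=
  gaugeGradient_smul (inv_pos.2 (hK.gauge_pos.2 hy)) y

theorem IsSymmetricConvex.differentiableAt_radialProj_iff (hK : IsSymmetricConvex K)
    {y : EuclideanSpace ℝ (Fin n)} (hy : y ≠ 0) :
    DifferentiableAt ℝ (gauge K) (radialProj K y) ↔ DifferentiableAt ℝ (gauge K) y :=
  differentiableAt_gauge_smul_iff (inv_pos.2 (hK.gauge_pos.2 hy))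

theorem IsSymmetricConvex.ae_differentiableAt_gauge (hK : IsSymmetricConvex K) :
    ∀ᵐ y, DifferentiableAt ℝ (gauge K) y := by
  obtain ⟨C, hC⟩ := hK.convex.lipschitz_gauge hK.mem_nhds_zero
  exact hC.ae_differentiableAt

/-- A unit outer normal bounds the gauge from below by a linear form. -/
theorem IsSymmetricConvex.inner_le_of_isUnitOuterNormal (hK : IsSymmetricConvex K)
    {x u : EuclideanSpace ℝ (Fin n)} (hu : IsUnitOuterNormal K x u)
    (y : EuclideanSpace ℝ (Fin n)) : ⟪y, u⟫ ≤ ⟪x, u⟫ * gauge K y := by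
  have hcl : ∀ z ∈ closure K, ⟪z, u⟫ ≤ ⟪x, u⟫ := by
    have hclosed : IsClosed {z : EuclideanSpace ℝ (Fin n) | ⟪z, u⟫ ≤ ⟪x, u⟫} :=
      isClosed_le (by fun_prop) continuous_const
    refine fun z hz => closure_minimal (fun w hw => ?_) hclosed hz
    have := hu.2 w hw
    rw [inner_sub_left] at this
    exact sub_nonpos.1 this
  rcases eq_or_ne y 0 with rfl | hy
  · simp
  · have h := hcl _ (hK.mem_closure_iff.2 (hK.gauge_radialProj hy).le)
    rw [radialProj, inner_smul_left] at h
    have hp := hK.gauge_pos.2 hy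
    simp only [map_inv₀, conj_trivial] at h
    rwa [inv_mul_le_iff₀ hp, mul_comm] at h

/-- Testing the supporting inequality at `u` itself gives 1 ≤ ⟪x, u⟫ · gauge K u. -/
theorem IsSymmetricConvex.inner_pos_of_isUnitOuterNormal (hK : IsSymmetricConvex K)
    {x u : EuclideanSpace ℝ (Fin n)} (hu : IsUnitOuterNormal K x u) : 0 < ⟪x, u⟫ := by
  have h := hK.inner_le_of_isUnitOuterNormal hu u
  rw [real_inner_self_eq_norm_sq, hu.1] at h
  have h0 := gauge_nonneg (s := K) u
  by_contra hneg
  nlinarith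

theorem IsSymmetricConvex.isUnitOuterNormal_iff (hK : IsSymmetricConvex K)
    {x u : EuclideanSpace ℝ (Fin n)} :
    IsUnitOuterNormal K x u ↔ ‖u‖ = 1 ∧ ∀ y, ⟪y, u⟫ ≤ ⟪x, u⟫ * gauge K y := by
  refine ⟨fun h => ⟨h.1, hK.inner_le_of_isUnitOuterNormal h⟩, fun h => ⟨h.1, fun y hy => ?_⟩⟩
  have h1 := h.2 y
  have h2 := h.2 u
  rw [real_inner_self_eq_norm_sq, h.1] at h2
  have h3 : 0 ≤ ⟪x, u⟫ := by
    by_contra hneg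
    nlinarith [gauge_nonneg (s := K) u]
  rw [inner_sub_left]
  nlinarith [gauge_le_one_of_mem hy]

/-- Supporting functionals: a linear form below the gauge which touches it at a given point. -/
theorem IsSymmetricConvex.exists_inner_le_gauge (hK : IsSymmetricConvex K)
    {x : EuclideanSpace ℝ (Fin n)} (hx : x ≠ 0) :
    ∃ w : EuclideanSpace ℝ (Fin n), ⟪w, x⟫ = gauge K x ∧ ∀ y, |⟪w, y⟫| ≤ gauge K y := by
  have hp := hK.gauge_pos.2 hx
  obtain ⟨g, hg⟩ := geometric_hahn_banach_open_point hK.convex.interior isOpen_interior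
    (x := radialProj K x) (by rw [hK.mem_interior_iff, hK.gauge_radialProj hx]; exact lt_irrefl _)
  have hc : 0 < g (radialProj K x) := by
    have := hg 0 (by rw [hK.mem_interior_iff]; simp)
    simpa using this
  set c := g (radialProj K x) with hcdef
  have hle : ∀ y, g y ≤ c * gauge K y := by
    intro y
    rcases eq_or_ne y 0 with rfl | hy
    · simp
    have hpy := hK.gauge_pos.2 hy
    -- The separating form is controlled only on the open interior, so `y` is divided by slightly
    -- more than its gauge.
    refine le_of_forall_pos_lt_add fun ε hε => ?_
    have hs : 0 < gauge K y + ε / c := by positivity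
    have := hg ((gauge K y + ε / c)⁻¹ • y) (by
      rw [hK.mem_interior_iff, gauge_smul_nonneg (by positivity), inv_mul_lt_iff₀ hs]
      have : 0 < ε / c := by positivity
      linarith)
    rw [map_smul, smul_eq_mul, inv_mul_lt_iff₀ hs] at this
    calc g y < (gauge K y + ε / c) * c := this
      _ = c * gauge K y + ε := by field_simp
  refine ⟨c⁻¹ • (InnerProductSpace.toDual ℝ _).symm g, ?_, fun y => ?_⟩
  · rw [inner_smul_left, InnerProductSpace.toDual_symm_apply]
    have : g x = gauge K x * c := by
      conv_lhs => rw [← hK.gauge_smul_radialProj x]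
      rw [map_smul, smul_eq_mul]
    rw [this]
    simp only [map_inv₀, conj_trivial]
    field_simp
  · rw [inner_smul_left, InnerProductSpace.toDual_symm_apply]
    simp only [map_inv₀, conj_trivial]
    rw [abs_le']
    constructor
    · rw [inv_mul_le_iff₀ hc]; exact hle y
    · have := hle (-y)
      rw [map_neg, hK.gauge_neg] at this
      rw [← mul_neg, inv_mul_le_iff₀ hc]; exact this

theorem IsSymmetricConvex.exists_isUnitOuterNormal (hK : IsSymmetricConvex K)
    {x : EuclideanSpace ℝ (Fin n)} (hx : x ∈ frontier K) : ∃ u, IsUnitOuterNormal K x u := by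
  obtain ⟨w, hw, hwle⟩ := hK.exists_inner_le_gauge (hK.ne_zero_of_mem_frontier hx)
  rw [hK.mem_frontier_iff.1 hx] at hw
  have hw0 : w ≠ 0 := by rintro rfl; simp at hw
  have hwn : 0 < ‖w‖ := norm_pos_iff.2 hw0
  refine ⟨‖w‖⁻¹ • w, hK.isUnitOuterNormal_iff.2 ⟨?_, fun y => ?_⟩⟩
  · rw [norm_smul, norm_inv, norm_norm, inv_mul_cancel₀ hwn.ne']
  · rw [inner_smul_right, inner_smul_right, real_inner_comm, real_inner_comm w x, hw, mul_one]
    gcongr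
    exact (le_abs_self _).trans (hwle y)

/-- At a boundary point where the gauge is differentiable, every normal is its normalized gradient.
-/
theorem IsSymmetricConvex.eq_of_isUnitOuterNormal (hK : IsSymmetricConvex K)
    {x u : EuclideanSpace ℝ (Fin n)} (hx : x ∈ frontier K)
    (hd : DifferentiableAt ℝ (gauge K) x) (hu : IsUnitOuterNormal K x u) :
    gaugeGradient K x = ⟪x, u⟫⁻¹ • u := by
  have hpos := hK.inner_pos_of_isUnitOuterNormal hu
  have hg := hasGradientAt_gauge hd
  have h2 : HasGradientAt (fun y => gauge K y - ⟪⟪x, u⟫⁻¹ • u, y⟫)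
      (gaugeGradient K x - ⟪x, u⟫⁻¹ • u) x := by
    rw [hasGradientAt_iff_hasFDerivAt, map_sub]
    exact hg.hasFDerivAt.sub (InnerProductSpace.toDual ℝ _ _).hasFDerivAt
  -- The gauge minus the normalized supporting form is nonnegative everywhere and vanishes at `x`,
  -- so its gradient there is zero.
  have hmin : IsLocalMin (fun y => gauge K y - ⟪⟪x, u⟫⁻¹ • u, y⟫) x := by
    refine Filter.Eventually.of_forall fun y => ?_
    have h3 := hK.inner_le_of_isUnitOuterNormal hu y
    simp only [inner_smul_left, map_inv₀, conj_trivial]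
    rw [real_inner_comm x u, inv_mul_cancel₀ hpos.ne', hK.mem_frontier_iff.1 hx, sub_self,
      sub_nonneg, inv_mul_le_iff₀ hpos, real_inner_comm]
    exact h3
  have h4 := hmin.hasFDerivAt_eq_zero h2.hasFDerivAt
  have h5 : gaugeGradient K x - ⟪x, u⟫⁻¹ • u = 0 :=
    (InnerProductSpace.toDual ℝ (EuclideanSpace ℝ (Fin n))).map_eq_zero_iff.1 h4
  exact sub_eq_zero.1 h5

theorem IsSymmetricConvex.outerNormal_eq (hK : IsSymmetricConvex K)
    {x : EuclideanSpace ℝ (Fin n)} (hx : x ∈ frontier K)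
    (hd : DifferentiableAt ℝ (gauge K) x) :
    outerNormal K x = ‖gaugeGradient K x‖⁻¹ • gaugeGradient K x := by
  have key : ∀ u, IsUnitOuterNormal K x u → u = ‖gaugeGradient K x‖⁻¹ • gaugeGradient K x := by
    intro u hu
    have hpos := hK.inner_pos_of_isUnitOuterNormal hu
    rw [hK.eq_of_isUnitOuterNormal hx hd hu, norm_smul, hu.1, mul_one, norm_inv,
      Real.norm_of_nonneg hpos.le, inv_inv, smul_smul, mul_inv_cancel₀ hpos.ne', one_smul]
  obtain ⟨u, hu⟩ := hK.exists_isUnitOuterNormal hx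
  have hex : ∃! u, IsUnitOuterNormal K x u :=
    ⟨u, hu, fun w hw => (key w hw).trans (key u hu).symm⟩
  rw [outerNormal, dif_pos hex]
  exact key _ hex.choose_spec.1

theorem IsSymmetricConvex.isUnitOuterNormal_gaugeGradient (hK : IsSymmetricConvex K)
    {x : EuclideanSpace ℝ (Fin n)} (hx : x ∈ frontier K)
    (hd : DifferentiableAt ℝ (gauge K) x) :
    IsUnitOuterNormal K x (‖gaugeGradient K x‖⁻¹ • gaugeGradient K x) := by
  obtain ⟨u, hu⟩ := hK.exists_isUnitOuterNormal hx
  have hpos := hK.inner_pos_of_isUnitOuterNormal hu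
  have : ‖gaugeGradient K x‖⁻¹ • gaugeGradient K x = u := by
    rw [hK.eq_of_isUnitOuterNormal hx hd hu, norm_smul, hu.1, mul_one, norm_inv,
      Real.norm_of_nonneg hpos.le, inv_inv, smul_smul, mul_inv_cancel₀ hpos.ne', one_smul]
  rwa [this]

end GaugeBasics

/-! ### Cones over flat and nearly flat sets. -/

section Cone

variable {n : ℕ}

theorem euclideanHausdorffMeasure_image_le {X Y : Type*} [EMetricSpace X] [EMetricSpace Y]
    [MeasurableSpace X] [BorelSpace X] [MeasurableSpace Y] [BorelSpace Y] {C : NNReal} {f : X → Y}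
    {s : Set X} (h : LipschitzOnWith C f s) (d : ℕ) :
    Measure.euclideanHausdorffMeasure d (f '' s)
      ≤ (C : ENNReal) ^ d * Measure.euclideanHausdorffMeasure d s := by
  have := h.hausdorffMeasure_image_le (d := d) (by positivity)
  rw [ENNReal.rpow_natCast] at this
  simp only [Measure.euclideanHausdorffMeasure_def, Measure.smul_apply, ENNReal.smul_def,
    smul_eq_mul]
  calc _ ≤ _ * ((C : ENNReal) ^ d * _) := by gcongr
    _ = _ := by ring

/-- The slice at height x of a cone whose base lies at height c has (x/c)^(n-1) times the area of
the base; this is the resulting integral over the heights. -/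
theorem lintegral_Ioc_div_pow (hn : 1 ≤ n) {c : ℝ} (hc : 0 < c) :
    (n : ENNReal) * ∫⁻ x in Ioc 0 c, ENNReal.ofReal ((x / c) ^ (n - 1)) = ENNReal.ofReal c := by
  have hint : IntegrableOn (fun x : ℝ => (x / c) ^ (n - 1)) (Ioc 0 c) :=
    (Continuous.integrableOn_Icc (by fun_prop)).mono_set Ioc_subset_Icc_self
  rw [← ofReal_integral_eq_lintegral_ofReal hint, ← intervalIntegral.integral_of_le hc.le]
  · have h1 : ∫ x in (0 : ℝ)..c, (x / c) ^ (n - 1) = c / n := by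
      rw [intervalIntegral.integral_comp_div (fun x => x ^ (n - 1)) hc.ne', zero_div,
        div_self hc.ne', integral_pow]
      have : ((n - 1 : ℕ) : ℝ) + 1 = n := by
        rw [Nat.cast_sub hn]; simp
      rw [this, Nat.sub_add_cancel hn, smul_eq_mul, one_pow, zero_pow (by omega)]
      ring
    rw [h1, ← ENNReal.ofReal_natCast, ← ENNReal.ofReal_mul (by positivity)]
    congr 1
    have : (n : ℝ) ≠ 0 := by positivity
    field_simp
  · filter_upwards [ae_restrict_mem measurableSet_Ioc] with x hx
    have := hx.1
    simp only [Pi.zero_apply]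
    positivity

theorem volume_eq_lintegral_slices {u : EuclideanSpace ℝ (Fin n)} (hu : ‖u‖ = 1)
    {t : Set (EuclideanSpace ℝ (Fin n))} (ht : MeasurableSet t) :
    volume t = ∫⁻ x : ℝ, Measure.euclideanHausdorffMeasure (n - 1) (t ∩ {y | ⟪u, y⟫ = x}) := by
  have h := EuclideanGeometry.euclideanHausdorffMeasure_eq_lintegral
    (0 : EuclideanSpace ℝ (Fin n)) (v := u) (by rintro rfl; simp at hu) ht
  have hu' : ‖u‖ₑ = 1 := by rw [← ofReal_norm, hu, ENNReal.ofReal_one]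
  rw [finrank_euclideanSpace_fin, EuclideanSpace.euclideanHausdorffMeasure_eq_volume, hu',
    one_mul] at h
  rw [h]
  refine lintegral_congr fun x => ?_
  congr 2
  ext y
  rw [SetLike.mem_coe, AffineSubspace.mem_mk', Submodule.mem_orthogonal_singleton_iff_inner_right]
  simp only [vadd_eq_add, add_zero, vsub_eq_sub, inner_sub_right, inner_smul_right,
    real_inner_self_eq_norm_sq, hu, mem_ofPred_eq]
  constructor <;> intro h <;> linarith

/-- The volume of a cone over a set in a hyperplane. -/
theorem volume_cone_of_subset_hyperplane (hn : 1 ≤ n) {u : EuclideanSpace ℝ (Fin n)}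
    (hu : ‖u‖ = 1) {c : ℝ} (hc : 0 < c) {B : Set (EuclideanSpace ℝ (Fin n))}
    (hB : ∀ x ∈ B, ⟪u, x⟫ = c) :
    n * volume (Ioc (0 : ℝ) 1 • B)
      = ENNReal.ofReal c * Measure.euclideanHausdorffMeasure (n - 1) B := by
  have hslice : ∀ x ∈ Ioc 0 c, ∀ D : Set (EuclideanSpace ℝ (Fin n)),
      Measure.euclideanHausdorffMeasure (n - 1) ((x / c) • D) = ENNReal.ofReal ((x / c) ^ (n - 1))
        * Measure.euclideanHausdorffMeasure (n - 1) D := by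
    intro x hx D
    have hxc : 0 < x / c := div_pos hx.1 hc
    rw [Measure.euclideanHausdorffMeasure_smul₀ _ hxc.ne', ENNReal.smul_def, smul_eq_mul,
      ENNReal.coe_pow, ENNReal.ofReal_pow hxc.le]
    congr 2
    rw [← enorm_eq_nnnorm, Real.enorm_eq_ofReal hxc.le]
  refine le_antisymm ?_ ?_
  -- `B` need not be measurable. For the upper bound the base is replaced by a measurable hull, for
  -- the lower bound the cone is.
  · set B' := toMeasurable (Measure.euclideanHausdorffMeasure (n - 1)) B with hB'
    set T : Set (EuclideanSpace ℝ (Fin n)) :=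
      {y | 0 < ⟪u, y⟫ ∧ ⟪u, y⟫ ≤ c ∧ (c / ⟪u, y⟫) • y ∈ B'} with hT
    have hTm : MeasurableSet T := by
      have hi : Measurable fun y : EuclideanSpace ℝ (Fin n) => ⟪u, y⟫ := by fun_prop
      refine (measurableSet_lt measurable_const hi).inter
        ((measurableSet_le hi measurable_const).inter ?_)
      have hm : Measurable fun y : EuclideanSpace ℝ (Fin n) => (c / ⟪u, y⟫) • y :=
        (measurable_const.div hi).smul measurable_id
      exact hm (measurableSet_toMeasurable _ _)
    have hsub : Ioc (0 : ℝ) 1 • B ⊆ T := by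
      rintro _ ⟨r, hr, x, hx, rfl⟩
      simp only [hT, mem_ofPred_eq, inner_smul_right, hB x hx]
      refine ⟨mul_pos hr.1 hc, by nlinarith [hr.2], ?_⟩
      have : c / (r * c) * r = 1 := by
        have := hr.1.ne'
        field_simp
      rw [smul_smul, this, one_smul]
      exact subset_toMeasurable _ _ hx
    have hle : ∀ x : ℝ, Measure.euclideanHausdorffMeasure (n - 1) (T ∩ {y | ⟪u, y⟫ = x})
        ≤ (Ioc 0 c).indicator (fun x => ENNReal.ofReal ((x / c) ^ (n - 1))
          * Measure.euclideanHausdorffMeasure (n - 1) B) x := by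
      intro x
      by_cases hx : x ∈ Ioc 0 c
      · rw [indicator_of_mem hx, ← measure_toMeasurable (s := B), ← hslice x hx]
        refine measure_mono ?_
        rintro y ⟨⟨h1, h2, h3⟩, rfl⟩
        refine ⟨_, h3, ?_⟩
        have : ⟪u, y⟫ / c * (c / ⟪u, y⟫) = 1 := by field_simp
        simp only [smul_smul, this, one_smul]
      · have : T ∩ {y | ⟪u, y⟫ = x} = ∅ := by
          ext y
          simp only [mem_inter_iff, mem_ofPred_eq, mem_empty_iff_false, iff_false, not_and]
          rintro ⟨h1, h2, -⟩ rfl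
          exact hx ⟨h1, h2⟩
        simp [this]
    calc n * volume (Ioc (0 : ℝ) 1 • B) ≤ n * volume T := by gcongr
      _ ≤ n * ∫⁻ x, (Ioc 0 c).indicator (fun x => ENNReal.ofReal ((x / c) ^ (n - 1))
          * Measure.euclideanHausdorffMeasure (n - 1) B) x := by
        rw [volume_eq_lintegral_slices hu hTm]
        gcongr
        exact hle _
      _ = ENNReal.ofReal c * Measure.euclideanHausdorffMeasure (n - 1) B := by
        rw [lintegral_indicator measurableSet_Ioc, lintegral_mul_const _ (by fun_prop),
          ← mul_assoc, lintegral_Ioc_div_pow hn hc]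
  · set T := toMeasurable volume (Ioc (0 : ℝ) 1 • B) with hT
    have hTm : MeasurableSet T := measurableSet_toMeasurable _ _
    have hle : ∀ x : ℝ, (Ioc 0 c).indicator (fun x => ENNReal.ofReal ((x / c) ^ (n - 1))
          * Measure.euclideanHausdorffMeasure (n - 1) B) x
        ≤ Measure.euclideanHausdorffMeasure (n - 1) (T ∩ {y | ⟪u, y⟫ = x}) := by
      intro x
      by_cases hx : x ∈ Ioc 0 c
      · rw [indicator_of_mem hx, ← hslice x hx]
        refine measure_mono ?_
        rintro _ ⟨b, hb, rfl⟩
        refine ⟨subset_toMeasurable _ _ ⟨x / c, ⟨div_pos hx.1 hc, (div_le_one hc).2 hx.2⟩, b, hb,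
          rfl⟩, ?_⟩
        simp only [mem_ofPred_eq, inner_smul_right, hB b hb]
        field_simp
      · rw [indicator_of_notMem hx]
        exact zero_le
    calc ENNReal.ofReal c * Measure.euclideanHausdorffMeasure (n - 1) B
        = n * ∫⁻ x, (Ioc 0 c).indicator (fun x => ENNReal.ofReal ((x / c) ^ (n - 1))
          * Measure.euclideanHausdorffMeasure (n - 1) B) x := by
          rw [lintegral_indicator measurableSet_Ioc, lintegral_mul_const _ (by fun_prop),
            ← mul_assoc, lintegral_Ioc_div_pow hn hc]
      _ ≤ n * volume T := by
        rw [volume_eq_lintegral_slices hu hTm]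
        gcongr
        exact hle _
      _ = n * volume (Ioc (0 : ℝ) 1 • B) := by rw [hT, measure_toMeasurable]

/-- Comparison of the area of a nearly flat set with the volume of the cone over it. -/
theorem cone_comparison (hn : 1 ≤ n) {u : EuclideanSpace ℝ (Fin n)} (hu : ‖u‖ = 1) {c R κ : ℝ}
    (hc : 0 < c) (hR : 0 < R) (hκ0 : 0 ≤ κ) (hκ : κ < 1 / 2)
    {A : Set (EuclideanSpace ℝ (Fin n))} (hA : ∀ x ∈ A, |⟪u, x⟫ - c| ≤ κ * c)
    (hAR : ∀ x ∈ A, ‖x‖ ≤ R)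
    (hAA : ∀ x ∈ A, ∀ y ∈ A, |⟪u, x - y⟫| ≤ κ * (c / R) * ‖x - y‖) :
    ENNReal.ofReal c * Measure.euclideanHausdorffMeasure (n - 1) A
        ≤ ENNReal.ofReal ((1 - 2 * κ)⁻¹ ^ (2 * n)) * (n * volume (Ioc (0 : ℝ) 1 • A)) ∧
      n * volume (Ioc (0 : ℝ) 1 • A) ≤ ENNReal.ofReal ((1 - 2 * κ)⁻¹ ^ (2 * n)) *
        (ENNReal.ofReal c * Measure.euclideanHausdorffMeasure (n - 1) A) := by
  set L : ℝ := (1 - 2 * κ)⁻¹ with hL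
  have hpos : 0 < 1 - 2 * κ := by linarith
  have hLpos : 0 < L := inv_pos.2 hpos
  have hL1 : 1 ≤ L := (one_le_inv₀ hpos).2 (by linarith)
  -- Radial projection onto the hyperplane ⟪u, ·⟫ = c, where the exact cone formula holds.
  -- Near-flatness of `A` makes θ bi-Lipschitz with constant `L` in both directions.
  set θ : EuclideanSpace ℝ (Fin n) → EuclideanSpace ℝ (Fin n) := fun x => (c / ⟪u, x⟫) • x with hθ
  have hlo : ∀ x ∈ A, (1 - κ) * c ≤ ⟪u, x⟫ := fun x hx => by
    have := (abs_le.1 (hA x hx)).1; linarith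
  have hhi : ∀ x ∈ A, ⟪u, x⟫ ≤ (1 + κ) * c := fun x hx => by
    have := (abs_le.1 (hA x hx)).2; linarith
  have hapos : ∀ x ∈ A, 0 < ⟪u, x⟫ := fun x hx =>
    lt_of_lt_of_le (mul_pos (by linarith) hc) (hlo x hx)
  have hratio : ∀ x ∈ A, c / ⟪u, x⟫ ≤ (1 - κ)⁻¹ := fun x hx => by
    rw [div_le_iff₀ (hapos x hx), le_inv_mul_iff₀ (by linarith)]
    exact hlo x hx
  have h1κ : (0 : ℝ) < 1 - κ := by linarith
  have hdiff : ∀ x ∈ A, ∀ y ∈ A,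
      ‖((⟪u, y⟫ - ⟪u, x⟫) / ⟪u, y⟫) • y‖ ≤ κ * (1 - κ)⁻¹ * ‖x - y‖ := by
    intro x hx y hy
    have h1 := hAA x hx y hy
    rw [inner_sub_right, abs_sub_comm] at h1
    have hay := hapos y hy
    rw [norm_smul, Real.norm_eq_abs, abs_div, abs_of_pos hay]
    calc |⟪u, y⟫ - ⟪u, x⟫| / ⟪u, y⟫ * ‖y‖ ≤ κ * (c / R) * ‖x - y‖ / ⟪u, y⟫ * R := by
          gcongr
          exact hAR y hy
      _ = κ * (c / ⟪u, y⟫) * ‖x - y‖ := by field_simp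
      _ ≤ κ * (1 - κ)⁻¹ * ‖x - y‖ := by gcongr; exact hratio y hy
  have hup : ∀ x ∈ A, ∀ y ∈ A, ‖θ x - θ y‖ ≤ L * ‖x - y‖ := by
    intro x hx y hy
    have hax := hapos x hx
    have hay := hapos y hy
    have heq : θ x - θ y = (c / ⟪u, x⟫) • ((x - y) + ((⟪u, y⟫ - ⟪u, x⟫) / ⟪u, y⟫) • y) := by
      simp only [hθ]
      rw [smul_add, smul_sub, smul_smul, sub_add, ← sub_smul]
      congr 2
      field_simp
      ring
    rw [heq, norm_smul, Real.norm_of_nonneg (by positivity)]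
    calc c / ⟪u, x⟫ * ‖(x - y) + ((⟪u, y⟫ - ⟪u, x⟫) / ⟪u, y⟫) • y‖
        ≤ (1 - κ)⁻¹ * (‖x - y‖ + κ * (1 - κ)⁻¹ * ‖x - y‖) := by
          gcongr
          · exact hratio x hx
          · exact (norm_add_le _ _).trans (by gcongr; exact hdiff x hx y hy)
      _ = ((1 - κ) ^ 2)⁻¹ * ‖x - y‖ := by field_simp; ring
      _ ≤ L * ‖x - y‖ := by
          gcongr
          rw [hL]
          gcongr
          nlinarith
  have hdown : ∀ x ∈ A, ∀ y ∈ A, ‖x - y‖ ≤ L * ‖θ x - θ y‖ := by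
    intro x hx y hy
    have hax := hapos x hx
    have hay := hapos y hy
    have heq : x - y = (⟪u, x⟫ / c) • (θ x - θ y) - ((⟪u, y⟫ - ⟪u, x⟫) / ⟪u, y⟫) • y := by
      simp only [hθ]
      rw [smul_sub, smul_smul, smul_smul, sub_sub, ← add_smul]
      congr 1
      · rw [show ⟪u, x⟫ / c * (c / ⟪u, x⟫) = 1 by field_simp, one_smul]
      · rw [show ⟪u, x⟫ / c * (c / ⟪u, y⟫) + (⟪u, y⟫ - ⟪u, x⟫) / ⟪u, y⟫ = 1 by field_simp; ring,
          one_smul]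
    have h2 : ‖x - y‖ ≤ (1 + κ) * ‖θ x - θ y‖ + κ * (1 - κ)⁻¹ * ‖x - y‖ := by
      calc ‖x - y‖ ≤ ‖(⟪u, x⟫ / c) • (θ x - θ y)‖ + ‖((⟪u, y⟫ - ⟪u, x⟫) / ⟪u, y⟫) • y‖ := by
            conv_lhs => rw [heq]
            exact norm_sub_le _ _
        _ ≤ (1 + κ) * ‖θ x - θ y‖ + κ * (1 - κ)⁻¹ * ‖x - y‖ := by
            gcongr
            · rw [norm_smul, Real.norm_of_nonneg (by positivity)]
              gcongr
              rw [div_le_iff₀ hc]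
              exact hhi x hx
            · exact hdiff x hx y hy
    have h3 : (1 - κ) * ‖x - y‖ ≤ (1 - κ) * (1 + κ) * ‖θ x - θ y‖ + κ * ‖x - y‖ := by
      calc (1 - κ) * ‖x - y‖ ≤ (1 - κ) * ((1 + κ) * ‖θ x - θ y‖ + κ * (1 - κ)⁻¹ * ‖x - y‖) := by
            gcongr
        _ = _ := by field_simp
    rw [hL, le_inv_mul_iff₀ hpos]
    nlinarith [norm_nonneg (θ x - θ y), sq_nonneg κ]
  have hLcoe : ((L.toNNReal : NNReal) : ENNReal) = ENNReal.ofReal L := rfl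
  -- The exponent 2n pays for a factor L^(n-1) in Hausdorff measure and L^n in volume; one factor L
  -- ≥ 1 is spare.
  have hL2 : ENNReal.ofReal (L ^ (2 * n)) = ENNReal.ofReal L * ENNReal.ofReal L ^ (n - 1)
      * ENNReal.ofReal L ^ n := by
    rw [ENNReal.ofReal_pow hLpos.le, mul_assoc, ← pow_add, ← pow_succ']
    congr 1
    omega
  have hone : (1 : ENNReal) ≤ ENNReal.ofReal L := by simpa using hL1
  have hμ1 : Measure.euclideanHausdorffMeasure (n - 1) (θ '' A)
      ≤ ENNReal.ofReal L ^ (n - 1) * Measure.euclideanHausdorffMeasure (n - 1) A := by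
    rw [← hLcoe]
    refine euclideanHausdorffMeasure_image_le (LipschitzOnWith.of_dist_le_mul fun x hx y hy => ?_) _
    rw [dist_eq_norm, dist_eq_norm, Real.coe_toNNReal _ hLpos.le]
    exact hup x hx y hy
  have hinj : InjOn θ A := fun x hx y hy h => by
    have := hdown x hx y hy
    rw [h, sub_self, norm_zero, mul_zero] at this
    exact sub_eq_zero.1 (norm_le_zero_iff.1 this)
  have hμ2 : Measure.euclideanHausdorffMeasure (n - 1) A
      ≤ ENNReal.ofReal L ^ (n - 1) * Measure.euclideanHausdorffMeasure (n - 1) (θ '' A) := by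
    rw [← hLcoe]
    have hinv : LipschitzOnWith L.toNNReal (Function.invFunOn θ A) (θ '' A) := by
      refine LipschitzOnWith.of_dist_le_mul ?_
      rintro _ ⟨x, hx, rfl⟩ _ ⟨y, hy, rfl⟩
      rw [hinj.leftInvOn_invFunOn hx, hinj.leftInvOn_invFunOn hy, dist_eq_norm, dist_eq_norm,
        Real.coe_toNNReal _ hLpos.le]
      exact hdown x hx y hy
    have := euclideanHausdorffMeasure_image_le hinv (n - 1)
    rwa [hinj.leftInvOn_invFunOn.image_image] at this
  have hvol : ∀ D D' : Set (EuclideanSpace ℝ (Fin n)), (∀ x ∈ D, ∃ s ∈ Ioc 0 L, ∃ y ∈ D',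
      x = s • y) → volume (Ioc (0 : ℝ) 1 • D) ≤ ENNReal.ofReal L ^ n *
        volume (Ioc (0 : ℝ) 1 • D') := by
    intro D D' h
    have hsub : Ioc (0 : ℝ) 1 • D ⊆ L • (Ioc (0 : ℝ) 1 • D') := by
      rintro _ ⟨r, hr, x, hx, rfl⟩
      obtain ⟨s, hs, y, hy, rfl⟩ := h x hx
      refine ⟨(r * s / L) • y, ⟨r * s / L, ⟨by have := hr.1; have := hs.1; positivity, ?_⟩, y, hy,
        rfl⟩, ?_⟩
      · rw [div_le_one hLpos]
        nlinarith [hr.1, hr.2, hs.1, hs.2]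
      · simp only [smul_smul]
        congr 1
        field_simp
    calc volume (Ioc (0 : ℝ) 1 • D) ≤ volume (L • (Ioc (0 : ℝ) 1 • D')) := measure_mono hsub
      _ = _ := by
        rw [Measure.addHaar_smul, finrank_euclideanSpace_fin, abs_of_pos (by positivity),
          ENNReal.ofReal_pow hLpos.le]
  have hv1 : volume (Ioc (0 : ℝ) 1 • (θ '' A)) ≤ ENNReal.ofReal L ^ n *
      volume (Ioc (0 : ℝ) 1 • A) := by
    refine hvol _ _ ?_
    rintro _ ⟨x, hx, rfl⟩
    refine ⟨c / ⟪u, x⟫, ⟨div_pos hc (hapos x hx), (hratio x hx).trans ?_⟩, x, hx, rfl⟩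
    rw [hL]
    gcongr
    linarith
  have hv2 : volume (Ioc (0 : ℝ) 1 • A) ≤ ENNReal.ofReal L ^ n *
      volume (Ioc (0 : ℝ) 1 • (θ '' A)) := by
    refine hvol _ _ fun x hx => ⟨⟪u, x⟫ / c, ⟨div_pos (hapos x hx) hc, ?_⟩, θ x, ⟨x, hx, rfl⟩, ?_⟩
    · rw [div_le_iff₀ hc]
      refine (hhi x hx).trans ?_
      gcongr
      rw [hL, le_inv_comm₀ (by linarith) hpos, inv_eq_one_div, le_div_iff₀ (by linarith)]
      nlinarith
    · have := (hapos x hx).ne'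
      simp only [hθ, smul_smul]
      rw [show ⟪u, x⟫ / c * (c / ⟪u, x⟫) = 1 by field_simp, one_smul]
  have hflat := volume_cone_of_subset_hyperplane hn hu hc (B := θ '' A) (by
    rintro _ ⟨x, hx, rfl⟩
    have := (hapos x hx).ne'
    simp only [hθ, inner_smul_right]
    field_simp)
  constructor
  · calc ENNReal.ofReal c * Measure.euclideanHausdorffMeasure (n - 1) A
        ≤ ENNReal.ofReal c * (ENNReal.ofReal L ^ (n - 1) *
          Measure.euclideanHausdorffMeasure (n - 1) (θ '' A)) := by gcongr
      _ = ENNReal.ofReal L ^ (n - 1) * (n * volume (Ioc (0 : ℝ) 1 • (θ '' A))) := by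
        rw [hflat]; ring
      _ ≤ ENNReal.ofReal L ^ (n - 1) * (n * (ENNReal.ofReal L ^ n *
          volume (Ioc (0 : ℝ) 1 • A))) := by gcongr
      _ = 1 * ENNReal.ofReal L ^ (n - 1) * ENNReal.ofReal L ^ n *
          (n * volume (Ioc (0 : ℝ) 1 • A)) := by ring
      _ ≤ _ := by rw [hL2]; gcongr
  · calc n * volume (Ioc (0 : ℝ) 1 • A)
        ≤ n * (ENNReal.ofReal L ^ n * volume (Ioc (0 : ℝ) 1 • (θ '' A))) := by gcongr
      _ = ENNReal.ofReal L ^ n * (n * volume (Ioc (0 : ℝ) 1 • (θ '' A))) := by ring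
      _ ≤ ENNReal.ofReal L ^ n * (ENNReal.ofReal c * (ENNReal.ofReal L ^ (n - 1) *
          Measure.euclideanHausdorffMeasure (n - 1) A)) := by rw [hflat]; gcongr
      _ = 1 * ENNReal.ofReal L ^ (n - 1) * ENNReal.ofReal L ^ n *
          (ENNReal.ofReal c * Measure.euclideanHausdorffMeasure (n - 1) A) := by ring
      _ ≤ _ := by rw [hL2]; gcongr

end Cone

/-! ### Boundary area as the radial image of a weighted volume. -/

section BoundaryFormula

variable {n : ℕ} {K : Set (EuclideanSpace ℝ (Fin n))}

/-- Inequalities between measures can be checked on the members of a countable cover. -/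
theorem measure_le_mul_of_cover {α : Type*} [MeasurableSpace α] {μ ν : Measure α} {C : ENNReal}
    {U : ℕ → Set α} (hU : ∀ i, MeasurableSet (U i)) {A : Set α} (hA : MeasurableSet A)
    (hAU : A ⊆ ⋃ i, U i) (h : ∀ i, ∀ B ⊆ A ∩ U i, MeasurableSet B → μ B ≤ C * ν B) :
    μ A ≤ C * ν A := by
  have hA' : A = ⋃ i, A ∩ disjointed U i := by
    rw [← inter_iUnion, iUnion_disjointed, inter_eq_left.2 hAU]
  have hd : Pairwise (Function.onFun Disjoint fun i => A ∩ disjointed U i) := fun i j hij =>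
    (disjoint_disjointed U hij).mono inter_subset_right inter_subset_right
  have hm : ∀ i, MeasurableSet (A ∩ disjointed U i) := fun i =>
    hA.inter (MeasurableSet.disjointed hU i)
  calc μ A = ∑' i, μ (A ∩ disjointed U i) := by
        conv_lhs => rw [hA']
        exact measure_iUnion hd hm
    _ ≤ ∑' i, C * ν (A ∩ disjointed U i) :=
        ENNReal.tsum_le_tsum fun i =>
          h i _ (inter_subset_inter_right _ (disjointed_subset U i)) (hm i)
    _ = C * ν A := by
        rw [ENNReal.tsum_mul_left, ← measure_iUnion hd hm, ← hA']

/-- `K` need not be closed, so the two sets can differ on the frontier, which is a null set by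
convexity. -/
theorem IsSymmetricConvex.volume_preimage_radialProj (hK : IsSymmetricConvex K) (hn : 1 ≤ n)
    {A : Set (EuclideanSpace ℝ (Fin n))} (hA : A ⊆ frontier K) :
    volume (K ∩ radialProj K ⁻¹' A) = volume (Ioc (0 : ℝ) 1 • A) := by
  have : Nonempty (Fin n) := ⟨⟨0, hn⟩⟩
  have h1 : K ∩ radialProj K ⁻¹' A ⊆ Ioc (0 : ℝ) 1 • A := by
    rintro y ⟨hy, hyA⟩
    have hy0 : y ≠ 0 := by
      rintro rfl
      have := hK.ne_zero_of_mem_frontier (hA hyA)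
      simp [radialProj] at this
    exact ⟨gauge K y, ⟨hK.gauge_pos.2 hy0, gauge_le_one_of_mem hy⟩, _, hyA,
      hK.gauge_smul_radialProj y⟩
  have h2 : Ioc (0 : ℝ) 1 • A ⊆ (K ∩ radialProj K ⁻¹' A) ∪ frontier K := by
    rintro _ ⟨r, hr, x, hx, rfl⟩
    have hcl : r • x ∈ closure K := by
      rw [hK.mem_closure_iff, gauge_smul_nonneg hr.1.le, hK.mem_frontier_iff.1 (hA hx), mul_one]
      exact hr.2
    rw [closure_eq_self_union_frontier] at hcl
    rcases hcl with hcl | hcl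
    · refine Or.inl ⟨hcl, ?_⟩
      simp only [mem_preimage]
      rwa [radialProj_smul hr.1, hK.radialProj_of_mem_frontier (hA hx)]
    · exact Or.inr hcl
  refine le_antisymm (measure_mono h1) ((measure_mono h2).trans ((measure_union_le _ _).trans ?_))
  rw [hK.convex.addHaar_frontier volume, add_zero]

/-- The cone measure on the boundary of `K`, weighted by `n / ⟨x, n_x⟩`. -/
noncomputable def coneMeasure (K : Set (EuclideanSpace ℝ (Fin n))) :
    Measure (EuclideanSpace ℝ (Fin n)) :=
  (volume.restrict K).withDensity fun y => ENNReal.ofReal (n * ‖gaugeGradient K y‖)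

/-- If `u` is a normal at y, then ⟪u, x - y⟫ ≤ 0 for x in the frontier, so ⟪u₀, x - y⟫ ≤ ⟪u₀ - u, x
- y⟫ ≤ δ ‖x - y‖. A piece on which points and normals vary by less than δ is therefore nearly flat,
without any regularity of the boundary. One δ serves all base points, so countably many pieces
suffice. -/
theorem IsSymmetricConvex.local_comparison (hK : IsSymmetricConvex K) (hn : 1 ≤ n) {κ : ℝ}
    (hκ0 : 0 < κ) (hκ : κ < 1 / 2) :
    ∃ δ > 0, ∀ x₀ ∈ frontier K, ∀ u₀, IsUnitOuterNormal K x₀ u₀ →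
      ∀ A ⊆ frontier K,
        (∀ x ∈ A, ‖x - x₀‖ < δ ∧ ∃ u, IsUnitOuterNormal K x u ∧ ‖u - u₀‖ < δ) →
      (∀ x ∈ A, ∀ u, IsUnitOuterNormal K x u → ‖u - u₀‖ < δ →
        |⟪x, u⟫ - ⟪u₀, x₀⟫| ≤ κ * ⟪u₀, x₀⟫) ∧
      ENNReal.ofReal ⟪u₀, x₀⟫ * Measure.euclideanHausdorffMeasure (n - 1) A
        ≤ ENNReal.ofReal ((1 - 2 * κ)⁻¹ ^ (2 * n)) * (n * volume (Ioc (0 : ℝ) 1 • A)) ∧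
      n * volume (Ioc (0 : ℝ) 1 • A) ≤ ENNReal.ofReal ((1 - 2 * κ)⁻¹ ^ (2 * n)) *
        (ENNReal.ofReal ⟪u₀, x₀⟫ * Measure.euclideanHausdorffMeasure (n - 1) A) := by
  obtain ⟨r, R, hr, hR, hrb, hRb⟩ := hK.exists_norm_bounds
  -- With inner radius r and outer radius R, this gives δ (1 + R) = κ r ≤ κ c and δ ≤ κ c / R,
  -- because r ≤ c = ⟪u₀, x₀⟫.
  refine ⟨κ * r / (1 + R), by positivity, fun x₀ hx₀ u₀ hu₀ A hA hAδ => ?_⟩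
  set δ := κ * r / (1 + R) with hδ
  have hδ0 : 0 < δ := by positivity
  have hδR : δ * (1 + R) = κ * r := by rw [hδ]; field_simp
  have hcr : r ≤ ⟪u₀, x₀⟫ := by
    have h1 := hK.inner_le_of_isUnitOuterNormal hu₀ u₀
    have h2 := hrb u₀
    have h3 := hK.inner_pos_of_isUnitOuterNormal hu₀
    rw [real_inner_self_eq_norm_sq, hu₀.1] at h1
    rw [hu₀.1] at h2
    rw [real_inner_comm]
    nlinarith [gauge_nonneg (s := K) u₀]
  set c := ⟪u₀, x₀⟫ with hc
  have hc0 : 0 < c := hr.trans_le hcr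
  have hκr : κ * r ≤ κ * c := by gcongr
  have hnorm : ∀ x ∈ A, ‖x‖ ≤ R := fun x hx => by
    have := hRb x
    rwa [hK.mem_frontier_iff.1 (hA hx), mul_one] at this
  have hδ1 : δ ≤ κ * r := by nlinarith
  have hx1 : ∀ x ∈ A, |⟪u₀, x⟫ - c| ≤ δ := by
    intro x hx
    rw [hc, ← inner_sub_right]
    refine (abs_real_inner_le_norm _ _).trans ?_
    rw [hu₀.1, one_mul]
    exact (hAδ x hx).1.le
  refine ⟨fun x hx u hu huδ => ?_, ?_⟩
  · have h1 : ⟪x, u⟫ - c = (⟪u₀, x⟫ - c) + ⟪x, u - u₀⟫ := by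
      rw [inner_sub_right, real_inner_comm x u₀]; ring
    have h2 : |⟪x, u - u₀⟫| ≤ R * δ :=
      (abs_real_inner_le_norm _ _).trans (by gcongr; exact hnorm x hx)
    rw [h1]
    calc _ ≤ δ + R * δ := (abs_add_le _ _).trans (add_le_add (hx1 x hx) h2)
      _ = κ * r := by rw [← hδR]; ring
      _ ≤ _ := hκr
  · refine cone_comparison hn hu₀.1 hc0 hR hκ0.le hκ (fun x hx => ?_) hnorm ?_
    · exact (hx1 x hx).trans (hδ1.trans hκr)
    · have key : ∀ x ∈ A, ∀ y ∈ A, ⟪u₀, x - y⟫ ≤ κ * (c / R) * ‖x - y‖ := by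
        intro x hx y hy
        obtain ⟨-, u, hu, huδ⟩ := hAδ y hy
        have h1 := hK.inner_le_of_isUnitOuterNormal hu x
        rw [hK.mem_frontier_iff.1 (hA hx), mul_one] at h1
        have h2 : ⟪u₀, x - y⟫ ≤ ⟪u₀ - u, x - y⟫ := by
          have e1 := real_inner_comm x u
          have e2 := real_inner_comm y u
          rw [inner_sub_left, inner_sub_right u]
          linarith
        refine h2.trans ((real_inner_le_norm _ _).trans ?_)
        gcongr
        rw [norm_sub_rev]
        refine huδ.le.trans ?_
        rw [hδ, mul_div_assoc]
        gcongr
        linarith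
      intro x hx y hy
      rw [abs_le']
      refine ⟨key x hx y hy, ?_⟩
      rw [← inner_neg_right, neg_sub, norm_sub_rev]
      exact key y hy x hx

theorem IsSymmetricConvex.frontier_nonempty (hK : IsSymmetricConvex K) (hn : 1 ≤ n) :
    (frontier K).Nonempty := by
  have : Nonempty (Fin n) := ⟨⟨0, hn⟩⟩
  obtain ⟨y, hy⟩ := exists_ne (0 : EuclideanSpace ℝ (Fin n))
  exact ⟨_, hK.radialProj_mem_frontier hy⟩

/-- The pairs of a boundary point and a unit outer normal there. -/
def normalPairs (K : Set (EuclideanSpace ℝ (Fin n))) :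
    Set (EuclideanSpace ℝ (Fin n) × EuclideanSpace ℝ (Fin n)) :=
  {z | z.1 ∈ frontier K ∧ IsUnitOuterNormal K z.1 z.2}

/-- The pairs (point, normal) are covered rather than the points, so that singular points, with any
one of their normals, are included. A dense sequence of pairs provides the centres. -/
theorem IsSymmetricConvex.exists_countable_cover (hK : IsSymmetricConvex K) (hn : 1 ≤ n) {δ : ℝ}
    (hδ : 0 < δ) : ∃ d : ℕ → EuclideanSpace ℝ (Fin n) × EuclideanSpace ℝ (Fin n),
      (∀ i, d i ∈ normalPairs K) ∧
      ∀ z ∈ normalPairs K, ∃ i, ‖z.1 - (d i).1‖ < δ ∧ ‖z.2 - (d i).2‖ < δ := by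
  obtain ⟨x, hx⟩ := hK.frontier_nonempty hn
  obtain ⟨u, hu⟩ := hK.exists_isUnitOuterNormal hx
  have : Nonempty (normalPairs K) := ⟨⟨(x, u), hx, hu⟩⟩
  refine ⟨fun i => (TopologicalSpace.denseSeq (normalPairs K) i).1,
    fun i => (TopologicalSpace.denseSeq (normalPairs K) i).2, fun z hz => ?_⟩
  obtain ⟨i, hi⟩ := (TopologicalSpace.denseRange_denseSeq (normalPairs K)).exists_dist_lt ⟨z, hz⟩ hδ
  rw [Subtype.dist_eq, Prod.dist_eq, max_lt_iff, dist_eq_norm, dist_eq_norm] at hi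
  exact ⟨i, hi⟩

/-- By homogeneity the cone over the singular boundary points consists of singular points, hence is
Lebesgue-null by Rademacher's theorem. The local comparison carries this over to Hausdorff measure.
-/
theorem IsSymmetricConvex.hausdorffMeasure_not_differentiableAt (hK : IsSymmetricConvex K)
    (hn : 1 ≤ n) :
    Measure.euclideanHausdorffMeasure (n - 1)
      (frontier K ∩ {x | ¬DifferentiableAt ℝ (gauge K) x}) = 0 := by
  obtain ⟨δ, hδ, h⟩ := hK.local_comparison hn (κ := 1 / 4) (by norm_num) (by norm_num)
  obtain ⟨d, hd, hcov⟩ := hK.exists_countable_cover hn hδ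
  set A : ℕ → Set (EuclideanSpace ℝ (Fin n)) := fun i =>
    {x | x ∈ frontier K ∧ ¬DifferentiableAt ℝ (gauge K) x ∧ ‖x - (d i).1‖ < δ ∧
      ∃ u, IsUnitOuterNormal K x u ∧ ‖u - (d i).2‖ < δ} with hA
  refine measure_mono_null (t := ⋃ i, A i) ?_ (measure_iUnion_null fun i => ?_)
  · rintro x ⟨hx, hnd⟩
    obtain ⟨u, hu⟩ := hK.exists_isUnitOuterNormal hx
    obtain ⟨i, h1, h2⟩ := hcov (x, u) ⟨hx, hu⟩
    exact mem_iUnion.2 ⟨i, hx, hnd, h1, u, hu, h2⟩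
  · have h1 := (h _ (hd i).1 _ (hd i).2 (A i) (fun x hx => hx.1)
      fun x hx => ⟨hx.2.2.1, hx.2.2.2⟩).2.1
    have h2 : volume (Ioc (0 : ℝ) 1 • A i) = 0 := by
      refine measure_mono_null ?_ (ae_iff.1 hK.ae_differentiableAt_gauge)
      rintro _ ⟨r, hr, x, hx, rfl⟩
      exact mt (differentiableAt_gauge_smul_iff hr.1).1 hx.2.1
    rw [h2, mul_zero, mul_zero, nonpos_iff_eq_zero, mul_eq_zero] at h1
    have hc : 0 < ⟪(d i).2, (d i).1⟫ := by
      rw [real_inner_comm]; exact hK.inner_pos_of_isUnitOuterNormal (hd i).2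
    rcases h1 with h1 | h1
    · exact absurd h1 (by simpa using hc)
    · exact h1

/-- On a nearly flat piece at height c, the density n‖q‖ = n / ⟪x, n_x⟫ equals n / c up to a factor
1 - κ, which cancels the c of the cone formula. The constant tends to 1 as κ → 0, so the two bounds
merge into an identity. -/
theorem IsSymmetricConvex.coneMeasure_comparison (hK : IsSymmetricConvex K) (hn : 1 ≤ n) {κ : ℝ}
    (hκ0 : 0 < κ) (hκ : κ < 1 / 2) {A : Set (EuclideanSpace ℝ (Fin n))} (hA : MeasurableSet A)
    (hAK : A ⊆ frontier K ∩ {x | DifferentiableAt ℝ (gauge K) x}) :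
    Measure.euclideanHausdorffMeasure (n - 1) A
        ≤ ENNReal.ofReal ((1 - 2 * κ)⁻¹ ^ (2 * n) * (1 - κ)⁻¹) *
          (coneMeasure K).map (radialProj K) A ∧
      (coneMeasure K).map (radialProj K) A ≤ ENNReal.ofReal ((1 - 2 * κ)⁻¹ ^ (2 * n) * (1 - κ)⁻¹) *
        Measure.euclideanHausdorffMeasure (n - 1) A := by
  obtain ⟨δ, hδ, h⟩ := hK.local_comparison hn hκ0 hκ
  obtain ⟨d, hd, hcov⟩ := hK.exists_countable_cover hn hδ
  set N : EuclideanSpace ℝ (Fin n) → EuclideanSpace ℝ (Fin n) :=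
    fun x => ‖gaugeGradient K x‖⁻¹ • gaugeGradient K x with hN
  have hNm : Measurable N :=
    (measurable_gaugeGradient.norm.inv).smul measurable_gaugeGradient
  set U : ℕ → Set (EuclideanSpace ℝ (Fin n)) := fun i =>
    {x | ‖x - (d i).1‖ < δ ∧ ‖N x - (d i).2‖ < δ} with hU
  have hUm : ∀ i, MeasurableSet (U i) := fun i =>
    (measurableSet_lt (measurable_id.sub_const _).norm measurable_const).inter
      (measurableSet_lt (hNm.sub_const _).norm measurable_const)
  have hNn : ∀ x ∈ A, IsUnitOuterNormal K x (N x) := fun x hx =>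
    hK.isUnitOuterNormal_gaugeGradient (hAK hx).1 (hAK hx).2
  have hAU : A ⊆ ⋃ i, U i := fun x hx =>
    mem_iUnion.2 (hcov (x, N x) ⟨(hAK hx).1, hNn x hx⟩)
  have h1κ : 0 < 1 - κ := by linarith
  have hpos : 0 < 1 - 2 * κ := by linarith
  have key : ∀ i, ∀ B ⊆ A ∩ U i, MeasurableSet B →
      Measure.euclideanHausdorffMeasure (n - 1) B
        ≤ ENNReal.ofReal ((1 - 2 * κ)⁻¹ ^ (2 * n) * (1 - κ)⁻¹) *
          (coneMeasure K).map (radialProj K) B ∧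
      (coneMeasure K).map (radialProj K) B ≤ ENNReal.ofReal ((1 - 2 * κ)⁻¹ ^ (2 * n) * (1 - κ)⁻¹) *
        Measure.euclideanHausdorffMeasure (n - 1) B := by
    intro i B hB hBm
    obtain ⟨hcl, hlo, hhi⟩ := h _ (hd i).1 _ (hd i).2 B (fun x hx => (hAK (hB hx).1).1)
      fun x hx => ⟨(hB hx).2.1, N x, hNn x (hB hx).1, (hB hx).2.2⟩
    have hc : 0 < ⟪(d i).2, (d i).1⟫ := by
      rw [real_inner_comm]; exact hK.inner_pos_of_isUnitOuterNormal (hd i).2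
    set c := ⟪(d i).2, (d i).1⟫ with hcdef
    have hq : ∀ x ∈ B, ‖gaugeGradient K x‖ ≤ ((1 - κ) * c)⁻¹ ∧
        (1 - κ) * c⁻¹ ≤ ‖gaugeGradient K x‖ := by
      intro x hx
      have hxA := (hB hx).1
      have hu := hNn x hxA
      have hxu := hK.inner_pos_of_isUnitOuterNormal hu
      have h1 := abs_le.1 (hcl x hx (N x) hu (hB hx).2.2)
      have h2 : ‖gaugeGradient K x‖ = ⟪x, N x⟫⁻¹ := by
        rw [hK.eq_of_isUnitOuterNormal (hAK hxA).1 (hAK hxA).2 hu, norm_smul, hu.1, mul_one,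
          Real.norm_of_nonneg (by positivity)]
      rw [h2]
      constructor
      · gcongr
        linarith [h1.1]
      · rw [← div_eq_mul_inv, div_le_iff₀ hc, inv_mul_eq_div, le_div_iff₀ hxu]
        nlinarith [h1.2]
    have hmap : (coneMeasure K).map (radialProj K) B =
        ∫⁻ y in K ∩ radialProj K ⁻¹' B, ENNReal.ofReal (n * ‖gaugeGradient K y‖) := by
      have hpre := hK.measurable_radialProj hBm
      rw [Measure.map_apply hK.measurable_radialProj hBm, coneMeasure, withDensity_apply _ hpre,
        Measure.restrict_restrict hpre, inter_comm]
    have hBK : B ⊆ frontier K := fun x hx => (hAK (hB hx).1).1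
    have hvol := hK.volume_preimage_radialProj hn hBK
    have hgrad : ∀ y ∈ K ∩ radialProj K ⁻¹' B,
        gaugeGradient K y = gaugeGradient K (radialProj K y) := by
      intro y hy
      refine (hK.gaugeGradient_radialProj ?_).symm
      rintro rfl
      have := hK.ne_zero_of_mem_frontier (hBK hy.2)
      simp [radialProj] at this
    have hnull : NullMeasurableSet (K ∩ radialProj K ⁻¹' B) :=
      (hK.convex.nullMeasurableSet volume).inter (hK.measurable_radialProj hBm).nullMeasurableSet
    have hup : (coneMeasure K).map (radialProj K) B ≤
        ENNReal.ofReal ((1 - κ) * c)⁻¹ * (n * volume (Ioc (0 : ℝ) 1 • B)) := by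
      rw [hmap, ← hvol]
      calc _ ≤ ∫⁻ y in K ∩ radialProj K ⁻¹' B, ENNReal.ofReal (n * ((1 - κ) * c)⁻¹) := by
            refine lintegral_mono_ae ?_
            filter_upwards [ae_restrict_mem₀ hnull] with y hy
            rw [hgrad y hy]
            gcongr
            exact (hq _ hy.2).1
        _ = _ := by
            rw [lintegral_const, Measure.restrict_apply_univ,
              ENNReal.ofReal_mul (p := (n : ℝ)) (by positivity), ENNReal.ofReal_natCast]
            ring
    have hdn : ENNReal.ofReal ((1 - κ) * c⁻¹) * (n * volume (Ioc (0 : ℝ) 1 • B)) ≤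
        (coneMeasure K).map (radialProj K) B := by
      rw [hmap, ← hvol]
      calc _ = ∫⁻ y in K ∩ radialProj K ⁻¹' B, ENNReal.ofReal (n * ((1 - κ) * c⁻¹)) := by
            rw [lintegral_const, Measure.restrict_apply_univ,
              ENNReal.ofReal_mul (p := (n : ℝ)) (by positivity), ENNReal.ofReal_natCast,
              ENNReal.ofReal_mul h1κ.le]
            ring
        _ ≤ _ := by
            refine lintegral_mono_ae ?_
            filter_upwards [ae_restrict_mem₀ hnull] with y hy
            rw [hgrad y hy]
            gcongr
            exact (hq _ hy.2).2
    have hcc : ENNReal.ofReal c⁻¹ * ENNReal.ofReal c = 1 := by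
      rw [← ENNReal.ofReal_mul (by positivity), inv_mul_cancel₀ hc.ne', ENNReal.ofReal_one]
    have hκκ : ENNReal.ofReal (1 - κ)⁻¹ * ENNReal.ofReal (1 - κ) = 1 := by
      rw [← ENNReal.ofReal_mul (by positivity), inv_mul_cancel₀ h1κ.ne', ENNReal.ofReal_one]
    rw [ENNReal.ofReal_mul (by positivity)]
    rw [mul_inv, ENNReal.ofReal_mul (by positivity)] at hup
    rw [ENNReal.ofReal_mul h1κ.le] at hdn
    set V := n * volume (Ioc (0 : ℝ) 1 • B)
    set H := Measure.euclideanHausdorffMeasure (n - 1) B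
    set G := (coneMeasure K).map (radialProj K) B
    set Λ := ENNReal.ofReal ((1 - 2 * κ)⁻¹ ^ (2 * n))
    constructor
    · calc H = ENNReal.ofReal c⁻¹ * (ENNReal.ofReal c * H) := by rw [← mul_assoc, hcc, one_mul]
        _ ≤ ENNReal.ofReal c⁻¹ * (Λ * V) := by gcongr
        _ = Λ * ENNReal.ofReal (1 - κ)⁻¹ * (ENNReal.ofReal (1 - κ) * ENNReal.ofReal c⁻¹ * V) := by
            calc _ = 1 * (ENNReal.ofReal c⁻¹ * (Λ * V)) := (one_mul _).symm
              _ = _ := by rw [← hκκ]; ring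
        _ ≤ Λ * ENNReal.ofReal (1 - κ)⁻¹ * G := by gcongr
    · calc G ≤ ENNReal.ofReal (1 - κ)⁻¹ * ENNReal.ofReal c⁻¹ * V := hup
        _ ≤ ENNReal.ofReal (1 - κ)⁻¹ * ENNReal.ofReal c⁻¹ * (Λ * (ENNReal.ofReal c * H)) := by
            gcongr
        _ = ENNReal.ofReal c⁻¹ * ENNReal.ofReal c * (Λ * ENNReal.ofReal (1 - κ)⁻¹ * H) := by ring
        _ = Λ * ENNReal.ofReal (1 - κ)⁻¹ * H := by rw [hcc, one_mul]
  exact ⟨measure_le_mul_of_cover hUm hA hAU fun i B hB hBm => (key i B hB hBm).1,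
    measure_le_mul_of_cover hUm hA hAU fun i B hB hBm => (key i B hB hBm).2⟩

theorem IsSymmetricConvex.ae_coneMeasure_radialProj (hK : IsSymmetricConvex K) (hn : 1 ≤ n) :
    ∀ᵐ y ∂coneMeasure K, y ≠ 0 ∧ DifferentiableAt ℝ (gauge K) y := by
  have : Nonempty (Fin n) := ⟨⟨0, hn⟩⟩
  refine (withDensity_absolutelyContinuous _ _).ae_le
    (ae_restrict_of_ae ?_)
  filter_upwards [hK.ae_differentiableAt_gauge, Measure.ae_ne volume 0] with y h1 h2
  exact ⟨h2, h1⟩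

/-- The boundary measure is the image of a weighted volume under the radial projection. -/
theorem IsSymmetricConvex.boundaryMeasure_eq_map (hK : IsSymmetricConvex K) (hn : 1 ≤ n) :
    boundaryMeasure K = (coneMeasure K).map (radialProj K) := by
  set D : Set (EuclideanSpace ℝ (Fin n)) := frontier K ∩ {x | DifferentiableAt ℝ (gauge K) x}
    with hD
  have hDm : MeasurableSet D :=
    isClosed_frontier.measurableSet.inter (measurableSet_of_differentiableAt ℝ (gauge K))
  ext A hA
  have h1 : boundaryMeasure K A = Measure.euclideanHausdorffMeasure (n - 1) (A ∩ D) := by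
    rw [boundaryMeasure, Measure.restrict_apply hA]
    refine le_antisymm ?_ (measure_mono (inter_subset_inter_right _ inter_subset_left))
    calc _ ≤ Measure.euclideanHausdorffMeasure (n - 1) ((A ∩ D) ∪
          (frontier K ∩ {x | ¬DifferentiableAt ℝ (gauge K) x})) := by
          refine measure_mono ?_
          rintro x ⟨hx, hxK⟩
          by_cases hd : DifferentiableAt ℝ (gauge K) x
          · exact Or.inl ⟨hx, hxK, hd⟩
          · exact Or.inr ⟨hxK, hd⟩
      _ ≤ _ := (measure_union_le _ _).trans
          (by rw [hK.hausdorffMeasure_not_differentiableAt hn, add_zero])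
  have h2 : (coneMeasure K).map (radialProj K) A = (coneMeasure K).map (radialProj K) (A ∩ D) := by
    rw [Measure.map_apply hK.measurable_radialProj hA,
      Measure.map_apply hK.measurable_radialProj (hA.inter hDm)]
    refine measure_congr ?_
    filter_upwards [hK.ae_coneMeasure_radialProj hn] with y hy
    refine propext ⟨fun h => ⟨h, hK.radialProj_mem_frontier hy.1,
      (hK.differentiableAt_radialProj_iff hy.1).2 hy.2⟩, fun h => h.1⟩
  rw [h1, h2]
  -- Letting κ → 0 turns the two-sided comparison into equality.
  have hlim : Filter.Tendsto (fun κ : ℝ => ENNReal.ofReal ((1 - 2 * κ)⁻¹ ^ (2 * n) * (1 - κ)⁻¹))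
      (𝓝[>] 0) (𝓝 1) := by
    have hc : ContinuousAt (fun κ : ℝ => (1 - 2 * κ)⁻¹ ^ (2 * n) * (1 - κ)⁻¹) 0 := by
      refine ContinuousAt.mul (ContinuousAt.pow (ContinuousAt.inv₀ (by fun_prop) (by norm_num)) _)
        (ContinuousAt.inv₀ (by fun_prop) (by norm_num))
    have := (ENNReal.continuous_ofReal.continuousAt.comp hc).tendsto
    simp only [Function.comp_apply, mul_zero, sub_zero, inv_one, one_pow, mul_one,
      ENNReal.ofReal_one] at this
    exact this.mono_left nhdsWithin_le_nhds
  have hev : ∀ᶠ κ : ℝ in 𝓝[>] 0, 0 < κ ∧ κ < 1 / 2 :=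
    Ioo_mem_nhdsGT (by norm_num : (0 : ℝ) < 1 / 2)
  have hlim' : ∀ x : ENNReal, Filter.Tendsto
      (fun κ : ℝ => ENNReal.ofReal ((1 - 2 * κ)⁻¹ ^ (2 * n) * (1 - κ)⁻¹) * x) (𝓝[>] 0) (𝓝 x) := by
    intro x
    have := ENNReal.Tendsto.mul_const (b := x) hlim (Or.inl one_ne_zero)
    rwa [one_mul] at this
  refine le_antisymm (ge_of_tendsto (hlim' _) ?_) (ge_of_tendsto (hlim' _) ?_)
  · filter_upwards [hev] with κ hκ
    exact (hK.coneMeasure_comparison hn hκ.1 hκ.2 (hA.inter hDm) inter_subset_right).1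
  · filter_upwards [hev] with κ hκ
    exact (hK.coneMeasure_comparison hn hκ.1 hκ.2 (hA.inter hDm) inter_subset_right).2

end BoundaryFormula

/-! ### Sweeping along a segment and the mixed volumes. -/

section Sweep

variable {n : ℕ} {K : Set (EuclideanSpace ℝ (Fin n))}

/-- A nonnegative additive function on the half-line is linear. -/
theorem eq_mul_of_additive_of_nonneg {f : ℝ → ℝ}
    (hadd : ∀ s t, 0 ≤ s → 0 ≤ t → f (s + t) = f s + f t) (hpos : ∀ s, 0 ≤ s → 0 ≤ f s)
    {t : ℝ} (ht : 0 ≤ t) : f t = t * f 1 := by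
  have h0 : f 0 = 0 := by
    have := hadd 0 0 le_rfl le_rfl
    rw [add_zero] at this
    linarith
  have hmul : ∀ (k : ℕ) (s : ℝ), 0 ≤ s → f (k * s) = k * f s := by
    intro k s hs
    induction k with
    | zero => simp [h0]
    | succ k ih =>
      push_cast
      rw [add_mul, one_mul, hadd _ _ (by positivity) hs, ih]
      ring
  have hmono : ∀ s t, 0 ≤ s → s ≤ t → f s ≤ f t := by
    intro s t hs hst
    have := hadd s (t - s) hs (sub_nonneg.2 hst)
    rw [add_sub_cancel] at this
    linarith [hpos (t - s) (sub_nonneg.2 hst)]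
  -- Monotonicity squeezes f(kt) between the values at ⌊kt⌋ and ⌊kt⌋ + 1, so the error at `t` is at
  -- most f(1)/k for every k.
  have hb : ∀ k : ℕ, k * |f t - t * f 1| ≤ f 1 := by
    intro k
    have hkt : 0 ≤ k * t := by positivity
    have h1 := hmono _ _ (by positivity) (Nat.floor_le hkt)
    have h2 := hmono _ _ hkt (Nat.lt_floor_add_one (k * t)).le
    rw [hmul k t ht] at h1 h2
    have h3 := hmul ⌊k * t⌋₊ 1 zero_le_one
    have h4 := hmul (⌊k * t⌋₊ + 1) 1 zero_le_one
    push_cast at h4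
    rw [mul_one] at h3 h4
    rw [h3] at h1
    rw [h4] at h2
    have hf := hpos 1 zero_le_one
    have h5 : (⌊k * t⌋₊ : ℝ) * f 1 ≤ k * t * f 1 := by
      gcongr; exact Nat.floor_le hkt
    have h6 : k * t * f 1 ≤ (⌊k * t⌋₊ + 1 : ℝ) * f 1 := by
      gcongr; exact (Nat.lt_floor_add_one (k * t)).le
    rw [← abs_of_nonneg (Nat.cast_nonneg k : (0 : ℝ) ≤ k), ← abs_mul, abs_le]
    constructor <;> nlinarith
  by_contra hne
  have hε : 0 < |f t - t * f 1| := abs_pos.2 (sub_ne_zero.2 hne)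
  obtain ⟨k, hk⟩ := exists_nat_gt (f 1 / |f t - t * f 1|)
  rw [div_lt_iff₀ hε] at hk
  exact absurd (hb k) (not_le.2 hk)

/-- The set swept out by `K` when it is translated along `[0, t v]`. -/
def sweep (K : Set (EuclideanSpace ℝ (Fin n))) (v : EuclideanSpace ℝ (Fin n)) (t : ℝ) :
    Set (EuclideanSpace ℝ (Fin n)) :=
  {x | ∃ a ∈ Icc 0 t, x - a • v ∈ K}

theorem subset_sweep (v : EuclideanSpace ℝ (Fin n)) {t : ℝ} (ht : 0 ≤ t) : K ⊆ sweep K v t :=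
  fun x hx => ⟨0, ⟨le_rfl, ht⟩, by simpa using hx⟩

theorem IsSymmetricConvex.convex_sweep (hK : IsSymmetricConvex K) (v : EuclideanSpace ℝ (Fin n))
    (t : ℝ) : Convex ℝ (sweep K v t) := by
  rintro x ⟨a, ha, hx⟩ y ⟨b, hb, hy⟩ α β hα hβ hαβ
  refine ⟨α * a + β * b, convex_Icc 0 t ha hb hα hβ hαβ, ?_⟩
  have := hK.convex hx hy hα hβ hαβ
  convert this using 1
  module

theorem IsSymmetricConvex.volume_ne_top (hK : IsSymmetricConvex K) : volume K ≠ ⊤ :=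
  hK.bounded.measure_lt_top.ne

theorem IsSymmetricConvex.volume_pos (hK : IsSymmetricConvex K) : 0 < volume.real K :=
  ENNReal.toReal_pos
    (Measure.measure_pos_of_nonempty_interior volume hK.interior_nonempty).ne' hK.volume_ne_top

theorem IsSymmetricConvex.isBounded_sweep (hK : IsSymmetricConvex K)
    (v : EuclideanSpace ℝ (Fin n)) (t : ℝ) : Bornology.IsBounded (sweep K v t) := by
  obtain ⟨R, hR⟩ := hK.bounded.exists_norm_le
  refine (isBounded_iff_forall_norm_le).2 ⟨R + t * ‖v‖, ?_⟩
  rintro x ⟨a, ha, hx⟩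
  calc ‖x‖ = ‖(x - a • v) + a • v‖ := by rw [sub_add_cancel]
    _ ≤ ‖x - a • v‖ + ‖a • v‖ := norm_add_le _ _
    _ ≤ R + t * ‖v‖ := by
        gcongr
        · exact hR _ hx
        · rw [norm_smul, Real.norm_of_nonneg ha.1]
          gcongr
          exact ha.2

theorem IsSymmetricConvex.volume_sweep_ne_top (hK : IsSymmetricConvex K)
    (v : EuclideanSpace ℝ (Fin n)) (t : ℝ) : volume (sweep K v t) ≠ ⊤ :=
  (hK.isBounded_sweep v t).measure_lt_top.ne

/-- The part of the longer sweep not covered by time s is the translate by sv of what the sweep of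
length t adds to `K`. Disjointness is convexity: a point covered both at a time b ≤ s and at a time
at least s is covered at time s as well. -/
theorem IsSymmetricConvex.volume_real_sweep_add (hK : IsSymmetricConvex K)
    (v : EuclideanSpace ℝ (Fin n)) {s t : ℝ} (hs : 0 ≤ s) (ht : 0 ≤ t) :
    volume.real (sweep K v (s + t)) - volume.real K =
      (volume.real (sweep K v s) - volume.real K) +
        (volume.real (sweep K v t) - volume.real K) := by
  have hdec : sweep K v (s + t) = sweep K v s ∪ ((s • v) +ᵥ (sweep K v t \ K)) := by
    ext x
    constructor
    · rintro ⟨a, ha, hx⟩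
      by_cases hxs : x ∈ sweep K v s
      · exact Or.inl hxs
      have has : s < a := by
        by_contra hle
        exact hxs ⟨a, ⟨ha.1, not_lt.1 hle⟩, hx⟩
      refine Or.inr (mem_vadd_set_iff_neg_vadd_mem.2 ⟨⟨a - s, ⟨by linarith, by linarith [ha.2]⟩, ?_⟩,
        fun h => hxs ⟨s, ⟨hs, le_rfl⟩, ?_⟩⟩)
      · convert hx using 1
        simp only [vadd_eq_add]
        module
      · convert h using 1
        simp only [vadd_eq_add]
        module
    · rintro (⟨a, ha, hx⟩ | hx)
      · exact ⟨a, ⟨ha.1, by linarith [ha.2]⟩, hx⟩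
      · obtain ⟨⟨a, ha, hx⟩, -⟩ := mem_vadd_set_iff_neg_vadd_mem.1 hx
        refine ⟨a + s, ⟨by linarith [ha.1], by linarith [ha.2]⟩, ?_⟩
        convert hx using 1
        simp only [vadd_eq_add]
        module
  have hdisj : Disjoint (sweep K v s) ((s • v) +ᵥ (sweep K v t \ K)) := by
    rw [Set.disjoint_left]
    rintro x ⟨b, hb, hx⟩ hx'
    obtain ⟨⟨a, ha, hxa⟩, hxK⟩ := mem_vadd_set_iff_neg_vadd_mem.1 hx'
    refine hxK ?_
    rcases eq_or_lt_of_le (show 0 ≤ a + (s - b) by linarith [ha.1, hb.2]) with h0 | h0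
    · have : s = b := by linarith [ha.1, hb.2]
      convert hx using 1
      rw [this]
      simp only [vadd_eq_add]
      module
    · have := hK.convex hx hxa (a := a / (a + (s - b))) (b := (s - b) / (a + (s - b)))
        (div_nonneg ha.1 h0.le) (div_nonneg (by linarith [hb.2]) h0.le)
        (by rw [← add_div, div_self h0.ne'])
      convert this using 1
      simp only [vadd_eq_add]
      match_scalars
      · field_simp
        ring
      · field_simp
  have hm : NullMeasurableSet ((s • v) +ᵥ (sweep K v t \ K)) := by
    exact (((hK.convex_sweep v t).nullMeasurableSet volume).diff
      (hK.convex.nullMeasurableSet volume)).vadd _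
  have hfin : volume (sweep K v t \ K) ≠ ⊤ :=
    measure_ne_top_of_subset sdiff_subset (hK.volume_sweep_ne_top v t)
  have h1 : volume (sweep K v (s + t)) = volume (sweep K v s) + volume (sweep K v t \ K) := by
    rw [hdec, measure_union₀ hm hdisj.aedisjoint, measure_vadd]
  have h2 : volume (sweep K v t \ K) = volume (sweep K v t) - volume K :=
    measure_sdiff (subset_sweep v ht) (hK.convex.nullMeasurableSet volume) hK.volume_ne_top
  have h3 : volume.real (sweep K v t \ K) = volume.real (sweep K v t) - volume.real K := by
    rw [measureReal_def, h2, ENNReal.toReal_sub_of_le (measure_mono (subset_sweep v ht))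
      (hK.volume_sweep_ne_top v t)]
    rfl
  have h4 : volume.real (sweep K v (s + t)) =
      volume.real (sweep K v s) + volume.real (sweep K v t \ K) := by
    rw [measureReal_def, h1, ENNReal.toReal_add (hK.volume_sweep_ne_top v s) hfin]
    rfl
  rw [h4, h3]
  ring

/-- The growth rate of the volume swept out by `K` in the direction `v`: the volume of the
projection of `K` along `v`. -/
noncomputable def sweepRate (K : Set (EuclideanSpace ℝ (Fin n)))
    (v : EuclideanSpace ℝ (Fin n)) : ℝ :=
  volume.real (sweep K v 1) - volume.real K

theorem IsSymmetricConvex.volume_real_sweep (hK : IsSymmetricConvex K)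
    (v : EuclideanSpace ℝ (Fin n)) {t : ℝ} (ht : 0 ≤ t) :
    volume.real (sweep K v t) = volume.real K + t * sweepRate K v := by
  have := eq_mul_of_additive_of_nonneg
    (f := fun t => volume.real (sweep K v t) - volume.real K)
    (fun s t hs ht => hK.volume_real_sweep_add v hs ht)
    (fun s hs => sub_nonneg.2 (measureReal_mono (subset_sweep v hs) (hK.volume_sweep_ne_top v s)))
    ht
  rw [sweepRate]
  linarith

theorem IsSymmetricConvex.sweepRate_nonneg (hK : IsSymmetricConvex K)
    (v : EuclideanSpace ℝ (Fin n)) : 0 ≤ sweepRate K v :=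
  sub_nonneg.2 (measureReal_mono (subset_sweep v zero_le_one) (hK.volume_sweep_ne_top v 1))

/-- Up to a translation, adding t[-v, v] is sweeping along 2tv. Hence |K + tM| is affine in t ≥ 0,
which settles its smoothness, V₁ and V₂ at once. -/
theorem add_smul_segment_eq (v : EuclideanSpace ℝ (Fin n)) {t : ℝ} (ht : 0 ≤ t) :
    K + t • segment ℝ (-v) v = (-(t • v)) +ᵥ sweep K v (2 * t) := by
  ext x
  rw [mem_vadd_set_iff_neg_vadd_mem, mem_add]
  constructor
  · rintro ⟨k, hk, _, ⟨m, ⟨α, β, hα, hβ, hαβ, rfl⟩, rfl⟩, rfl⟩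
    refine ⟨2 * t * β, ⟨by positivity, ?_⟩, ?_⟩
    · nlinarith
    · convert hk using 1
      simp only [vadd_eq_add]
      obtain rfl : α = 1 - β := by linarith
      module
  · rintro ⟨a, ha, hx⟩
    rcases ht.eq_or_lt with rfl | ht'
    · have : a = 0 := by linarith [ha.1, ha.2]
      subst this
      exact ⟨x, by simpa using hx, 0, ⟨v, right_mem_segment ℝ _ _, by simp⟩, by simp⟩
    · refine ⟨_, hx, (a - t) • v, ⟨((a - t) / t) • v,
        ⟨1 - a / (2 * t), a / (2 * t), ?_, by have := ha.1; positivity, by ring, ?_⟩, ?_⟩, ?_⟩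
      · rw [sub_nonneg, div_le_one (by positivity)]
        exact ha.2
      · match_scalars
        field_simp
        ring
      · simp only [smul_smul]
        congr 1
        field_simp
      · simp only [vadd_eq_add]
        module

theorem IsSymmetricConvex.volume_real_add_smul_segment (hK : IsSymmetricConvex K)
    (v : EuclideanSpace ℝ (Fin n)) {t : ℝ} (ht : 0 ≤ t) :
    volume.real (K + t • segment ℝ (-v) v) = volume.real K + 2 * sweepRate K v * t := by
  rw [add_smul_segment_eq v ht, measureReal_def, measure_vadd, ← measureReal_def,
    hK.volume_real_sweep v (by positivity)]
  ring

theorem IsSymmetricConvex.contDiffOn_volume (hK : IsSymmetricConvex K)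
    (v : EuclideanSpace ℝ (Fin n)) :
    ContDiffOn ℝ 2 (fun t : ℝ => volume.real (K + t • segment ℝ (-v) v)) (Ici 0) := by
  have : ContDiff ℝ 2 fun t : ℝ => volume.real K + 2 * sweepRate K v * t := by fun_prop
  exact this.contDiffOn.congr fun t ht => hK.volume_real_add_smul_segment v ht

theorem IsSymmetricConvex.mixedVolume_one (hK : IsSymmetricConvex K) (hn : 1 ≤ n)
    (v : EuclideanSpace ℝ (Fin n)) :
    n * mixedVolume 1 K (segment ℝ (-v) v) = 2 * sweepRate K v := by
  have h1 : iteratedDerivWithin 1 (fun t : ℝ => volume.real (K + t • segment ℝ (-v) v)) (Ici 0) 0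
      = 2 * sweepRate K v := by
    rw [iteratedDerivWithin_one]
    rw [derivWithin_congr (fun t (ht : t ∈ Ici (0 : ℝ)) => hK.volume_real_add_smul_segment v ht)
      (hK.volume_real_add_smul_segment v le_rfl)]
    have : HasDerivWithinAt (fun t : ℝ => volume.real K + 2 * sweepRate K v * t)
        (2 * sweepRate K v) (Ici 0) 0 := by
      simpa using (((hasDerivAt_id (0 : ℝ)).const_mul (2 * sweepRate K v)).const_add
        (volume.real K)).hasDerivWithinAt
    exact this.derivWithin (uniqueDiffOn_Ici 0 0 self_mem_Ici)
  rw [mixedVolume, h1]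
  obtain ⟨m, rfl⟩ : ∃ m, n = m + 1 := ⟨n - 1, by omega⟩
  rw [Nat.add_sub_cancel, Nat.factorial_succ]
  have : (m.factorial : ℝ) ≠ 0 := by positivity
  push_cast
  field_simp

/-- Only the vanishing second derivative matters, so the truncated `n - 2` in the coefficient is
harmless for n = 1. -/
theorem IsSymmetricConvex.mixedVolume_two (hK : IsSymmetricConvex K)
    (v : EuclideanSpace ℝ (Fin n)) : mixedVolume 2 K (segment ℝ (-v) v) = 0 := by
  have h2 : iteratedDerivWithin 2 (fun t : ℝ => volume.real (K + t • segment ℝ (-v) v)) (Ici 0) 0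
      = 0 := by
    rw [iteratedDerivWithin_succ]
    have : ∀ t ∈ Ici (0 : ℝ), iteratedDerivWithin 1
        (fun t : ℝ => volume.real (K + t • segment ℝ (-v) v)) (Ici 0) t = 2 * sweepRate K v := by
      intro t ht
      rw [iteratedDerivWithin_one]
      rw [derivWithin_congr (fun t (ht : t ∈ Ici (0 : ℝ)) => hK.volume_real_add_smul_segment v ht)
        (hK.volume_real_add_smul_segment v ht)]
      have : HasDerivWithinAt (fun t : ℝ => volume.real K + 2 * sweepRate K v * t)
          (2 * sweepRate K v) (Ici 0) t := by
        simpa using (((hasDerivAt_id t).const_mul (2 * sweepRate K v)).const_add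
          (volume.real K)).hasDerivWithinAt
      exact this.derivWithin (uniqueDiffOn_Ici 0 t ht)
    rw [derivWithin_congr this (this 0 self_mem_Ici), derivWithin_fun_const]
    rfl
  rw [mixedVolume, h2, mul_zero]

theorem IsSymmetricConvex.volume_interior (hK : IsSymmetricConvex K) :
    volume (interior K) = volume K := by
  refine le_antisymm (measure_mono interior_subset) ?_
  have h : K ⊆ interior K ∪ frontier K := by
    rw [← closure_eq_interior_union_frontier]; exact subset_closure
  refine (measure_mono h).trans ((measure_union_le _ _).trans ?_)
  rw [hK.convex.addHaar_frontier volume, add_zero]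

theorem IsSymmetricConvex.volume_closure (hK : IsSymmetricConvex K) :
    volume (closure K) = volume K := by
  refine le_antisymm ?_ (measure_mono subset_closure)
  rw [closure_eq_self_union_frontier]
  refine (measure_union_le _ _).trans ?_
  rw [hK.convex.addHaar_frontier volume, add_zero]

/-- Two translates of `K` by twice the half-width of `K` in direction `v` do not overlap. -/
theorem IsSymmetricConvex.disjoint_interior_translate (hK : IsSymmetricConvex K)
    {v : EuclideanSpace ℝ (Fin n)} (hv : v ≠ 0) :
    Disjoint (interior K) (((2 * (gauge K v)⁻¹) • v) +ᵥ interior K) := by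
  have hp := hK.gauge_pos.2 hv
  rw [Set.disjoint_left]
  intro x hx hx'
  have h1 := hK.mem_interior_iff.1 hx
  have h2 := hK.mem_interior_iff.1 (mem_vadd_set_iff_neg_vadd_mem.1 hx')
  rw [← hK.gauge_neg] at h2
  -- By symmetry the second point may be reflected. The two points then have gauge below 1, while
  -- their sum 2v / p(v) has gauge 2.
  have h3 := hK.gauge_add_le x (-(-((2 * (gauge K v)⁻¹) • v) +ᵥ x))
  have h4 : x + -(-((2 * (gauge K v)⁻¹) • v) +ᵥ x) = (2 * (gauge K v)⁻¹) • v := by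
    simp only [vadd_eq_add]
    module
  rw [h4, gauge_smul_nonneg (by positivity), mul_assoc, inv_mul_cancel₀ hp.ne'] at h3
  linarith

theorem IsSymmetricConvex.volume_interior_union_translate (hK : IsSymmetricConvex K)
    {v : EuclideanSpace ℝ (Fin n)} (hv : v ≠ 0) :
    volume (interior K ∪ (((2 * (gauge K v)⁻¹) • v) +ᵥ interior K)) = 2 * volume K := by
  rw [measure_union (hK.disjoint_interior_translate hv)
    (isOpen_interior.vadd _).measurableSet, measure_vadd, hK.volume_interior, two_mul]

theorem interior_union_translate_subset (v : EuclideanSpace ℝ (Fin n)) :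
    interior K ∪ (((2 * (gauge K v)⁻¹) • v) +ᵥ interior K)
      ⊆ sweep K v (2 * (gauge K v)⁻¹) := by
  have h0 : 0 ≤ 2 * (gauge K v)⁻¹ := by have := gauge_nonneg (s := K) v; positivity
  rintro x (hx | hx)
  · exact subset_sweep v h0 (interior_subset hx)
  · refine ⟨_, ⟨h0, le_rfl⟩, interior_subset ?_⟩
    convert mem_vadd_set_iff_neg_vadd_mem.1 hx using 1
    simp only [vadd_eq_add]
    module

/-- The sweep of length 2 / p(v) contains two disjoint translates of the interior, so 2|K| ≤ |K| +
(2 / p(v)) · `sweepRate K v`. -/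
theorem IsSymmetricConvex.gauge_mul_volume_le (hK : IsSymmetricConvex K)
    (v : EuclideanSpace ℝ (Fin n)) : gauge K v * volume.real K ≤ 2 * sweepRate K v := by
  rcases eq_or_ne v 0 with rfl | hv
  · simpa using hK.sweepRate_nonneg 0
  have hp := hK.gauge_pos.2 hv
  have h1 := measure_mono (μ := volume) (interior_union_translate_subset (K := K) v)
  rw [hK.volume_interior_union_translate hv] at h1
  have h2 := ENNReal.toReal_mono (hK.volume_sweep_ne_top v _) h1
  rw [ENNReal.toReal_mul, ← measureReal_def, ← measureReal_def,
    hK.volume_real_sweep v (by positivity)] at h2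
  simp only [ENNReal.toReal_ofNat] at h2
  have h3 : volume.real K ≤ (gauge K v)⁻¹ * (2 * sweepRate K v) := by linarith
  rwa [le_inv_mul_iff₀ hp] at h3

end Sweep

/-! ### Polar integration with respect to the gauge. -/

section Polar

variable {n : ℕ} {K : Set (EuclideanSpace ℝ (Fin n))}

theorem IsSymmetricConvex.restrict_closure (hK : IsSymmetricConvex K) :
    volume.restrict (closure K) = volume.restrict K := by
  refine Measure.restrict_congr_set ?_
  have h : (frontier K : Set _) =ᵐ[volume] (∅ : Set (EuclideanSpace ℝ (Fin n))) :=
    ae_eq_empty.2 (hK.convex.addHaar_frontier volume)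
  rw [closure_eq_self_union_frontier]
  simpa using (Filter.EventuallyEq.refl _ (K : Set _)).union h

theorem IsSymmetricConvex.isFiniteMeasure_restrict (hK : IsSymmetricConvex K) :
    IsFiniteMeasure (volume.restrict K) :=
  ⟨by rw [Measure.restrict_apply_univ]; exact hK.volume_ne_top.lt_top⟩

theorem IsSymmetricConvex.integrableOn_of_bounded (hK : IsSymmetricConvex K)
    {G : EuclideanSpace ℝ (Fin n) → ℝ} (hG : AEStronglyMeasurable G (volume.restrict K)) {C : ℝ}
    (hC : ∀ᵐ y ∂volume.restrict K, |G y| ≤ C) : IntegrableOn G K := by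
  have := hK.isFiniteMeasure_restrict
  exact Integrable.of_bound hG C hC

theorem IsSymmetricConvex.closure_inter_gauge_le (hK : IsSymmetricConvex K) {a : ℝ} (ha : 0 < a) :
    {y | gauge K y ≤ a} = a • closure K := by
  ext y
  rw [mem_smul_set_iff_inv_smul_mem₀ ha.ne', hK.mem_closure_iff, gauge_smul_nonneg (by positivity),
    inv_mul_le_iff₀ ha, mul_one]
  rfl

theorem setLIntegral_Ioc_pow (hn : 1 ≤ n) {a : ℝ} (ha : 0 ≤ a) :
    ∫⁻ r in Ioc 0 a, ENNReal.ofReal (n * r ^ (n - 1)) = ENNReal.ofReal (a ^ n) := by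
  have hint : IntegrableOn (fun r : ℝ => n * r ^ (n - 1)) (Ioc 0 a) :=
    (Continuous.integrableOn_Icc (by fun_prop)).mono_set Ioc_subset_Icc_self
  rw [← ofReal_integral_eq_lintegral_ofReal hint, ← intervalIntegral.integral_of_le ha]
  · congr 1
    rw [intervalIntegral.integral_const_mul, integral_pow]
    have : ((n - 1 : ℕ) : ℝ) + 1 = n := by
      rw [Nat.cast_sub hn]; simp
    have hn0 : (n : ℝ) ≠ 0 := by positivity
    rw [this, Nat.sub_add_cancel hn, zero_pow (by omega)]
    field_simp
    ring
  · filter_upwards [ae_restrict_mem measurableSet_Ioc] with r hr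
    have := hr.1
    simp only [Pi.zero_apply]
    positivity

/-- Integration in polar coordinates: the law of the gauge under a homogeneous density. -/
theorem IsSymmetricConvex.map_gauge_withDensity (hK : IsSymmetricConvex K) (hn : 1 ≤ n)
    {G : EuclideanSpace ℝ (Fin n) → ℝ} (hG0 : ∀ y, 0 ≤ G y) (hGi : IntegrableOn G K)
    (hGh : ∀ s : ℝ, 0 < s → ∀ y, G (s • y) = G y) :
    ((volume.restrict K).withDensity fun y => ENNReal.ofReal (G y)).map (gauge K) =
      ENNReal.ofReal (∫ y in K, G y) •
        (volume.restrict (Ioc 0 1)).withDensity fun r : ℝ => ENNReal.ofReal (n * r ^ (n - 1)) := by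
  have : Nonempty (Fin n) := ⟨⟨0, hn⟩⟩
  rw [← hK.restrict_closure]
  rw [IntegrableOn, ← hK.restrict_closure] at hGi
  have hpm : Measurable (gauge K) := hK.continuous_gauge.measurable
  have hfin : IsFiniteMeasure
      ((volume.restrict (closure K)).withDensity fun y => ENNReal.ofReal (G y)) :=
    isFiniteMeasure_withDensity_ofReal hGi.2
  -- Both measures are finite, so half-lines suffice. For a > 0, the part of the closure where the
  -- gauge is at most a is the dilate of the closure by min(a, 1), and invariance of `G` under
  -- dilations gives the factor min(a, 1)^n.
  refine Measure.ext_of_Iic _ _ fun a => ?_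
  have hpre : MeasurableSet (gauge K ⁻¹' Iic a) := hpm measurableSet_Iic
  rw [Measure.map_apply hpm measurableSet_Iic, withDensity_apply _ hpre, Measure.smul_apply,
    withDensity_apply _ measurableSet_Iic, Measure.restrict_restrict hpre,
    Measure.restrict_restrict measurableSet_Iic, smul_eq_mul]
  rcases le_or_gt a 0 with ha | ha
  · have h1 : Iic a ∩ Ioc (0 : ℝ) 1 = ∅ := by
      ext r
      simp only [mem_inter_iff, mem_Iic, mem_Ioc, mem_empty_iff_false, iff_false, not_and]
      intro h1 h2
      linarith
    have h2 : volume (gauge K ⁻¹' Iic a ∩ closure K) = 0 := by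
      refine measure_mono_null (t := {0}) ?_ (measure_singleton _)
      rintro y ⟨hy, -⟩
      by_contra h
      have h3 := hK.gauge_pos.2 h
      have h4 : gauge K y ≤ a := hy
      linarith
    rw [h1, Measure.restrict_empty, lintegral_zero_measure, mul_zero,
      Measure.restrict_eq_zero.2 h2, lintegral_zero_measure]
  · have hb : 0 < min a 1 := lt_min ha one_pos
    have h1 : Iic a ∩ Ioc (0 : ℝ) 1 = Ioc 0 (min a 1) := by
      ext r
      simp only [mem_inter_iff, mem_Iic, mem_Ioc, le_min_iff]
      tauto
    have h2 : gauge K ⁻¹' Iic a ∩ closure K = (min a 1) • closure K := by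
      rw [← hK.closure_inter_gauge_le hb]
      ext y
      simp only [mem_inter_iff, mem_preimage, mem_Iic, hK.mem_closure_iff, mem_ofPred_eq,
        le_min_iff]
    rw [h1, h2, setLIntegral_Ioc_pow hn hb.le]
    have h3 := Measure.setIntegral_comp_smul_of_pos volume G (closure K) hb
    simp only [hGh _ hb, finrank_euclideanSpace_fin, smul_eq_mul] at h3
    rw [eq_inv_mul_iff_mul_eq₀ (by positivity)] at h3
    have h4 : IntegrableOn G ((min a 1) • closure K) :=
      IntegrableOn.mono_set hGi (by rw [← h2]; exact inter_subset_right)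
    rw [← ofReal_integral_eq_lintegral_ofReal h4 (Filter.Eventually.of_forall hG0), ← h3, mul_comm,
      ENNReal.ofReal_mul (integral_nonneg hG0)]

theorem IsSymmetricConvex.integral_gauge_mul_of_nonneg (hK : IsSymmetricConvex K) (hn : 1 ≤ n)
    {G : EuclideanSpace ℝ (Fin n) → ℝ} (hG0 : ∀ y, 0 ≤ G y) (hGi : IntegrableOn G K)
    (hGm : Measurable G) (hGh : ∀ s : ℝ, 0 < s → ∀ y, G (s • y) = G y) {ω : ℝ → ℝ}
    (hω : Continuous ω) :
    ∫ y in K, ω (gauge K y) * G y = (∫ r in (0 : ℝ)..1, ω r * (n * r ^ (n - 1))) *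
      ∫ y in K, G y := by
  have hpm : Measurable (gauge K) := hK.continuous_gauge.measurable
  have h1 : ∫ y in K, ω (gauge K y) * G y =
      ∫ r, ω r ∂(((volume.restrict K).withDensity fun y => ENNReal.ofReal (G y)).map
        (gauge K)) := by
    rw [integral_map hpm.aemeasurable hω.aestronglyMeasurable,
      integral_withDensity_eq_integral_toReal_smul hGm.ennreal_ofReal (by simp)]
    refine integral_congr_ae (Filter.Eventually.of_forall fun y => ?_)
    simp only [ENNReal.toReal_ofReal (hG0 y), smul_eq_mul]
    ring
  rw [h1, hK.map_gauge_withDensity hn hG0 hGi hGh, integral_smul_measure,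
    integral_withDensity_eq_integral_toReal_smul (by fun_prop)
      (Filter.Eventually.of_forall fun _ => ENNReal.ofReal_lt_top),
    ENNReal.toReal_ofReal (integral_nonneg hG0), smul_eq_mul, mul_comm,
    intervalIntegral.integral_of_le zero_le_one]
  congr 1
  refine setIntegral_congr_fun measurableSet_Ioc fun r hr => ?_
  have : 0 ≤ (n : ℝ) * r ^ (n - 1) := by have := hr.1; positivity
  simp only [ENNReal.toReal_ofReal this, smul_eq_mul]
  ring

/-- Integration in polar coordinates, for bounded homogeneous functions. -/
theorem IsSymmetricConvex.integral_gauge_mul (hK : IsSymmetricConvex K) (hn : 1 ≤ n)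
    {G : EuclideanSpace ℝ (Fin n) → ℝ} {C : ℝ} (hC : ∀ y, |G y| ≤ C) (hGm : Measurable G)
    (hGh : ∀ s : ℝ, 0 < s → ∀ y, G (s • y) = G y) {ω : ℝ → ℝ} (hω : Continuous ω) :
    ∫ y in K, ω (gauge K y) * G y = (∫ r in (0 : ℝ)..1, ω r * (n * r ^ (n - 1))) *
      ∫ y in K, G y := by
  have := hK.isFiniteMeasure_restrict
  have hC0 : 0 ≤ C := (abs_nonneg _).trans (hC 0)
  have hGi : IntegrableOn G K :=
    hK.integrableOn_of_bounded hGm.aestronglyMeasurable (Filter.Eventually.of_forall hC)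
  have hCi : IntegrableOn (fun _ => C) K := integrable_const C
  have hωi : IntegrableOn (fun y => ω (gauge K y)) K := by
    obtain ⟨M, hM⟩ := (isCompact_Icc (a := (0 : ℝ)) (b := 1)).exists_bound_of_continuousOn
      hω.continuousOn
    refine hK.integrableOn_of_bounded (C := M)
      (hω.comp hK.continuous_gauge).aestronglyMeasurable ?_
    filter_upwards [ae_restrict_mem₀ (hK.convex.nullMeasurableSet volume)] with y hy
    exact hM _ ⟨gauge_nonneg _, gauge_le_one_of_mem hy⟩
  -- Adding the constant `C` reduces a bounded `G` to the nonnegative case; the contribution of the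
  -- constant is then subtracted.
  have h1 := hK.integral_gauge_mul_of_nonneg hn (G := fun y => G y + C)
    (fun y => by linarith [(abs_le.1 (hC y)).1]) (hGi.add hCi) (hGm.add_const C)
    (fun s hs y => by rw [hGh s hs]) hω
  have h2 := hK.integral_gauge_mul_of_nonneg hn (G := fun _ => C)
    (fun y => hC0) hCi measurable_const (fun s hs y => rfl) hω
  have h3 : ∫ y in K, ω (gauge K y) * (G y + C) =
      (∫ y in K, ω (gauge K y) * G y) + ∫ y in K, ω (gauge K y) * C := by
    simp only [mul_add]
    refine integral_add ?_ (hωi.mul_const C)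
    exact hωi.mul_bdd hGm.aestronglyMeasurable (Filter.Eventually.of_forall hC)
  have h4 : ∫ y in K, (G y + C) = (∫ y in K, G y) + ∫ y in K, C := integral_add hGi hCi
  rw [h3, h4, mul_add, h2] at h1
  linarith

theorem IsSymmetricConvex.integral_gauge_mul_self (hK : IsSymmetricConvex K) (hn : 1 ≤ n)
    {G : EuclideanSpace ℝ (Fin n) → ℝ} {C : ℝ} (hC : ∀ y, |G y| ≤ C) (hGm : Measurable G)
    (hGh : ∀ s : ℝ, 0 < s → ∀ y, G (s • y) = G y) :
    ∫ y in K, gauge K y * G y = n / (n + 1) * ∫ y in K, G y := by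
  have h := hK.integral_gauge_mul hn hC hGm hGh (ω := fun r => r) continuous_id
  rw [h]
  congr 1
  have : ∀ r : ℝ, r * (n * r ^ (n - 1)) = n * r ^ n := fun r => by
    rw [mul_left_comm, ← pow_succ', Nat.sub_add_cancel hn]
  simp only [this]
  rw [intervalIntegral.integral_const_mul, integral_pow]
  simp
  ring

end Polar

/-! ### Two-sided bounds for the integral of |⟨q, v⟩|. -/

section Projection

variable {n : ℕ} {K : Set (EuclideanSpace ℝ (Fin n))}

theorem measurable_abs_inner_gaugeGradient (v : EuclideanSpace ℝ (Fin n)) :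
    Measurable fun y => |⟪gaugeGradient K y, v⟫| := by
  have := measurable_gaugeGradient (K := K)
  fun_prop

theorem IsSymmetricConvex.integrableOn_abs_inner (hK : IsSymmetricConvex K)
    (v : EuclideanSpace ℝ (Fin n)) : IntegrableOn (fun y => |⟪gaugeGradient K y, v⟫|) K :=
  hK.integrableOn_of_bounded (measurable_abs_inner_gaugeGradient v).aestronglyMeasurable
    (C := gauge K v) (Filter.Eventually.of_forall fun y => by
      rw [abs_abs]; exact hK.abs_inner_gaugeGradient_le y v)

theorem measurable_inner_gaugeGradient_sq (v : EuclideanSpace ℝ (Fin n)) :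
    Measurable fun y => ⟪gaugeGradient K y, v⟫ ^ 2 := by
  have := measurable_gaugeGradient (K := K)
  fun_prop

theorem IsSymmetricConvex.integrableOn_inner_sq (hK : IsSymmetricConvex K)
    (v : EuclideanSpace ℝ (Fin n)) : IntegrableOn (fun y => ⟪gaugeGradient K y, v⟫ ^ 2) K :=
  hK.integrableOn_of_bounded (measurable_inner_gaugeGradient_sq v).aestronglyMeasurable
    (C := gauge K v ^ 2) (Filter.Eventually.of_forall fun y => by
      rw [abs_pow]
      gcongr
      exact hK.abs_inner_gaugeGradient_le y v)

/-- The cut-off `(1 - gauge)⁺`. -/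
noncomputable def gaugeTent (K : Set (EuclideanSpace ℝ (Fin n)))
    (y : EuclideanSpace ℝ (Fin n)) : ℝ := max (1 - gauge K y) 0

theorem gaugeTent_nonneg (y : EuclideanSpace ℝ (Fin n)) : 0 ≤ gaugeTent K y := le_max_right _ _

theorem IsSymmetricConvex.lipschitz_gaugeTent (hK : IsSymmetricConvex K) :
    ∃ C, LipschitzWith C (gaugeTent K) := by
  obtain ⟨C, hC⟩ := hK.convex.lipschitz_gauge hK.mem_nhds_zero
  refine ⟨C, LipschitzWith.max_const ?_ 0⟩
  simpa using (LipschitzWith.const (1 : ℝ)).sub hC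

theorem IsSymmetricConvex.continuous_gaugeTent (hK : IsSymmetricConvex K) :
    Continuous (gaugeTent K) :=
  (continuous_const.sub hK.continuous_gauge).max continuous_const

theorem IsSymmetricConvex.gaugeTent_eq_zero (hK : IsSymmetricConvex K)
    {y : EuclideanSpace ℝ (Fin n)} (hy : y ∉ closure K) : gaugeTent K y = 0 := by
  rw [hK.mem_closure_iff, not_le] at hy
  exact max_eq_right (by linarith)

theorem IsSymmetricConvex.hasCompactSupport_gaugeTent (hK : IsSymmetricConvex K) :
    HasCompactSupport (gaugeTent K) :=
  HasCompactSupport.intro hK.bounded.isCompact_closure fun _ hy => hK.gaugeTent_eq_zero hy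

theorem IsSymmetricConvex.integrable_gaugeTent (hK : IsSymmetricConvex K) :
    Integrable (gaugeTent K) :=
  hK.continuous_gaugeTent.integrable_of_hasCompactSupport hK.hasCompactSupport_gaugeTent

theorem IsSymmetricConvex.hasLineDerivAt_gaugeTent (hK : IsSymmetricConvex K)
    {y : EuclideanSpace ℝ (Fin n)} (hd : DifferentiableAt ℝ (gauge K) y) (hy : gauge K y < 1)
    (v : EuclideanSpace ℝ (Fin n)) :
    HasLineDerivAt ℝ (gaugeTent K) (-⟪gaugeGradient K y, v⟫) y v := by
  have h1 : HasDerivAt (fun t : ℝ => 1 - gauge K (y + t • v)) (-⟪gaugeGradient K y, v⟫) 0 :=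
    (hasDerivAt_gauge_line hd v).const_sub 1
  refine h1.congr_of_eventuallyEq ?_
  have hc : Continuous fun t : ℝ => gauge K (y + t • v) :=
    hK.continuous_gauge.comp (by fun_prop)
  have : ∀ᶠ t : ℝ in 𝓝 0, gauge K (y + t • v) < 1 :=
    (hc.tendsto 0).eventually_lt_const (by simpa using hy)
  filter_upwards [this] with t ht
  exact max_eq_left (by linarith)

theorem IsSymmetricConvex.lineDeriv_gaugeTent_of_gt (hK : IsSymmetricConvex K)
    {y : EuclideanSpace ℝ (Fin n)} (hy : y ∉ closure K) (v : EuclideanSpace ℝ (Fin n)) :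
    lineDeriv ℝ (gaugeTent K) y v = 0 := by
  have h1 : HasLineDerivAt ℝ (gaugeTent K) 0 y v := by
    have h0 : HasDerivAt (fun _ : ℝ => (0 : ℝ)) 0 0 := hasDerivAt_const 0 0
    refine h0.congr_of_eventuallyEq ?_
    have hc : Continuous fun t : ℝ => y + t • v := by fun_prop
    have : ∀ᶠ t : ℝ in 𝓝 0, y + t • v ∈ (closure K)ᶜ :=
      (hc.tendsto 0).eventually (isClosed_closure.isOpen_compl.mem_nhds (by simpa using hy))
    filter_upwards [this] with t ht
    exact hK.gaugeTent_eq_zero ht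
  exact h1.lineDeriv

theorem IsSymmetricConvex.integral_one_sub_gauge (hK : IsSymmetricConvex K) (hn : 1 ≤ n) :
    ∫ y, gaugeTent K y = 1 / (n + 1) * volume.real K := by
  have := hK.isFiniteMeasure_restrict
  have h1 : ∫ y, gaugeTent K y = ∫ y in closure K, gaugeTent K y :=
    (setIntegral_eq_integral_of_forall_compl_eq_zero fun y hy => hK.gaugeTent_eq_zero hy).symm
  have h2 := hK.integral_gauge_mul_self hn (G := fun _ => 1) (C := 1) (by simp) measurable_const
    (fun _ _ _ => rfl)
  have hpi : IntegrableOn (gauge K) K := by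
    refine hK.integrableOn_of_bounded (C := 1) hK.continuous_gauge.aestronglyMeasurable ?_
    filter_upwards [ae_restrict_mem₀ (hK.convex.nullMeasurableSet volume)] with y hy
    rw [abs_of_nonneg (gauge_nonneg _)]
    exact gauge_le_one_of_mem hy
  have h3 : ∫ y in K, gaugeTent K y = ∫ y in K, (1 - gauge K y) := by
    refine integral_congr_ae ?_
    filter_upwards [ae_restrict_mem₀ (hK.convex.nullMeasurableSet volume)] with y hy
    exact max_eq_left (sub_nonneg.2 (gauge_le_one_of_mem hy))
  rw [h1, hK.restrict_closure, h3, integral_sub (integrable_const _) hpi]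
  simp only [mul_one, integral_const, measureReal_restrict_apply_univ, smul_eq_mul] at h2 ⊢
  rw [h2]
  field_simp
  ring

theorem IsSymmetricConvex.ae_restrict_gauge_lt_one (hK : IsSymmetricConvex K) :
    ∀ᵐ y ∂volume.restrict K, gauge K y < 1 := by
  have h : ∀ᵐ y ∂volume.restrict K, y ∉ frontier K :=
    ae_restrict_of_ae (measure_eq_zero_iff_ae_notMem.1 (hK.convex.addHaar_frontier volume))
  filter_upwards [h, ae_restrict_mem₀ (hK.convex.nullMeasurableSet volume)] with y h1 h2
  rw [hK.mem_frontier_iff] at h1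
  exact lt_of_le_of_ne (gauge_le_one_of_mem h2) h1

/-- The projection bound from below. -/
theorem IsSymmetricConvex.gauge_mul_volume_le_integral (hK : IsSymmetricConvex K) (hn : 1 ≤ n)
    (v : EuclideanSpace ℝ (Fin n)) :
    gauge K v * volume.real K ≤ n * ∫ y in K, |⟪gaugeGradient K y, v⟫| := by
  rcases eq_or_ne v 0 with rfl | hv
  · simp
  -- The form `w` satisfies ⟪w, v⟫ = p(v) and |⟪w, ·⟫| ≤ p. Integrating by parts against the tent (1
  -- - p)⁺ gives p(v) |K| / (n+1) = ∫ ⟪q, v⟫⟪w, y⟫ ≤ ∫ p |⟪q, v⟫|, and the last integral is n/(n+1)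
  -- times that of |⟪q, v⟫|.
  obtain ⟨w, hwv, hw⟩ := hK.exists_inner_le_gauge hv
  obtain ⟨C, hC⟩ := hK.lipschitz_gaugeTent
  have hwl : LipschitzWith ‖innerSL ℝ w‖₊ fun y => ⟪w, y⟫ := (innerSL ℝ w).lipschitz
  have h := LipschitzWith.integral_lineDeriv_mul_eq (μ := volume) hwl hC
    hK.hasCompactSupport_gaugeTent v
  have hl : ∀ y, lineDeriv ℝ (fun y => ⟪w, y⟫) y v = gauge K v := fun y => by
    rw [← hwv]
    exact ((innerSL ℝ w).hasFDerivAt.hasLineDerivAt v).lineDeriv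
  simp only [hl] at h
  rw [integral_const_mul, hK.integral_one_sub_gauge hn] at h
  have h2 : ∫ y, lineDeriv ℝ (gaugeTent K) y (-v) * ⟪w, y⟫ =
      ∫ y in closure K, lineDeriv ℝ (gaugeTent K) y (-v) * ⟪w, y⟫ :=
    (setIntegral_eq_integral_of_forall_compl_eq_zero fun y hy => by
      rw [hK.lineDeriv_gaugeTent_of_gt hy, zero_mul]).symm
  have h3 : ∫ y in K, lineDeriv ℝ (gaugeTent K) y (-v) * ⟪w, y⟫ =
      ∫ y in K, ⟪gaugeGradient K y, v⟫ * ⟪w, y⟫ := by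
    refine integral_congr_ae ?_
    filter_upwards [hK.ae_restrict_gauge_lt_one,
      ae_restrict_of_ae hK.ae_differentiableAt_gauge] with y hy hd
    rw [(hK.hasLineDerivAt_gaugeTent hd hy (-v)).lineDeriv, inner_neg_right, neg_neg]
  have hb : ∀ y, ⟪gaugeGradient K y, v⟫ * ⟪w, y⟫ ≤ gauge K y * |⟪gaugeGradient K y, v⟫| ∧
      |⟪gaugeGradient K y, v⟫ * ⟪w, y⟫| ≤ gauge K v * gauge K y := fun y => by
    rw [abs_mul]
    refine ⟨?_, mul_le_mul (hK.abs_inner_gaugeGradient_le y v) (hw y) (abs_nonneg _)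
      (gauge_nonneg _)⟩
    calc _ ≤ |⟪gaugeGradient K y, v⟫ * ⟪w, y⟫| := le_abs_self _
      _ = |⟪w, y⟫| * |⟪gaugeGradient K y, v⟫| := by rw [abs_mul, mul_comm]
      _ ≤ _ := by gcongr; exact hw y
  have hm := measurable_gaugeGradient (K := K)
  have hint1 : IntegrableOn (fun y => ⟪gaugeGradient K y, v⟫ * ⟪w, y⟫) K := by
    refine hK.integrableOn_of_bounded (C := gauge K v)
      (Measurable.aestronglyMeasurable (by fun_prop)) ?_
    filter_upwards [hK.ae_restrict_gauge_lt_one] with y hy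
    refine (hb y).2.trans ?_
    exact mul_le_of_le_one_right (gauge_nonneg _) hy.le
  have hint2 : IntegrableOn (fun y => gauge K y * |⟪gaugeGradient K y, v⟫|) K := by
    refine hK.integrableOn_of_bounded (C := gauge K v) (hK.continuous_gauge.measurable.mul
      (measurable_abs_inner_gaugeGradient v)).aestronglyMeasurable ?_
    filter_upwards [hK.ae_restrict_gauge_lt_one] with y hy
    rw [abs_mul, abs_abs, abs_of_nonneg (gauge_nonneg _)]
    exact (mul_le_of_le_one_left (abs_nonneg _) hy.le).trans (hK.abs_inner_gaugeGradient_le y v)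
  have h4 : ∫ y in K, ⟪gaugeGradient K y, v⟫ * ⟪w, y⟫ ≤
      ∫ y in K, gauge K y * |⟪gaugeGradient K y, v⟫| :=
    integral_mono hint1 hint2 fun y => (hb y).1
  rw [hK.integral_gauge_mul_self hn (C := gauge K v)
    (fun y => by rw [abs_abs]; exact hK.abs_inner_gaugeGradient_le y v)
    (measurable_abs_inner_gaugeGradient v)
    (fun s hs y => by rw [gaugeGradient_smul hs]), ← h3, ← hK.restrict_closure, ← h2, ← h,
    hK.restrict_closure] at h4
  have hn1 : (0 : ℝ) < n + 1 := by positivity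
  have h5 : gauge K v * (1 / (n + 1) * volume.real K) =
      (gauge K v * volume.real K) / (n + 1) := by ring
  rw [h5, div_mul_eq_mul_div, div_le_div_iff_of_pos_right hn1] at h4
  exact h4

/-- The set where one of two translated gauges is small. -/
theorem IsSymmetricConvex.volume_gauge_lt_or (hK : IsSymmetricConvex K) (hn : 1 ≤ n)
    (v : EuclideanSpace ℝ (Fin n)) {t c : ℝ} (ht : 0 ≤ t) (hc : 0 < c) :
    volume {y | gauge K y < c ∨ gauge K (y + t • v) < c} ≤
      ENNReal.ofReal (c ^ n * volume.real K) +
        ENNReal.ofReal (t * sweepRate K v * c ^ (n - 1)) := by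
  have hmem : ∀ y, gauge K y < c → c⁻¹ • y ∈ K := fun y hy => interior_subset <| by
    rw [hK.mem_interior_iff, gauge_smul_nonneg (by positivity), inv_mul_lt_iff₀ hc, mul_one]
    exact hy
  -- The union of cK and cK - tv lies in a translate of c times the sweep of length t/c, whose
  -- volume is known exactly.
  have hsub : {y | gauge K y < c ∨ gauge K (y + t • v) < c} ⊆
      (-(t • v)) +ᵥ (c • sweep K v (t / c)) := by
    intro y hy
    rw [mem_vadd_set_iff_neg_vadd_mem, mem_smul_set_iff_inv_smul_mem₀ hc.ne', neg_neg, vadd_eq_add]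
    rcases hy with hy | hy
    · refine ⟨t / c, ⟨by positivity, le_rfl⟩, ?_⟩
      convert hmem y hy using 1
      match_scalars
      · field_simp
        ring
      · ring
    · refine ⟨0, ⟨le_rfl, by positivity⟩, ?_⟩
      rw [zero_smul, sub_zero, add_comm]
      exact hmem _ hy
  refine (measure_mono hsub).trans ?_
  rw [measure_vadd, Measure.addHaar_smul, finrank_euclideanSpace_fin, abs_of_pos (by positivity),
    ← ofReal_measureReal (hK.volume_sweep_ne_top v _), hK.volume_real_sweep v (by positivity),
    ← ENNReal.ofReal_mul (by positivity), ← ENNReal.ofReal_add (by positivity)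
      (mul_nonneg (mul_nonneg ht (hK.sweepRate_nonneg v)) (by positivity))]
  refine le_of_eq ?_
  congr 1
  obtain ⟨m, rfl⟩ : ∃ m, n = m + 1 := ⟨n - 1, by omega⟩
  rw [Nat.add_sub_cancel, pow_succ]
  field_simp

theorem IsSymmetricConvex.volume_lt_gaugeTent (hK : IsSymmetricConvex K) {r : ℝ} (hr : r < 1) :
    ENNReal.ofReal ((1 - r) ^ n * volume.real K) ≤ volume {y | r < gaugeTent K y} := by
  have hc : 0 < 1 - r := by linarith
  have hsub : (1 - r) • interior K ⊆ {y | r < gaugeTent K y} := by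
    intro y hy
    rw [mem_smul_set_iff_inv_smul_mem₀ hc.ne', hK.mem_interior_iff,
      gauge_smul_nonneg (by positivity), inv_mul_lt_iff₀ hc, mul_one] at hy
    have : r < max (1 - gauge K y) 0 := lt_max_of_lt_left (by linarith)
    exact this
  refine le_trans (le_of_eq ?_) (measure_mono hsub)
  rw [Measure.addHaar_smul, finrank_euclideanSpace_fin, abs_of_pos (by positivity),
    hK.volume_interior, ENNReal.ofReal_mul (by positivity), ofReal_measureReal hK.volume_ne_top]

/-- Layer cake: above level r < 1 the maximum lives on two translates of the open dilate (1 - r)K.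
Together they exceed one of them by at most t · `sweepRate K v` · (1 - r)^(n-1) in volume, and the
integral of (1 - r)^(n-1) over [0, 1] is 1/n. -/
theorem IsSymmetricConvex.integral_max_gaugeTent_le (hK : IsSymmetricConvex K) (hn : 1 ≤ n)
    (v : EuclideanSpace ℝ (Fin n)) {t : ℝ} (ht : 0 ≤ t) :
    ∫ y, max (gaugeTent K y) (gaugeTent K (y + t • v)) ≤
      (∫ y, gaugeTent K y) + t * sweepRate K v / n := by
  have hD := hK.sweepRate_nonneg v
  have hcont := hK.continuous_gaugeTent
  have hint2 : Integrable fun y => gaugeTent K (y + t • v) :=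
    hK.integrable_gaugeTent.comp_add_right (t • v)
  have hmaxi : Integrable fun y => max (gaugeTent K y) (gaugeTent K (y + t • v)) :=
    hK.integrable_gaugeTent.sup hint2
  have hmax0 : ∀ y, 0 ≤ max (gaugeTent K y) (gaugeTent K (y + t • v)) := fun y =>
    (gaugeTent_nonneg y).trans (le_max_left _ _)
  have hle : ∫⁻ y, ENNReal.ofReal (max (gaugeTent K y) (gaugeTent K (y + t • v))) ≤
      (∫⁻ y, ENNReal.ofReal (gaugeTent K y)) +
        ∫⁻ r in Ioc (0 : ℝ) 1, ENNReal.ofReal (t * sweepRate K v * (1 - r) ^ (n - 1)) := by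
    rw [lintegral_eq_lintegral_meas_lt volume (Filter.Eventually.of_forall hmax0)
      hmaxi.aemeasurable, lintegral_eq_lintegral_meas_lt volume
      (Filter.Eventually.of_forall gaugeTent_nonneg) hcont.measurable.aemeasurable]
    have h1 : ∫⁻ r in Ioc (0 : ℝ) 1, ENNReal.ofReal (t * sweepRate K v * (1 - r) ^ (n - 1)) =
        ∫⁻ r in Ioi (0 : ℝ), (Ioc (0 : ℝ) 1).indicator
          (fun r => ENNReal.ofReal (t * sweepRate K v * (1 - r) ^ (n - 1))) r := by
      rw [lintegral_indicator measurableSet_Ioc, Measure.restrict_restrict measurableSet_Ioc,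
        inter_eq_left.2 Ioc_subset_Ioi_self]
    rw [h1, ← lintegral_add_right _
      (Measurable.indicator (by fun_prop) measurableSet_Ioc)]
    refine lintegral_mono_ae ?_
    filter_upwards [ae_restrict_mem measurableSet_Ioi] with r hr
    have hr0 : 0 < r := hr
    rcases lt_or_ge r 1 with hr1 | hr1
    · rw [indicator_of_mem (show r ∈ Ioc (0 : ℝ) 1 from ⟨hr0, hr1.le⟩)]
      refine le_trans (measure_mono ?_) ((hK.volume_gauge_lt_or hn v ht (sub_pos.2 hr1)).trans ?_)
      · intro y hy
        have hy : r < max (gaugeTent K y) (gaugeTent K (y + t • v)) := hy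
        have key : ∀ z, r < gaugeTent K z → gauge K z < 1 - r := fun z hz => by
          rcases lt_max_iff.1 hz with h | h <;> linarith
        exact (lt_max_iff.1 hy).imp (key _) (key _)
      · gcongr
        exact hK.volume_lt_gaugeTent hr1
    · have : {y | r < max (gaugeTent K y) (gaugeTent K (y + t • v))} = ∅ := by
        ext y
        have key : ∀ z, gaugeTent K z ≤ r := fun z =>
          max_le (by linarith [gauge_nonneg (s := K) z]) hr0.le
        simpa using ⟨key _, key _⟩
      rw [this, measure_empty]
      exact zero_le
  have hpow : ∫⁻ r in Ioc (0 : ℝ) 1, ENNReal.ofReal (t * sweepRate K v * (1 - r) ^ (n - 1)) =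
      ENNReal.ofReal (t * sweepRate K v / n) := by
    have hint : IntegrableOn (fun r : ℝ => t * sweepRate K v * (1 - r) ^ (n - 1)) (Ioc 0 1) :=
      (Continuous.integrableOn_Icc (by fun_prop)).mono_set Ioc_subset_Icc_self
    rw [← ofReal_integral_eq_lintegral_ofReal hint,
      ← intervalIntegral.integral_of_le zero_le_one]
    · congr 1
      rw [intervalIntegral.integral_const_mul,
        intervalIntegral.integral_comp_sub_left (fun r => r ^ (n - 1)), integral_pow]
      have : ((n - 1 : ℕ) : ℝ) + 1 = n := by
        rw [Nat.cast_sub hn]; simp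
      rw [this, Nat.sub_add_cancel hn]
      simp [show n ≠ 0 by omega]
      ring
    · filter_upwards [ae_restrict_mem measurableSet_Ioc] with r hr
      have : 0 ≤ 1 - r := by linarith [hr.2]
      simp only [Pi.zero_apply]
      positivity
  have hI0 : 0 ≤ ∫ y, gaugeTent K y := integral_nonneg gaugeTent_nonneg
  rw [hpow, ← ofReal_integral_eq_lintegral_ofReal hmaxi (Filter.Eventually.of_forall hmax0),
    ← ofReal_integral_eq_lintegral_ofReal hK.integrable_gaugeTent
      (Filter.Eventually.of_forall gaugeTent_nonneg),
    ← ENNReal.ofReal_add hI0 (by positivity)] at hle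
  exact (ENNReal.ofReal_le_ofReal_iff (by positivity)).1 hle

/-- Since |a - b| = 2 max(a, b) - (a + b), and the tent and its translate have equal integrals, the
bound on the maximum suffices. -/
theorem IsSymmetricConvex.integral_abs_sub_gaugeTent_le (hK : IsSymmetricConvex K) (hn : 1 ≤ n)
    (v : EuclideanSpace ℝ (Fin n)) {t : ℝ} (ht : 0 ≤ t) :
    ∫ y, |gaugeTent K (y + t • v) - gaugeTent K y| ≤ 2 * (t * sweepRate K v / n) := by
  have hint2 : Integrable fun y => gaugeTent K (y + t • v) :=
    hK.integrable_gaugeTent.comp_add_right (t • v)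
  have hmaxi : Integrable fun y => max (gaugeTent K y) (gaugeTent K (y + t • v)) :=
    hK.integrable_gaugeTent.sup hint2
  have h1 : ∀ y, |gaugeTent K (y + t • v) - gaugeTent K y| =
      2 * max (gaugeTent K y) (gaugeTent K (y + t • v)) -
        (gaugeTent K (y + t • v) + gaugeTent K y) := fun y => by
    rcases le_total (gaugeTent K y) (gaugeTent K (y + t • v)) with h | h
    · rw [max_eq_right h, abs_of_nonneg (by linarith)]; ring
    · rw [max_eq_left h, abs_of_nonpos (by linarith)]; ring
  have h2 : ∫ y, gaugeTent K (y + t • v) = ∫ y, gaugeTent K y :=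
    integral_add_right_eq_self (gaugeTent K) (t • v)
  have h3 : Integrable fun y => gaugeTent K (y + t • v) + gaugeTent K y :=
    hint2.add hK.integrable_gaugeTent
  simp_rw [h1]
  rw [integral_sub (hmaxi.const_mul 2) h3, integral_const_mul,
    integral_add hint2 hK.integrable_gaugeTent, h2]
  linarith [hK.integral_max_gaugeTent_le hn v ht]

/-- The projection bound from above: the integral over the boundary of the length of the projected
normal is at most twice the volume of the projection. -/
theorem IsSymmetricConvex.integral_le_sweepRate (hK : IsSymmetricConvex K) (hn : 1 ≤ n)
    (v : EuclideanSpace ℝ (Fin n)) :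
    n * ∫ y in K, |⟪gaugeGradient K y, v⟫| ≤ 2 * sweepRate K v := by
  have hn0 : (0 : ℝ) < n := by exact_mod_cast hn
  have hcont := hK.continuous_gaugeTent
  -- Difference quotients of the tent along `v`. Their L¹ norms are at most 2 · `sweepRate K v` / n,
  -- and almost everywhere on `K` they converge to |⟪q, v⟫|; Fatou's lemma concludes.
  set F : ℕ → EuclideanSpace ℝ (Fin n) → ENNReal := fun k y =>
    ENNReal.ofReal ((k + 1 : ℝ) * |gaugeTent K (y + (1 / (k + 1 : ℝ)) • v) - gaugeTent K y|) with hF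
  have hFm : ∀ k, Measurable (F k) := fun k => by
    refine Measurable.ennreal_ofReal (Continuous.measurable ?_)
    fun_prop
  have hFi : ∀ k, ∫⁻ y, F k y ≤ ENNReal.ofReal (2 * (sweepRate K v / n)) := by
    intro k
    have hi : Integrable fun y =>
        (k + 1 : ℝ) * |gaugeTent K (y + (1 / (k + 1 : ℝ)) • v) - gaugeTent K y| :=
      ((hK.integrable_gaugeTent.comp_add_right _).sub hK.integrable_gaugeTent).abs.const_mul _
    rw [← ofReal_integral_eq_lintegral_ofReal hi
      (Filter.Eventually.of_forall fun y => by positivity), integral_const_mul]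
    refine ENNReal.ofReal_le_ofReal ?_
    have := hK.integral_abs_sub_gaugeTent_le hn v (t := 1 / (k + 1 : ℝ)) (by positivity)
    calc _ ≤ (k + 1 : ℝ) * (2 * (1 / (k + 1 : ℝ) * sweepRate K v / n)) := by gcongr
      _ = _ := by field_simp
  have hlim : ∀ᵐ y ∂volume.restrict K,
      Filter.liminf (fun k => F k y) Filter.atTop = ENNReal.ofReal |⟪gaugeGradient K y, v⟫| := by
    filter_upwards [hK.ae_restrict_gauge_lt_one,
      ae_restrict_of_ae hK.ae_differentiableAt_gauge] with y hy hd
    refine Filter.Tendsto.liminf_eq ?_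
    refine ENNReal.tendsto_ofReal ?_
    have h1 := (hK.hasLineDerivAt_gaugeTent hd hy v).tendsto_slope_zero_right
    have h2 : Filter.Tendsto (fun k : ℕ => 1 / (k + 1 : ℝ)) Filter.atTop (𝓝[>] 0) :=
      tendsto_nhdsWithin_iff.2 ⟨tendsto_one_div_add_atTop_nhds_zero_nat,
        Filter.Eventually.of_forall fun k => by simp only [mem_Ioi]; positivity⟩
    have h3 := (h1.comp h2).abs
    rw [abs_neg] at h3
    refine h3.congr fun k => ?_
    simp only [Function.comp_apply, smul_eq_mul, abs_mul, one_div, inv_inv]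
    rw [abs_of_pos (by positivity : (0 : ℝ) < k + 1)]
  have h1 : ∫⁻ y in K, ENNReal.ofReal |⟪gaugeGradient K y, v⟫| ≤
      ENNReal.ofReal (2 * (sweepRate K v / n)) := by
    calc _ = ∫⁻ y in K, Filter.liminf (fun k => F k y) Filter.atTop :=
          lintegral_congr_ae (hlim.mono fun y hy => hy.symm)
      _ ≤ ∫⁻ y, Filter.liminf (fun k => F k y) Filter.atTop := setLIntegral_le_lintegral _ _
      _ ≤ Filter.liminf (fun k => ∫⁻ y, F k y) Filter.atTop := lintegral_liminf_le hFm
      _ ≤ _ := by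
          refine Filter.liminf_le_of_le (by isBoundedDefault) fun b hb => ?_
          obtain ⟨k, hk⟩ := hb.exists
          exact hk.trans (hFi k)
  have hD := hK.sweepRate_nonneg v
  rw [← ofReal_integral_eq_lintegral_ofReal (hK.integrableOn_abs_inner v)
    (Filter.Eventually.of_forall fun y => abs_nonneg _),
    ENNReal.ofReal_le_ofReal_iff (by positivity), mul_div_assoc', le_div_iff₀ hn0] at h1
  linarith

end Projection

/-! ### The mixed volume inequality and its equality case. -/

section MixedVolumeInequality

variable {n : ℕ} {K : Set (EuclideanSpace ℝ (Fin n))}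

theorem IsSymmetricConvex.ae_boundaryMeasure (hK : IsSymmetricConvex K) (hn : 1 ≤ n) :
    ∀ᵐ x ∂boundaryMeasure K, x ∈ frontier K ∧ DifferentiableAt ℝ (gauge K) x := by
  have h1 : ∀ᵐ x ∂boundaryMeasure K, x ∈ frontier K :=
    ae_restrict_mem isClosed_frontier.measurableSet
  have h2 : ∀ᵐ x ∂boundaryMeasure K, DifferentiableAt ℝ (gauge K) x := by
    rw [ae_iff, boundaryMeasure, Measure.restrict_apply' isClosed_frontier.measurableSet,
      inter_comm]
    exact hK.hausdorffMeasure_not_differentiableAt hn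
  exact h1.and h2

/-- Integrals over the boundary as volume integrals. -/
theorem IsSymmetricConvex.boundary_integral (hK : IsSymmetricConvex K) (hn : 1 ≤ n)
    {G Φ : EuclideanSpace ℝ (Fin n) → ℝ} (hG : AEStronglyMeasurable G (boundaryMeasure K))
    (hΦ : IntegrableOn Φ K)
    (h : ∀ᵐ y ∂volume.restrict K, ‖gaugeGradient K y‖ * G (radialProj K y) = Φ y) :
    Integrable G (boundaryMeasure K) ∧ ∫ x, G x ∂boundaryMeasure K = n * ∫ y in K, Φ y := by
  have hqm := measurable_gaugeGradient (K := K)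
  have hdm : Measurable fun y => ENNReal.ofReal (n * ‖gaugeGradient K y‖) := by fun_prop
  have hlt : ∀ᵐ y ∂volume.restrict K, ENNReal.ofReal (n * ‖gaugeGradient K y‖) < ⊤ :=
    Filter.Eventually.of_forall fun _ => ENNReal.ofReal_lt_top
  have hπ := hK.measurable_radialProj
  have hcongr : (fun y => (ENNReal.ofReal (n * ‖gaugeGradient K y‖)).toReal •
      G (radialProj K y)) =ᵐ[volume.restrict K] fun y => n * Φ y := by
    filter_upwards [h] with y hy
    rw [ENNReal.toReal_ofReal (by positivity), smul_eq_mul, mul_assoc, hy]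
  rw [hK.boundaryMeasure_eq_map hn] at hG ⊢
  constructor
  · rw [integrable_map_measure hG hπ.aemeasurable, coneMeasure,
      integrable_withDensity_iff_integrable_smul' hdm hlt]
    exact (hΦ.const_mul (n : ℝ)).congr hcongr.symm
  · rw [integral_map hπ.aemeasurable hG, coneMeasure,
      integral_withDensity_eq_integral_toReal_smul hdm hlt, integral_congr_ae hcongr,
      integral_const_mul]

theorem supportFunction_segment (u v : EuclideanSpace ℝ (Fin n)) :
    supportFunction (segment ℝ (-v) v) u = |⟪u, v⟫| := by
  have hgr : IsGreatest ((fun y => ⟪u, y⟫) '' segment ℝ (-v) v) |⟪u, v⟫| := by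
    constructor
    · rcases abs_cases ⟪u, v⟫ with h | h
      · exact ⟨v, right_mem_segment ℝ _ _, h.1.symm⟩
      · exact ⟨-v, left_mem_segment ℝ _ _, by simp only [inner_neg_right]; exact h.1.symm⟩
    · rintro _ ⟨_, ⟨a, b, ha, hb, hab, rfl⟩, rfl⟩
      simp only [inner_add_right, inner_smul_right, inner_neg_right]
      have h1 := le_abs_self ⟪u, v⟫
      have h2 := neg_abs_le ⟪u, v⟫
      have h3 : a * |⟪u, v⟫| + b * |⟪u, v⟫| = |⟪u, v⟫| := by rw [← add_mul, hab, one_mul]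
      nlinarith
  exact hgr.csSup_eq

theorem IsSymmetricConvex.inner_outerNormal (hK : IsSymmetricConvex K)
    {x : EuclideanSpace ℝ (Fin n)} (hx : x ∈ frontier K)
    (hd : DifferentiableAt ℝ (gauge K) x) : ⟪x, outerNormal K x⟫ = ‖gaugeGradient K x‖⁻¹ := by
  rw [hK.outerNormal_eq hx hd, inner_smul_right, real_inner_comm, inner_gaugeGradient_self hd,
    hK.mem_frontier_iff.1 hx, mul_one]

theorem IsSymmetricConvex.ae_restrict_regular (hK : IsSymmetricConvex K) (hn : 1 ≤ n) :
    ∀ᵐ y ∂volume.restrict K, y ≠ 0 ∧ DifferentiableAt ℝ (gauge K) y := by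
  have : Nonempty (Fin n) := ⟨⟨0, hn⟩⟩
  refine ae_restrict_of_ae ?_
  filter_upwards [hK.ae_differentiableAt_gauge, Measure.ae_ne volume 0] with y h1 h2
  exact ⟨h2, h1⟩

/-- At regular points the integrand is ⟪q, v⟫² / ‖q‖, and the density ‖q‖ of the boundary formula
cancels the denominator. -/
theorem IsSymmetricConvex.integral_support_sq_div (hK : IsSymmetricConvex K) (hn : 1 ≤ n)
    (v : EuclideanSpace ℝ (Fin n)) :
    Integrable (fun x => supportFunction (segment ℝ (-v) v) (outerNormal K x) ^ 2 /
      ⟪x, outerNormal K x⟫) (boundaryMeasure K) ∧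
    ∫ x, supportFunction (segment ℝ (-v) v) (outerNormal K x) ^ 2 /
      ⟪x, outerNormal K x⟫ ∂boundaryMeasure K = n * ∫ y in K, ⟪gaugeGradient K y, v⟫ ^ 2 := by
  have hqm := measurable_gaugeGradient (K := K)
  have hval : ∀ x ∈ frontier K, DifferentiableAt ℝ (gauge K) x →
      supportFunction (segment ℝ (-v) v) (outerNormal K x) ^ 2 / ⟪x, outerNormal K x⟫ =
        ⟪gaugeGradient K x, v⟫ ^ 2 / ‖gaugeGradient K x‖ := by
    intro x hx hd
    have hq := norm_ne_zero_iff.2 (hK.gaugeGradient_ne_zero hd (hK.ne_zero_of_mem_frontier hx))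
    rw [supportFunction_segment, sq_abs, hK.inner_outerNormal hx hd, hK.outerNormal_eq hx hd,
      inner_smul_left]
    simp only [map_inv₀, conj_trivial]
    field_simp
  refine hK.boundary_integral hn ?_ (hK.integrableOn_inner_sq v) ?_
  · have : Measurable fun x => ⟪gaugeGradient K x, v⟫ ^ 2 / ‖gaugeGradient K x‖ := by fun_prop
    refine this.aestronglyMeasurable.congr ?_
    filter_upwards [hK.ae_boundaryMeasure hn] with x hx
    exact (hval x hx.1 hx.2).symm
  · filter_upwards [hK.ae_restrict_regular hn] with y hy
    rw [hval _ (hK.radialProj_mem_frontier hy.1) ((hK.differentiableAt_radialProj_iff hy.1).2 hy.2),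
      hK.gaugeGradient_radialProj hy.1]
    have hq := norm_ne_zero_iff.2 (hK.gaugeGradient_ne_zero hy.2 hy.1)
    field_simp

theorem IsSymmetricConvex.integral_inner_sq_le (hK : IsSymmetricConvex K)
    (v : EuclideanSpace ℝ (Fin n)) :
    ∫ y in K, ⟪gaugeGradient K y, v⟫ ^ 2 ≤
      gauge K v * ∫ y in K, |⟪gaugeGradient K y, v⟫| := by
  rw [← integral_const_mul]
  refine integral_mono (hK.integrableOn_inner_sq v) ((hK.integrableOn_abs_inner v).const_mul _)
    fun y => ?_
  simp only
  rw [← sq_abs, sq]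
  gcongr
  exact hK.abs_inner_gaugeGradient_le y v

/-- Extremal sets are cylinders. -/
theorem IsSymmetricConvex.mem_closure_decomposition (hK : IsSymmetricConvex K)
    {v : EuclideanSpace ℝ (Fin n)} (hv : v ≠ 0)
    (heq : 2 * sweepRate K v = gauge K v * volume.real K) {x : EuclideanSpace ℝ (Fin n)}
    (hx : x ∈ interior K) :
    ∃ a ∈ Icc 0 (2 * (gauge K v)⁻¹), x + a • v ∈ closure K ∧
      x + (a - 2 * (gauge K v)⁻¹) • v ∈ closure K := by
  have hp := hK.gauge_pos.2 hv
  set g := (gauge K v)⁻¹ with hg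
  have hg0 : 0 < g := inv_pos.2 hp
  set U := interior K ∪ (((2 * g) • v) +ᵥ interior K) with hU
  set F := closure K ∪ (((2 * g) • v) +ᵥ closure K) with hF
  have hUF : U ⊆ F := union_subset_union (interior_subset.trans subset_closure)
    (vadd_set_mono (interior_subset.trans subset_closure))
  have hFclosed : IsClosed F := isClosed_closure.union (isClosed_closure.vadd _)
  have hvol : volume (sweep K v (2 * g)) = volume U := by
    rw [hU, hK.volume_interior_union_translate hv, ← ofReal_measureReal (hK.volume_sweep_ne_top v _),
      hK.volume_real_sweep v (by positivity), ← ofReal_measureReal hK.volume_ne_top,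
      two_mul (ENNReal.ofReal _), ← ENNReal.ofReal_add measureReal_nonneg measureReal_nonneg]
    congr 1
    have : 2 * g * sweepRate K v = g * (2 * sweepRate K v) := by ring
    rw [this, heq, hg, inv_mul_cancel_left₀ hp.ne']
  have hUo : IsOpen U := isOpen_interior.union (isOpen_interior.vadd _)
  -- Under the equality hypothesis the sweep has volume 2|K|, as does the union `U` of the two open
  -- translates. What remains of its interior outside the closed set `F` is open and null, hence
  -- empty.
  have hnull : volume (interior (sweep K v (2 * g)) \ F) = 0 := by
    refine measure_mono_null (sdiff_subset_sdiff interior_subset hUF) ?_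
    rw [measure_sdiff (interior_union_translate_subset v) hUo.measurableSet.nullMeasurableSet
      (hvol ▸ hK.volume_sweep_ne_top v _), hvol, tsub_self]
  have hempty : interior (sweep K v (2 * g)) \ F = ∅ :=
    (isOpen_interior.sdiff hFclosed).eq_empty_of_measure_zero hnull
  have hcover : ∀ a ∈ Icc 0 (2 * g), x + a • v ∈ F := by
    intro a ha
    refine sdiff_eq_empty.1 hempty ?_
    have hsub : (a • v) +ᵥ interior K ⊆ sweep K v (2 * g) := by
      rintro z hz
      refine ⟨a, ha, interior_subset ?_⟩
      convert mem_vadd_set_iff_neg_vadd_mem.1 hz using 1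
      simp only [vadd_eq_add]
      module
    refine interior_maximal hsub (isOpen_interior.vadd _) ?_
    rw [mem_vadd_set_iff_neg_vadd_mem]
    simpa using hx
  have hpre : IsPreconnected (Icc (0 : ℝ) (2 * g)) := isPreconnected_Icc
  rw [isPreconnected_closed_iff] at hpre
  have hc1 : Continuous fun a : ℝ => x + a • v := by fun_prop
  have hc2 : Continuous fun a : ℝ => x + (a - 2 * g) • v := by fun_prop
  have hxcl : x ∈ closure K := subset_closure (interior_subset hx)
  -- The parameters a for which x + av lies in the closure, respectively in its translate by 2gv,
  -- form two closed sets covering the interval [0, 2g]; a = 0 lies in the first and a = 2g in the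
  -- second. By connectedness some a lies in both, which places `x` on a chord parallel to `v` of
  -- the maximal length.
  obtain ⟨a, ha, ha1, ha2⟩ := hpre _ _ (isClosed_closure.preimage hc1)
    (isClosed_closure.preimage hc2) (fun a ha => by
      rcases hcover a ha with h | h
      · exact Or.inl h
      · refine Or.inr ?_
        simp only [mem_preimage]
        convert mem_vadd_set_iff_neg_vadd_mem.1 h using 1
        simp only [vadd_eq_add]
        module)
    ⟨0, ⟨le_rfl, by positivity⟩, by simpa using hxcl⟩
    ⟨2 * g, ⟨by positivity, le_rfl⟩, by simpa using hxcl⟩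
  exact ⟨a, ha, ha1, ha2⟩

/-- `C` is the set of midpoints of chords ±v / p(v) of the closure; every interior point lies on
such a chord. The span of `C` together with `v` is everything. If `v` were in that span, `C` would
be a body containing a positive multiple of `v`, and adding v / p(v) to it would leave the closure
of `K`. So the dimension is n - 1. -/
theorem IsSymmetricConvex.exists_cylinder (hK : IsSymmetricConvex K)
    {v : EuclideanSpace ℝ (Fin n)} (hv : v ≠ 0)
    (heq : 2 * sweepRate K v = gauge K v * volume.real K) :
    ∃ (s : ℝ) (C : Set (EuclideanSpace ℝ (Fin n))), 0 < s ∧ Convex ℝ C ∧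
      (∀ x ∈ C, -x ∈ C) ∧ Module.finrank ℝ (vectorSpan ℝ C) = n - 1 ∧
      closure K = C + segment ℝ (-(s • v)) (s • v) := by
  have hp := hK.gauge_pos.2 hv
  set g := (gauge K v)⁻¹ with hg
  have hg0 : 0 < g := inv_pos.2 hp
  have hclneg : ∀ x ∈ closure K, -x ∈ closure K := fun x hx => by
    rw [hK.mem_closure_iff] at hx ⊢
    rwa [hK.gauge_neg]
  set C : Set (EuclideanSpace ℝ (Fin n)) := {c | c + g • v ∈ closure K ∧ c - g • v ∈ closure K}
    with hC
  have hCconv : Convex ℝ C := by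
    rintro x ⟨hx1, hx2⟩ y ⟨hy1, hy2⟩ a b ha hb hab
    obtain rfl : a = 1 - b := by linarith
    constructor
    · convert hK.convex.closure hx1 hy1 ha hb hab using 1
      module
    · convert hK.convex.closure hx2 hy2 ha hb hab using 1
      module
  have hCsymm : ∀ x ∈ C, -x ∈ C := by
    rintro x ⟨hx1, hx2⟩
    refine ⟨?_, ?_⟩
    · convert hclneg _ hx2 using 1
      module
    · convert hclneg _ hx1 using 1
      module
  have hgv : g • v ∈ closure K := by
    rw [hK.mem_closure_iff, gauge_smul_nonneg hg0.le, hg, inv_mul_cancel₀ hp.ne']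
  have hC0 : (0 : EuclideanSpace ℝ (Fin n)) ∈ C :=
    ⟨by simpa using hgv, by simpa using hclneg _ hgv⟩
  have hCsub : C ⊆ closure K := by
    rintro x ⟨hx1, hx2⟩
    have := hK.convex.closure hx1 hx2 (by norm_num : (0 : ℝ) ≤ 1 / 2)
      (by norm_num : (0 : ℝ) ≤ 1 / 2) (by norm_num)
    convert this using 1
    module
  have hCclosed : IsClosed C :=
    (isClosed_closure.preimage (by fun_prop : Continuous fun c => c + g • v)).inter
      (isClosed_closure.preimage (by fun_prop : Continuous fun c => c - g • v))
  have hCcompact : IsCompact C := hK.bounded.isCompact_closure.of_isClosed_subset hCclosed hCsub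
  have hcl : closure K = C + segment ℝ (-(g • v)) (g • v) := by
    apply Subset.antisymm
    · have hseg : IsCompact (segment ℝ (-(g • v)) (g • v)) := by
        rw [segment_eq_image_lineMap]
        exact isCompact_Icc.image (AffineMap.lineMap_continuous)
      have hclosed : IsClosed (C + segment ℝ (-(g • v)) (g • v)) :=
        (hCcompact.add hseg).isClosed
      rw [← hK.convex.closure_interior_eq_closure_of_nonempty_interior hK.interior_nonempty]
      refine closure_minimal (fun x hx => ?_) hclosed
      obtain ⟨a, ha, ha1, ha2⟩ := hK.mem_closure_decomposition hv heq hx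
      refine ⟨x + (a - g) • v, ⟨?_, ?_⟩, (g - a) • v, ⟨a / (2 * g), 1 - a / (2 * g), ?_, ?_, ?_, ?_⟩,
        ?_⟩
      · convert ha1 using 1
        module
      · convert ha2 using 1
        module
      · have := ha.1
        positivity
      · rw [sub_nonneg, div_le_one (by positivity)]
        exact ha.2
      · ring
      · match_scalars
        field_simp
        ring
      · simp only
        module
    · rintro _ ⟨c, ⟨hc1, hc2⟩, _, ⟨a, b, ha, hb, hab, rfl⟩, rfl⟩
      convert hK.convex.closure hc2 hc1 ha hb hab using 1
      obtain rfl : a = 1 - b := by linarith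
      simp only
      module
  refine ⟨g, C, hg0, hCconv, hCsymm, ?_, hcl⟩
  have hCW : ∀ c ∈ C, c ∈ vectorSpan ℝ C := fun c hc => by
    simpa using vsub_mem_vectorSpan ℝ hc hC0
  have hsup : vectorSpan ℝ C ⊔ Submodule.span ℝ {v} = ⊤ := by
    rw [eq_top_iff]
    intro y _
    obtain ⟨ε, hε, hεy⟩ : ∃ ε : ℝ, 0 < ε ∧ ε • y ∈ closure K := by
      rcases eq_or_ne y 0 with rfl | hy
      · exact ⟨1, one_pos, by simpa using hCsub hC0⟩
      · have := hK.gauge_pos.2 hy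
        exact ⟨(gauge K y)⁻¹, inv_pos.2 this, hK.mem_closure_iff.2 (hK.gauge_radialProj hy).le⟩
    rw [hcl] at hεy
    obtain ⟨c, hc, _, ⟨a, b, ha, hb, hab, rfl⟩, hsum⟩ := hεy
    have hy : y = ε⁻¹ • (ε • y) := by rw [smul_smul, inv_mul_cancel₀ hε.ne', one_smul]
    rw [hy, ← hsum]
    refine Submodule.smul_mem _ _ (Submodule.add_mem_sup (hCW c hc) ?_)
    have hvm := Submodule.mem_span_singleton_self (R := ℝ) v
    exact add_mem (Submodule.smul_mem _ _ (neg_mem (Submodule.smul_mem _ _ hvm)))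
      (Submodule.smul_mem _ _ (Submodule.smul_mem _ _ hvm))
  have hvW : v ∉ vectorSpan ℝ C := by
    intro hvW
    have htop : vectorSpan ℝ C = ⊤ := by
      rw [← hsup, eq_comm, sup_eq_left]
      exact (Submodule.span_singleton_le_iff_mem _ _).2 hvW
    have haff : affineSpan ℝ C = ⊤ :=
      (AffineSubspace.affineSpan_eq_top_iff_vectorSpan_eq_top_of_nonempty _ _ _ ⟨0, hC0⟩).2 htop
    have hCK : IsSymmetricConvex C :=
      ⟨hCsymm, hCconv, hCcompact.isBounded, hCconv.interior_nonempty_iff_affineSpan_eq_top.2 haff⟩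
    have hpC := hCK.gauge_pos.2 hv
    have h1 : radialProj C v ∈ C :=
      hCclosed.closure_subset (hCK.mem_closure_iff.2 (hCK.gauge_radialProj hv).le)
    have h2 := hK.mem_closure_iff.1 h1.1
    rw [radialProj, ← add_smul, gauge_smul_nonneg (by positivity), add_mul, hg,
      inv_mul_cancel₀ hp.ne'] at h2
    have : 0 < (gauge C v)⁻¹ * gauge K v := by positivity
    linarith
  have hdisj : vectorSpan ℝ C ⊓ Submodule.span ℝ {v} = ⊥ := by
    rw [← disjoint_iff, Submodule.disjoint_span_singleton' hv]
    exact hvW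
  have hfr := Submodule.finrank_sup_add_finrank_inf_eq (vectorSpan ℝ C) (Submodule.span ℝ {v})
  rw [hsup, hdisj, finrank_top, finrank_bot, finrank_span_singleton hv,
    finrank_euclideanSpace_fin] at hfr
  omega

theorem gaugeGradient_eq_of_inner_le {x w : EuclideanSpace ℝ (Fin n)}
    (hd : DifferentiableAt ℝ (gauge K) x) (hw : ∀ y, ⟪w, y⟫ ≤ gauge K y)
    (hx : ⟪w, x⟫ = gauge K x) : gaugeGradient K x = w := by
  have h2 : HasGradientAt (fun y => gauge K y - ⟪w, y⟫) (gaugeGradient K x - w) x := by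
    rw [hasGradientAt_iff_hasFDerivAt, map_sub]
    exact (hasGradientAt_gauge hd).hasFDerivAt.sub (InnerProductSpace.toDual ℝ _ _).hasFDerivAt
  have hmin : IsLocalMin (fun y => gauge K y - ⟪w, y⟫) x :=
    Filter.Eventually.of_forall fun y => by
      simp only [hx, sub_self, sub_nonneg]
      exact hw y
  have h4 := hmin.hasFDerivAt_eq_zero h2.hasFDerivAt
  exact sub_eq_zero.1
    ((InnerProductSpace.toDual ℝ (EuclideanSpace ℝ (Fin n))).map_eq_zero_iff.1 h4)

/-- On a cylinder, the equality case of the projection bounds. -/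
theorem IsSymmetricConvex.cylinder_equality (hK : IsSymmetricConvex K) (hn : 1 ≤ n)
    {v : EuclideanSpace ℝ (Fin n)} {s : ℝ} {C : Set (EuclideanSpace ℝ (Fin n))}
    (hs : 0 < s) (hC : Convex ℝ C) (hCs : ∀ x ∈ C, -x ∈ C)
    (hCd : Module.finrank ℝ (vectorSpan ℝ C) = n - 1)
    (hcl : closure K = C + segment ℝ (-(s • v)) (s • v)) :
    2 * sweepRate K v = gauge K v * volume.real K ∧
      ∀ᵐ y ∂volume.restrict K, ⟪gaugeGradient K y, v⟫ ^ 2 =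
        gauge K v * |⟪gaugeGradient K y, v⟫| := by
  have hKne : (closure K).Nonempty := (hK.interior_nonempty.mono interior_subset).closure
  have hC0 : (0 : EuclideanSpace ℝ (Fin n)) ∈ C := by
    obtain ⟨_, c, hc, -⟩ := hcl ▸ hKne
    have := hC hc (hCs c hc) (by norm_num : (0 : ℝ) ≤ 1 / 2)
      (by norm_num : (0 : ℝ) ≤ 1 / 2) (by norm_num)
    simpa using this
  have hCW : ∀ c ∈ C, c ∈ vectorSpan ℝ C := fun c hc => by
    simpa using vsub_mem_vectorSpan ℝ hc hC0
  have hmem : ∀ x, x ∈ closure K ↔ ∃ c ∈ C, ∃ a, |a| ≤ s ∧ x = c + a • v := by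
    intro x
    rw [hcl, mem_add]
    constructor
    · rintro ⟨c, hc, _, ⟨α, β, hα, hβ, hαβ, rfl⟩, rfl⟩
      refine ⟨c, hc, (β - α) * s, ?_, ?_⟩
      · rw [abs_mul, abs_of_pos hs]
        refine mul_le_of_le_one_left hs.le ?_
        rw [abs_le]
        constructor <;> linarith
      · module
    · rintro ⟨c, hc, a, ha, rfl⟩
      obtain ⟨h1, h2⟩ := abs_le.1 ha
      refine ⟨c, hc, a • v, ⟨(1 - a / s) / 2, (1 + a / s) / 2, ?_, ?_, by ring, ?_⟩, rfl⟩
      · have : a / s ≤ 1 := (div_le_one hs).2 h2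
        linarith
      · have : -1 ≤ a / s := by rw [le_div_iff₀ hs]; linarith
        linarith
      · match_scalars
        field_simp
        ring
  have hvW : v ∉ vectorSpan ℝ C := by
    intro hvW
    have htop : vectorSpan ℝ C = ⊤ := by
      rw [eq_top_iff]
      intro y _
      rcases eq_or_ne y 0 with rfl | hy
      · exact zero_mem _
      · obtain ⟨c, hc, a, -, hca⟩ :=
          (hmem _).1 (hK.mem_closure_iff.2 (hK.gauge_radialProj hy).le)
        rw [← hK.gauge_smul_radialProj y, hca]
        exact Submodule.smul_mem _ _ (add_mem (hCW c hc) (Submodule.smul_mem _ _ hvW))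
    rw [htop, finrank_top, finrank_euclideanSpace_fin] at hCd
    omega
  obtain ⟨l, hlv, hlW⟩ := Submodule.exists_le_ker_of_notMem hvW
  -- The linear form vanishing on the span of `C` with value 1/s at `v`. It lies below the gauge and
  -- touches it on the cone over the face C + sv, where it must be the gradient.
  set w : EuclideanSpace ℝ (Fin n) :=
    (s * l v)⁻¹ • (InnerProductSpace.toDual ℝ _).symm l.toContinuousLinearMap with hw
  have hwi : ∀ y, ⟪w, y⟫ = (s * l v)⁻¹ * l y := fun y => by
    rw [hw, inner_smul_left, InnerProductSpace.toDual_symm_apply]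
    simp
  have hwca : ∀ c ∈ C, ∀ a : ℝ, ⟪w, c + a • v⟫ = a / s := by
    intro c hc a
    have : l c = 0 := hlW (hCW c hc)
    rw [hwi, map_add, this, zero_add, map_smul, smul_eq_mul]
    field_simp
  have hwle : ∀ y, ⟪w, y⟫ ≤ gauge K y := by
    intro y
    rcases eq_or_ne y 0 with rfl | hy
    · simp
    · obtain ⟨c, hc, a, ha, hca⟩ :=
        (hmem _).1 (hK.mem_closure_iff.2 (hK.gauge_radialProj hy).le)
      have h1 : ⟪w, radialProj K y⟫ ≤ 1 := by
        rw [hca, hwca c hc, div_le_one hs]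
        exact (abs_le.1 ha).2
      calc ⟪w, y⟫ = gauge K y * ⟪w, radialProj K y⟫ := by
            rw [← inner_smul_right, hK.gauge_smul_radialProj]
        _ ≤ gauge K y * 1 := by gcongr; exact gauge_nonneg _
        _ = gauge K y := mul_one _
  have hpv : gauge K v = s⁻¹ := by
    refine le_antisymm ?_ ?_
    · have h1 : gauge K (s • v) ≤ 1 := hK.mem_closure_iff.1
        ((hmem _).2 ⟨0, hC0, s, by rw [abs_of_pos hs], by simp⟩)
      rw [gauge_smul_nonneg hs.le] at h1
      rwa [← one_div, le_div_iff₀' hs]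
    · have h1 := hwle v
      have h2 := hwca 0 hC0 1
      rw [zero_add, one_smul, one_div] at h2
      rwa [h2] at h1
  constructor
  · refine le_antisymm ?_ (hK.gauge_mul_volume_le v)
    have hsub : sweep K v (2 * s) ⊆ closure K ∪ (((2 * s) • v) +ᵥ closure K) := by
      rintro x ⟨b, hb, hx⟩
      obtain ⟨c, hc, a, ha, hca⟩ := (hmem _).1 (subset_closure hx)
      obtain ⟨h1, h2⟩ := abs_le.1 ha
      have hx' : x = c + (a + b) • v := by
        rw [sub_eq_iff_eq_add.1 hca]
        module
      rcases le_total (a + b) s with h | h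
      · exact Or.inl ((hmem _).2 ⟨c, hc, a + b, abs_le.2 ⟨by linarith [hb.1], h⟩, hx'⟩)
      · refine Or.inr (mem_vadd_set_iff_neg_vadd_mem.2
          ((hmem _).2 ⟨c, hc, a + b - 2 * s, abs_le.2 ⟨by linarith, by linarith [hb.2]⟩, ?_⟩))
        rw [hx', vadd_eq_add]
        module
    have h1 : volume (sweep K v (2 * s)) ≤ volume K + volume K := by
      refine (measure_mono hsub).trans ((measure_union_le _ _).trans ?_)
      rw [measure_vadd, hK.volume_closure]
    have h2 := ENNReal.toReal_mono (by simp [hK.volume_ne_top]) h1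
    rw [ENNReal.toReal_add hK.volume_ne_top hK.volume_ne_top, ← measureReal_def, ← measureReal_def,
      hK.volume_real_sweep v (by positivity)] at h2
    rw [hpv, le_inv_mul_iff₀ hs]
    linarith
  · filter_upwards [hK.ae_restrict_regular hn] with y hy
    have hpos : ∀ z : EuclideanSpace ℝ (Fin n), z ≠ 0 → DifferentiableAt ℝ (gauge K) z →
        0 < ⟪gaugeGradient K z, v⟫ → ⟪gaugeGradient K z, v⟫ = s⁻¹ := by
      intro z hz hd hq
      obtain ⟨c, hc, a, ha, hca⟩ :=
        (hmem _).1 (hK.mem_closure_iff.2 (hK.gauge_radialProj hz).le)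
      -- The form ⟪q(z), ·⟫ is at most 1 on the closure and equals 1 at the radial projection of
      -- `z`. If it increases along `v`, that point must be the upper end of its chord.
      have has : a = s := by
        refine le_antisymm (abs_le.1 ha).2 ?_
        have h1 : gauge K (c + s • v) ≤ 1 :=
          hK.mem_closure_iff.1 ((hmem _).2 ⟨c, hc, s, by rw [abs_of_pos hs], rfl⟩)
        have h2 := (hK.inner_gaugeGradient_le z (c + s • v)).trans h1
        have h3 : ⟪gaugeGradient K z, radialProj K z⟫ = 1 := by
          rw [radialProj, inner_smul_right, inner_gaugeGradient_self hd,
            inv_mul_cancel₀ (hK.gauge_pos.2 hz).ne']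
        rw [hca] at h3
        rw [inner_add_right, inner_smul_right] at h2 h3
        by_contra hlt
        nlinarith [not_le.1 hlt]
      have hwz : ⟪w, z⟫ = gauge K z := by
        calc ⟪w, z⟫ = gauge K z * ⟪w, radialProj K z⟫ := by
              rw [← inner_smul_right, hK.gauge_smul_radialProj]
          _ = gauge K z := by rw [hca, hwca c hc, has, div_self hs.ne', mul_one]
      rw [gaugeGradient_eq_of_inner_le hd hwle hwz]
      have h2 := hwca 0 hC0 1
      rwa [zero_add, one_smul, one_div] at h2
    have hneg : gaugeGradient K (-y) = -gaugeGradient K y ∧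
        DifferentiableAt ℝ (gauge K) (-y) := by
      have hfun : gauge K = fun z => gauge K (-z) := funext fun z => (hK.gauge_neg z).symm
      have h1 : HasFDerivAt (gauge K) (-(fderiv ℝ (gauge K) y)) (-y) := by
        rw [hfun]
        have h2 : HasFDerivAt (gauge K) (fderiv ℝ (gauge K) y) (-(-y)) := by
          rw [neg_neg]; exact hy.2.hasFDerivAt
        have h3 := h2.comp (-y) (hasFDerivAt_id (-y)).neg
        refine h3.congr_fderiv ?_
        ext z
        simp [← hfun]
      refine ⟨?_, h1.differentiableAt⟩
      rw [gaugeGradient, gaugeGradient, gradient, gradient, h1.fderiv, map_neg]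
    rcases lt_trichotomy ⟪gaugeGradient K y, v⟫ 0 with h | h | h
    · have h1 := hpos (-y) (neg_ne_zero.2 hy.1) hneg.2 (by
        rw [hneg.1, inner_neg_left]; linarith)
      rw [hneg.1, inner_neg_left] at h1
      rw [abs_of_neg h, h1, hpv, ← h1]
      ring
    · rw [h]
      simp
    · rw [abs_of_pos h, hpos y hy.1 hy.2 h, hpv]
      ring

theorem IsSymmetricConvex.mixedVolume_inequality (hK : IsSymmetricConvex K) (hn : 1 ≤ n)
    (v : EuclideanSpace ℝ (Fin n)) :
    n * ∫ y in K, ⟪gaugeGradient K y, v⟫ ^ 2 ≤ (2 * sweepRate K v) ^ 2 / volume.real K ∧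
    (n * ∫ y in K, ⟪gaugeGradient K y, v⟫ ^ 2 = (2 * sweepRate K v) ^ 2 / volume.real K ↔
      v = 0 ∨ ∃ (s : ℝ) (C : Set (EuclideanSpace ℝ (Fin n))), 0 < s ∧ Convex ℝ C ∧
        (∀ x ∈ C, -x ∈ C) ∧ Module.finrank ℝ (vectorSpan ℝ C) = n - 1 ∧
        closure K = C + segment ℝ (-(s • v)) (s • v)) := by
  have hV := hK.volume_pos
  have h1 := hK.integral_inner_sq_le v
  have h2 := hK.integral_le_sweepRate hn v
  have h3 := hK.gauge_mul_volume_le v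
  have h4 := hK.gauge_mul_volume_le_integral hn v
  have hp := gauge_nonneg (s := K) v
  set P := gauge K v
  set A := ∫ y in K, |⟪gaugeGradient K y, v⟫|
  set Q := ∫ y in K, ⟪gaugeGradient K y, v⟫ ^ 2 with hQ
  set D := 2 * sweepRate K v with hD
  have hD0 : 0 ≤ D := by have := hK.sweepRate_nonneg v; positivity
  -- The chain is n Q ≤ n P A ≤ P D ≤ D² / |K|. Equality in the last link alone, with D > 0, already
  -- gives D = P |K| and hence a cylinder.
  have hstep : n * Q ≤ P * D := by
    calc n * Q ≤ n * (P * A) := by gcongr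
      _ = P * (n * A) := by ring
      _ ≤ P * D := by gcongr
  have hstep2 : P * D ≤ D ^ 2 / volume.real K := by
    rw [le_div_iff₀ hV]
    nlinarith
  refine ⟨hstep.trans hstep2, fun heq => ?_, ?_⟩
  · rcases eq_or_ne v 0 with hv | hv
    · exact Or.inl hv
    · refine Or.inr (hK.exists_cylinder hv ?_)
      have hPpos : 0 < P := hK.gauge_pos.2 hv
      have hDpos : 0 < D := lt_of_lt_of_le (mul_pos hPpos hV) h3
      have h5 : P * D = D ^ 2 / volume.real K := le_antisymm hstep2 (heq ▸ hstep)
      rw [eq_div_iff hV.ne'] at h5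
      have h6 : D * (D - P * volume.real K) = 0 := by linarith
      rcases mul_eq_zero.1 h6 with h | h
      · exact absurd h hDpos.ne'
      · linarith
  · rintro (hv | ⟨s, C, hs, hC, hCs, hCd, hcl⟩)
    · have hP : P = 0 := by simp [P, hv]
      have hD' : D = 0 := by
        have h7 : sweep K v 1 ⊆ K := by
          rintro x ⟨a, ha, hx⟩
          simpa [hv] using hx
        have h8 : volume.real (sweep K v 1) ≤ volume.real K :=
          measureReal_mono h7 hK.volume_ne_top
        have h9 := hK.sweepRate_nonneg v
        rw [hD]
        rw [sweepRate] at h9 ⊢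
        linarith
      have hQ0 : Q = 0 := by simp [hQ, hv]
      rw [hQ0, hD']
      simp
    -- For v = 0 the cylinder would reduce to `C`, which then has non-empty interior, against its
    -- dimension n - 1.
    · rcases eq_or_ne v 0 with hv | hv
      · have hsub : closure K ⊆ C := by
          rw [hcl, hv]
          rintro _ ⟨c, hc, z, hz, rfl⟩
          rw [smul_zero, neg_zero, segment_same] at hz
          rw [mem_singleton_iff.1 hz]
          simpa using hc
        have htop : vectorSpan ℝ C = ⊤ := by
          have h7 : (interior C).Nonempty :=
            hK.interior_nonempty.mono (interior_mono (subset_closure.trans hsub))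
          exact (AffineSubspace.vectorSpan_eq_top_of_affineSpan_eq_top _ _ _
            (hC.interior_nonempty_iff_affineSpan_eq_top.1 h7))
        rw [htop, finrank_top, finrank_euclideanSpace_fin] at hCd
        omega
      · obtain ⟨e1, e2⟩ := hK.cylinder_equality hn hs hC hCs hCd hcl
        have e1' : D = P * volume.real K := e1
        have e3 : Q = P * A := by
          rw [hQ, integral_congr_ae e2, integral_const_mul]
        -- On a cylinder P |K| = D, so n A is squeezed between P |K| and D.
        have e4 : n * A = D := le_antisymm h2 (e1'.le.trans h4)
        rw [e3, mul_left_comm, e4, eq_div_iff hV.ne']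
        calc P * D * volume.real K = P * volume.real K * D := by ring
          _ = D ^ 2 := by rw [← e1']; ring

end MixedVolumeInequality

/-! ### Regularity of the gauge for C² boundaries. -/

section Regularity

variable {n : ℕ} {K : Set (EuclideanSpace ℝ (Fin n))}

/-- A `C²` defining function is transversal to the radial direction. -/
theorem IsSymmetricConvex.fderiv_defining_ne_zero (hK : IsSymmetricConvex K)
    {x : EuclideanSpace ℝ (Fin n)} (hx : x ∈ frontier K) {ρ : EuclideanSpace ℝ (Fin n) → ℝ}
    (hρ : ContDiffAt ℝ 2 ρ x) (hρ0 : fderiv ℝ ρ x ≠ 0)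
    (hρz : ∀ᶠ y in 𝓝 x, y ∈ frontier K ↔ ρ y = 0) : fderiv ℝ ρ x x ≠ 0 := by
  -- If dρ annihilated the radial direction, ρ would have opposite signs at x + s(x ± εe) for small
  -- s > 0. It would vanish at some x + s(x + βe) in between: a frontier point strictly beyond the
  -- supporting hyperplane at `x`, once ε is small.
  intro hLx
  obtain ⟨u, hu⟩ := hK.exists_isUnitOuterNormal hx
  have hxu := hK.inner_pos_of_isUnitOuterNormal hu
  obtain ⟨e, he⟩ : ∃ e, 0 < fderiv ℝ ρ x e := by
    obtain ⟨e, he⟩ : ∃ e, fderiv ℝ ρ x e ≠ 0 := by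
      by_contra! h
      exact hρ0 (ContinuousLinearMap.ext h)
    rcases lt_or_gt_of_ne he with h | h
    · exact ⟨-e, by rw [map_neg]; linarith⟩
    · exact ⟨e, h⟩
  have hd : DifferentiableAt ℝ ρ x := hρ.differentiableAt (by norm_num)
  have hx0 : ρ x = 0 := hρz.self_of_nhds.1 hx
  have hcont : ∀ᶠ y in 𝓝 x, ContinuousAt ρ y :=
    (hρ.eventually (by simp)).mono fun y hy => hy.continuousAt
  obtain ⟨η, hη, hball⟩ := Metric.eventually_nhds_iff_ball.1 (hρz.and hcont)
  obtain ⟨ε, hε, hεu⟩ : ∃ ε > 0, ε * |⟪e, u⟫| < ⟪x, u⟫ := by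
    refine ⟨⟪x, u⟫ / (|⟪e, u⟫| + 1), by positivity, ?_⟩
    rw [div_mul_eq_mul_div, div_lt_iff₀ (by positivity)]
    nlinarith
  have hslope : ∀ d, Filter.Tendsto (fun s : ℝ => s⁻¹ • (ρ (x + s • d) - ρ x)) (𝓝[>] 0)
      (𝓝 (fderiv ℝ ρ x d)) := fun d => (hd.hasFDerivAt.hasLineDerivAt d).tendsto_slope_zero_right
  have h1 : ∀ᶠ s : ℝ in 𝓝[>] 0, 0 < ρ (x + s • (x + ε • e)) := by
    have h2 : 0 < fderiv ℝ ρ x (x + ε • e) := by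
      rw [map_add, hLx, map_smul, smul_eq_mul, zero_add]; positivity
    filter_upwards [(hslope _).eventually_const_lt h2, self_mem_nhdsWithin] with s hs hs0
    have hs0 : 0 < s := hs0
    rw [hx0, sub_zero, smul_eq_mul] at hs
    exact (mul_pos_iff_of_pos_left (inv_pos.2 hs0)).1 hs
  have h2 : ∀ᶠ s : ℝ in 𝓝[>] 0, ρ (x + s • (x + (-ε) • e)) < 0 := by
    have h2 : fderiv ℝ ρ x (x + (-ε) • e) < 0 := by
      rw [map_add, hLx, map_smul, smul_eq_mul, zero_add]
      nlinarith
    filter_upwards [(hslope _).eventually_lt_const h2, self_mem_nhdsWithin] with s hs hs0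
    have hs0 : 0 < s := hs0
    rw [hx0, sub_zero, smul_eq_mul] at hs
    by_contra hneg
    have := mul_nonneg (inv_pos.2 hs0).le (not_lt.1 hneg)
    linarith
  have h3 : ∀ᶠ s : ℝ in 𝓝[>] 0, s * (‖x‖ + ε * ‖e‖) < η := by
    have hc : Continuous fun s : ℝ => s * (‖x‖ + ε * ‖e‖) := by fun_prop
    have := (hc.tendsto 0).eventually_lt_const (u := η) (by simpa using hη)
    exact this.filter_mono nhdsWithin_le_nhds
  obtain ⟨s, hs1, hs2, hs3, hs0⟩ := (h1.and (h2.and (h3.and self_mem_nhdsWithin))).exists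
  have hs0 : 0 < s := hs0
  have hin : ∀ β ∈ Icc (-ε) ε, x + s • (x + β • e) ∈ Metric.ball x η := by
    intro β hβ
    rw [Metric.mem_ball, dist_eq_norm, add_sub_cancel_left, norm_smul, Real.norm_of_nonneg hs0.le]
    refine lt_of_le_of_lt ?_ hs3
    gcongr
    refine (norm_add_le _ _).trans ?_
    rw [norm_smul]
    gcongr
    exact abs_le.2 hβ
  have hcontβ : ContinuousOn (fun β : ℝ => ρ (x + s • (x + β • e))) (Icc (-ε) ε) := by
    intro β hβ
    have h4 := (hball _ (hin β hβ)).2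
    have h5 : ContinuousAt (fun β : ℝ => x + s • (x + β • e)) β := by fun_prop
    exact (ContinuousAt.comp (f := fun β : ℝ => x + s • (x + β • e)) h4 h5).continuousWithinAt
  obtain ⟨β, hβ, hβ0⟩ := intermediate_value_Icc (by linarith) hcontβ ⟨hs2.le, hs1.le⟩
  have hfr := (hball _ (hin β hβ)).1.2 hβ0
  have h6 := hK.inner_le_of_isUnitOuterNormal hu (x + s • (x + β • e))
  rw [hK.mem_frontier_iff.1 hfr, mul_one, inner_add_left, inner_smul_left, inner_add_left,
    inner_smul_left] at h6
  simp only [conj_trivial] at h6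
  have h7 : |β * ⟪e, u⟫| ≤ ε * |⟪e, u⟫| := by
    rw [abs_mul]
    gcongr
    exact abs_le.2 hβ
  have h8 := neg_abs_le (β * ⟪e, u⟫)
  have h9 : 0 < s * (⟪x, u⟫ + β * ⟪e, u⟫) := by
    apply mul_pos hs0
    linarith
  linarith

theorem IsSymmetricConvex.continuousAt_radialProj (hK : IsSymmetricConvex K)
    {y : EuclideanSpace ℝ (Fin n)} (hy : y ≠ 0) : ContinuousAt (radialProj K) y :=
  (hK.continuous_gauge.continuousAt.inv₀ (hK.gauge_pos.2 hy).ne').smul continuousAt_id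

/-- As ρ vanishes at x and at π(y), differentiability gives dρ(π(y) - x) = o(π(y) - x), which is o(y
- x) because the gauge is Lipschitz. Inserting π(y) = y / p(y) and solving for p(y) yields its
first-order expansion. -/
theorem IsSymmetricConvex.hasFDerivAt_gauge_of_defining (hK : IsSymmetricConvex K)
    {x : EuclideanSpace ℝ (Fin n)} (hx : x ∈ frontier K) {ρ : EuclideanSpace ℝ (Fin n) → ℝ}
    (hd : DifferentiableAt ℝ ρ x) (hρx : fderiv ℝ ρ x x ≠ 0)
    (hρz : ∀ᶠ y in 𝓝 x, y ∈ frontier K ↔ ρ y = 0) :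
    HasFDerivAt (gauge K) ((fderiv ℝ ρ x x)⁻¹ • fderiv ℝ ρ x) x := by
  have hx0 := hK.ne_zero_of_mem_frontier hx
  have hpx := hK.mem_frontier_iff.1 hx
  set L := fderiv ℝ ρ x with hL
  obtain ⟨C, hC⟩ := hK.convex.lipschitz_gauge hK.mem_nhds_zero
  have hπ : Filter.Tendsto (radialProj K) (𝓝 x) (𝓝 x) := by
    have := (hK.continuousAt_radialProj hx0).tendsto
    rwa [hK.radialProj_of_mem_frontier hx] at this
  have h1 : (fun y => L (radialProj K y - x)) =o[𝓝 x] fun y => radialProj K y - x := by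
    have h2 := hd.hasFDerivAt.isLittleO.comp_tendsto hπ
    have h3 : (fun y => -(L (radialProj K y - x))) =o[𝓝 x] fun y => radialProj K y - x := by
      refine h2.congr' ?_ Filter.EventuallyEq.rfl
      filter_upwards [hπ.eventually hρz, eventually_ne_nhds hx0] with y hy hy0
      have h4 := hy.1 (hK.radialProj_mem_frontier hy0)
      have h5 := hρz.self_of_nhds.1 hx
      simp only [Function.comp_apply, h4, h5]
      ring
    simpa using h3.neg_left
  have hnear : ∀ᶠ y in 𝓝 x, (1 / 2 : ℝ) < gauge K y :=
    (hK.continuous_gauge.tendsto x).eventually_const_lt (by rw [hpx]; norm_num)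
  have hnear2 : ∀ᶠ y in 𝓝 x, gauge K y < 2 :=
    (hK.continuous_gauge.tendsto x).eventually_lt_const (by rw [hpx]; norm_num)
  have h2 : (fun y => radialProj K y - x) =O[𝓝 x] fun y => y - x := by
    refine Asymptotics.IsBigO.of_bound (2 * (1 + C * ‖x‖)) ?_
    filter_upwards [hnear] with y hy
    have hp : 0 < gauge K y := by linarith
    have h3 : radialProj K y - x = (gauge K y)⁻¹ • ((y - x) - (gauge K y - gauge K x) • x) := by
      rw [radialProj, hpx]
      match_scalars <;> field_simp
      ring
    rw [h3, norm_smul, norm_inv, Real.norm_of_nonneg hp.le, mul_assoc]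
    have h4 : (gauge K y)⁻¹ ≤ 2 := by
      rw [inv_le_comm₀ hp (by norm_num)]
      linarith
    gcongr
    refine (norm_sub_le _ _).trans ?_
    rw [norm_smul]
    have h5 := hC.dist_le_mul y x
    rw [dist_eq_norm, dist_eq_norm] at h5
    calc _ ≤ ‖y - x‖ + (C * ‖y - x‖) * ‖x‖ := by gcongr
      _ = _ := by ring
  have h3 := h1.trans_isBigO h2
  have h4 : (fun y => -(gauge K y * (L x)⁻¹) * L (radialProj K y - x)) =o[𝓝 x]
      fun y => y - x := by
    have hb : (fun y => -(gauge K y * (L x)⁻¹)) =O[𝓝 x] fun _ => (1 : ℝ) := by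
      refine Asymptotics.IsBigO.of_bound (2 * |(L x)⁻¹|) ?_
      filter_upwards [hnear2] with y hy
      rw [norm_neg, norm_mul, Real.norm_of_nonneg (gauge_nonneg _), norm_one, mul_one,
        Real.norm_eq_abs]
      gcongr
    simpa using (hb.mul_isLittleO h3.norm_right).norm_right
  refine HasFDerivAt.of_isLittleO (h4.congr' ?_ Filter.EventuallyEq.rfl)
  filter_upwards [hnear] with y hy
  have hp : gauge K y ≠ 0 := by linarith
  simp only [radialProj, map_sub, map_smul, smul_eq_mul, hpx,
    FunLike.coe_smul, Pi.smul_apply]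
  field_simp
  ring

/-- The gauge of a convex set with `C²` boundary is `C²` away from the origin. -/
theorem IsSymmetricConvex.contDiffAt_gauge (hK : IsSymmetricConvex K) (hC2 : HasC2Boundary K)
    {y : EuclideanSpace ℝ (Fin n)} (hy : y ≠ 0) : ContDiffAt ℝ 2 (gauge K) y := by
  have hfr : ∀ x ∈ frontier K, ContDiffAt ℝ 2 (gauge K) x := by
    intro x hx
    have hx0 := hK.ne_zero_of_mem_frontier hx
    obtain ⟨ρ, hρ, hρ0, hρz⟩ := hC2 x hx
    have hρx := hK.fderiv_defining_ne_zero hx hρ hρ0 hρz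
    have hDρ : ContDiffAt ℝ 1 (fderiv ℝ ρ) x := hρ.fderiv_right (by norm_num)
    set ℓ : EuclideanSpace ℝ (Fin n) → EuclideanSpace ℝ (Fin n) →L[ℝ] ℝ :=
      fun z => (fderiv ℝ ρ z z)⁻¹ • fderiv ℝ ρ z with hℓ
    have hℓ1 : ContDiffAt ℝ 1 ℓ x :=
      ((hDρ.clm_apply contDiffAt_id).inv hρx).smul hDρ
    have hπ : Filter.Tendsto (radialProj K) (𝓝 x) (𝓝 x) := by
      have := (hK.continuousAt_radialProj hx0).tendsto
      rwa [hK.radialProj_of_mem_frontier hx] at this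
    have hgood : ∀ᶠ z in 𝓝 x, DifferentiableAt ℝ ρ z ∧ fderiv ℝ ρ z z ≠ 0 ∧
        ∀ᶠ w in 𝓝 z, w ∈ frontier K ↔ ρ w = 0 := by
      have h1 := (hρ.eventually (by simp)).mono fun z hz => hz.differentiableAt (by norm_num)
      have h2 := (hDρ.clm_apply contDiffAt_id).continuousAt.eventually_ne hρx
      exact h1.and (h2.and (eventually_eventually_nhds.2 hρz))
    have hder : ∀ᶠ y in 𝓝 x, HasFDerivAt (gauge K) (ℓ (radialProj K y)) y := by
      filter_upwards [hπ.eventually hgood, eventually_ne_nhds hx0] with y hy hy0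
      have h1 := hK.hasFDerivAt_gauge_of_defining (hK.radialProj_mem_frontier hy0) hy.1 hy.2.1
        hy.2.2
      have h2 := hasFDerivAt_gauge_smul (hK.gauge_pos.2 hy0) h1
      rwa [hK.gauge_smul_radialProj] at h2
    -- Bootstrap: near x the derivative of p at y is ℓ(π(y)) with ℓ of class C¹. If p is C^m with m
    -- ≤ 1, so is π, hence so is the derivative, and p is C^(m+1). Two rounds lead from continuity
    -- to C².
    have hstep : ∀ m : ℕ, m ≤ 1 → ContDiffAt ℝ m (gauge K) x →
        ContDiffAt ℝ (m + 1) (gauge K) x := by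
      intro m hm hp
      rw [contDiffAt_succ_iff_hasFDerivAt]
      refine ⟨_, hder.exists_mem, ?_⟩
      have h1 : ContDiffAt ℝ m (radialProj K) x :=
        (hp.inv (hK.gauge_pos.2 hx0).ne').smul contDiffAt_id
      refine ContDiffAt.comp x (g := ℓ) ?_ h1
      rw [hK.radialProj_of_mem_frontier hx]
      exact hℓ1.of_le (by exact_mod_cast hm)
    have h0 : ContDiffAt ℝ 0 (gauge K) x := (contDiff_zero.2 hK.continuous_gauge).contDiffAt
    have h1 : ContDiffAt ℝ 1 (gauge K) x := by simpa using hstep 0 (by simp) (by simpa using h0)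
    have h2 := hstep 1 le_rfl (by simpa using h1)
    rwa [Nat.cast_one, one_add_one_eq_two] at h2
  have hp := hK.gauge_pos.2 hy
  have h1 : gauge K = fun z => gauge K y * gauge K ((gauge K y)⁻¹ • z) := by
    funext z
    rw [gauge_smul_nonneg (by positivity), mul_inv_cancel_left₀ hp.ne']
  rw [h1]
  refine contDiffAt_const.mul ?_
  refine ContDiffAt.comp y (g := gauge K) (f := fun z => (gauge K y)⁻¹ • z) ?_ (by fun_prop)
  exact hfr _ (hK.radialProj_mem_frontier hy)

end Regularity

/-! ### Second fundamental form and mean curvature via the Hessian of the gauge. -/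

section Curvature

variable {n : ℕ} {K : Set (EuclideanSpace ℝ (Fin n))}

/-- The Hessian of the gauge, as an operator. -/
noncomputable def gaugeHessian (K : Set (EuclideanSpace ℝ (Fin n)))
    (y : EuclideanSpace ℝ (Fin n)) : EuclideanSpace ℝ (Fin n) →L[ℝ] EuclideanSpace ℝ (Fin n) :=
  fderiv ℝ (gaugeGradient K) y

theorem IsSymmetricConvex.differentiableAt_gauge (hK : IsSymmetricConvex K)
    (hC2 : HasC2Boundary K) {y : EuclideanSpace ℝ (Fin n)} (hy : y ≠ 0) :
    DifferentiableAt ℝ (gauge K) y :=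
  (hK.contDiffAt_gauge hC2 hy).differentiableAt (by norm_num)

theorem IsSymmetricConvex.contDiffAt_gaugeGradient (hK : IsSymmetricConvex K)
    (hC2 : HasC2Boundary K) {y : EuclideanSpace ℝ (Fin n)} (hy : y ≠ 0) :
    ContDiffAt ℝ 1 (gaugeGradient K) y := by
  have h : ContDiffAt ℝ 1 (fderiv ℝ (gauge K)) y :=
    (hK.contDiffAt_gauge hC2 hy).fderiv_right (by norm_num)
  exact (InnerProductSpace.toDual ℝ (EuclideanSpace ℝ (Fin n))).symm.contDiff.contDiffAt.comp y h

theorem IsSymmetricConvex.hasFDerivAt_gaugeGradient (hK : IsSymmetricConvex K)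
    (hC2 : HasC2Boundary K) {y : EuclideanSpace ℝ (Fin n)} (hy : y ≠ 0) :
    HasFDerivAt (gaugeGradient K) (gaugeHessian K y) y :=
  ((hK.contDiffAt_gaugeGradient hC2 hy).differentiableAt (by norm_num)).hasFDerivAt

theorem IsSymmetricConvex.inner_gaugeHessian_comm (hK : IsSymmetricConvex K)
    (hC2 : HasC2Boundary K) {y : EuclideanSpace ℝ (Fin n)} (hy : y ≠ 0)
    (u w : EuclideanSpace ℝ (Fin n)) : ⟪gaugeHessian K y u, w⟫ = ⟪u, gaugeHessian K y w⟫ := by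
  have hsymm := (hK.contDiffAt_gauge hC2 hy).isSymmSndFDerivAt (by simp)
  have hB : ∀ a b, ⟪gaugeHessian K y a, b⟫ = fderiv ℝ (fderiv ℝ (gauge K)) y a b := by
    intro a b
    have h1 : fderiv ℝ (gauge K) = fun z =>
        InnerProductSpace.toDual ℝ (EuclideanSpace ℝ (Fin n)) (gaugeGradient K z) := by
      funext z
      simp [gaugeGradient, gradient]
    have h2 := ((InnerProductSpace.toDual ℝ
      (EuclideanSpace ℝ (Fin n))).toContinuousLinearEquiv.hasFDerivAt
      (x := gaugeGradient K y)).comp y (hK.hasFDerivAt_gaugeGradient hC2 hy)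
    have h3 := h2.congr_of_eventuallyEq (Filter.Eventually.of_forall (congrFun h1))
    rw [h3.fderiv]
    simp
  rw [hB, hsymm.eq, ← hB, real_inner_comm]

/-- Euler's relation: the gradient is constant along rays. -/
theorem IsSymmetricConvex.gaugeHessian_self (hK : IsSymmetricConvex K)
    (hC2 : HasC2Boundary K) {y : EuclideanSpace ℝ (Fin n)} (hy : y ≠ 0) :
    gaugeHessian K y y = 0 := by
  have h1 : HasDerivAt (fun s : ℝ => s • y) y 1 := by
    simpa using (hasDerivAt_id (1 : ℝ)).smul_const y
  have h2 := (hK.hasFDerivAt_gaugeGradient hC2 hy).comp_hasDerivAt_of_eq 1 h1 (by simp)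
  have h3 : HasDerivAt (gaugeGradient K ∘ fun s : ℝ => s • y) 0 1 := by
    refine (hasDerivAt_const (1 : ℝ) (gaugeGradient K y)).congr_of_eventuallyEq ?_
    filter_upwards [lt_mem_nhds (zero_lt_one (α := ℝ))] with s hs
    exact gaugeGradient_smul hs y
  exact h2.unique h3

/-- Derivatives along the boundary coincide with those of an extension. -/
theorem IsSymmetricConvex.fderivWithin_frontier_apply (hK : IsSymmetricConvex K)
    {F : Type*} [NormedAddCommGroup F] [NormedSpace ℝ F]
    {g G : EuclideanSpace ℝ (Fin n) → F} {G' : EuclideanSpace ℝ (Fin n) →L[ℝ] F}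
    {x τ : EuclideanSpace ℝ (Fin n)} (hx : x ∈ frontier K) (hd : DifferentiableAt ℝ (gauge K) x)
    (hg : ∀ z ∈ frontier K, g z = G z) (hG : HasFDerivAt G G' x)
    (hτ : ⟪gaugeGradient K x, τ⟫ = 0) : fderivWithin ℝ g (frontier K) x τ = G' τ := by
  have hx0 := hK.ne_zero_of_mem_frontier hx
  have hpx := hK.mem_frontier_iff.1 hx
  have hg1 : HasFDerivWithinAt g G' (frontier K) x :=
    hG.hasFDerivWithinAt.congr hg (hg x hx)
  have hg2 := hg1.differentiableWithinAt.hasFDerivWithinAt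
  have hline : HasDerivAt (fun s : ℝ => x + s • τ) τ 0 := by
    simpa using ((hasDerivAt_id (0 : ℝ)).smul_const τ).const_add x
  have hgauge : HasDerivAt (fun s : ℝ => gauge K (x + s • τ)) 0 0 := by
    have := (hasGradientAt_gauge hd).hasFDerivAt.comp_hasDerivAt_of_eq 0 hline (by simp)
    simpa only [Function.comp_def, InnerProductSpace.toDual_apply_apply, hτ] using this
  -- A derivative within the frontier is determined only in tangent directions. It is tested on the
  -- curve s ↦ π(x + sτ), which stays in the frontier and has velocity τ because the gauge has
  -- derivative 0 along τ.
  have hcurve : HasDerivAt (fun s : ℝ => radialProj K (x + s • τ)) τ 0 := by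
    have h1 := (hgauge.fun_inv (by simp [hpx])).fun_smul hline
    simpa only [radialProj, zero_smul, add_zero, hpx, inv_one, one_smul, neg_zero, zero_div]
      using h1
  have hc0 : x = radialProj K (x + (0 : ℝ) • τ) := by
    rw [zero_smul, add_zero, hK.radialProj_of_mem_frontier hx]
  have hmem : ∀ᶠ s : ℝ in 𝓝 0, radialProj K (x + s • τ) ∈ frontier K := by
    have h1 : ContinuousAt (fun s : ℝ => x + s • τ) 0 := by fun_prop
    filter_upwards [h1.eventually_ne (y := 0) (by simpa using hx0)] with s hs
    exact hK.radialProj_mem_frontier hs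
  exact (hg2.comp_hasDerivAt_of_eq 0 hcurve hmem hc0).unique
    (hg1.comp_hasDerivAt_of_eq 0 hcurve hmem hc0)

theorem hasFDerivAt_norm_inv {E F : Type*} [NormedAddCommGroup E] [NormedSpace ℝ E]
    [NormedAddCommGroup F] [InnerProductSpace ℝ F] {q : E → F} {B : E →L[ℝ] F} {x : E}
    (hq : HasFDerivAt q B x) (h0 : q x ≠ 0) :
    HasFDerivAt (fun z => ‖q z‖⁻¹) (-(‖q x‖ ^ 3)⁻¹ • (innerSL ℝ (q x)).comp B) x := by
  have hn := norm_ne_zero_iff.2 h0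
  have h1 := hq.norm_sq.sqrt (by positivity)
  simp only [Real.sqrt_sq (norm_nonneg _)] at h1
  refine ((hasDerivAt_inv hn).comp_hasFDerivAt x h1).congr_fderiv ?_
  ext τ
  simp
  field_simp

theorem IsSymmetricConvex.mem_boundaryTangent (hK : IsSymmetricConvex K)
    {x τ : EuclideanSpace ℝ (Fin n)} (hx : x ∈ frontier K)
    (hd : DifferentiableAt ℝ (gauge K) x) :
    τ ∈ boundaryTangent K x ↔ ⟪gaugeGradient K x, τ⟫ = 0 := by
  have hq := norm_ne_zero_iff.2 (hK.gaugeGradient_ne_zero hd (hK.ne_zero_of_mem_frontier hx))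
  rw [boundaryTangent, Submodule.mem_orthogonal_singleton_iff_inner_right, hK.outerNormal_eq hx hd,
    inner_smul_left]
  simp [hq]

/-- Differentiating q / ‖q‖, the derivative of the factor 1/‖q‖ contributes a multiple of q, which
the tangential projection kills. -/
theorem IsSymmetricConvex.secondFundamentalForm_eq (hK : IsSymmetricConvex K)
    (hC2 : HasC2Boundary K) {x : EuclideanSpace ℝ (Fin n)} (hx : x ∈ frontier K) :
    secondFundamentalForm K x = ((boundaryTangent K x).orthogonalProjectionOnto.comp
      (‖gaugeGradient K x‖⁻¹ • gaugeHessian K x)).comp (boundaryTangent K x).subtypeL := by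
  have hx0 := hK.ne_zero_of_mem_frontier hx
  have hd := hK.differentiableAt_gauge hC2 hx0
  have hq0 := hK.gaugeGradient_ne_zero hd hx0
  have hq := hK.hasFDerivAt_gaugeGradient hC2 hx0
  ext1 τ
  have hτ := (hK.mem_boundaryTangent hx hd).1 τ.2
  have h1 : fderivWithin ℝ (outerNormal K) (frontier K) x τ = _ :=
    hK.fderivWithin_frontier_apply hx hd
      (G := fun z => ‖gaugeGradient K z‖⁻¹ • gaugeGradient K z)
      (fun z hz => hK.outerNormal_eq hz
        (hK.differentiableAt_gauge hC2 (hK.ne_zero_of_mem_frontier hz)))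
      ((hasFDerivAt_norm_inv hq hq0).smul hq) hτ
  have h2 : (boundaryTangent K x).orthogonalProjectionOnto (gaugeGradient K x) = 0 := by
    refine Submodule.orthogonalProjectionOnto_apply_of_mem_orthogonal ?_
    intro w hw
    rw [real_inner_comm]
    exact (hK.mem_boundaryTangent hx hd).1 hw
  simp only [secondFundamentalForm, ContinuousLinearMap.comp_apply, Submodule.subtypeL_apply, h1]
  simp [h2]

theorem IsSymmetricConvex.inner_secondFundamentalForm (hK : IsSymmetricConvex K)
    (hC2 : HasC2Boundary K) {x : EuclideanSpace ℝ (Fin n)} (hx : x ∈ frontier K)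
    (σ τ : boundaryTangent K x) : ⟪secondFundamentalForm K x σ, τ⟫ =
      ‖gaugeGradient K x‖⁻¹ * ⟪gaugeHessian K x σ, τ⟫ := by
  rw [hK.secondFundamentalForm_eq hC2 hx]
  simp [inner_smul_left]

/-- Cyclicity of the trace turns the trace on the tangent space into that of the Hessian composed
with I - N ⊗ N on the whole space, N being the unit normal. -/
theorem IsSymmetricConvex.meanCurvature_eq (hK : IsSymmetricConvex K)
    (hC2 : HasC2Boundary K) {x : EuclideanSpace ℝ (Fin n)} (hx : x ∈ frontier K) :
    meanCurvature K x = ‖gaugeGradient K x‖⁻¹ *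
      (LinearMap.trace ℝ _ (gaugeHessian K x).toLinearMap -
        ⟪gaugeGradient K x, gaugeHessian K x (gaugeGradient K x)⟫ / ‖gaugeGradient K x‖ ^ 2) := by
  have hx0 := hK.ne_zero_of_mem_frontier hx
  have hd := hK.differentiableAt_gauge hC2 hx0
  have hq0 := norm_ne_zero_iff.2 (hK.gaugeGradient_ne_zero hd hx0)
  have hN : ‖outerNormal K x‖ = 1 := by
    rw [hK.outerNormal_eq hx hd, norm_smul, norm_inv, norm_norm, inv_mul_cancel₀ hq0]
  rw [meanCurvature, hK.secondFundamentalForm_eq hC2 hx, ContinuousLinearMap.comp_assoc,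
    ContinuousLinearMap.toLinearMap_comp, LinearMap.trace_comp_comm']
  have h1 : ((‖gaugeGradient K x‖⁻¹ • gaugeHessian K x).comp
      (boundaryTangent K x).subtypeL).toLinearMap ∘ₗ
      (boundaryTangent K x).orthogonalProjectionOnto.toLinearMap =
      ‖gaugeGradient K x‖⁻¹ • ((gaugeHessian K x).toLinearMap -
        (innerSL ℝ (outerNormal K x)).toLinearMap.smulRight
          (gaugeHessian K x (outerNormal K x))) := by
    refine LinearMap.ext fun z => ?_
    have h2 : ((boundaryTangent K x).orthogonalProjectionOnto z : EuclideanSpace ℝ (Fin n)) =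
        z - ⟪outerNormal K x, z⟫ • outerNormal K x := by
      rw [← Submodule.starProjection_unit_singleton ℝ hN z]
      exact Submodule.starProjection_orthogonal_val z
    simp [h2]
  rw [h1, map_smul, map_sub, LinearMap.trace_smulRight, smul_eq_mul]
  congr 2
  rw [hK.outerNormal_eq hx hd]
  simp
  field_simp

end Curvature

/-! ### Locally Lipschitz maps and the divergence theorem. -/

section LipschitzFields

/-- `f` is Lipschitz on a neighbourhood of `x`. -/
def LipschitzNear {α β : Type*} [PseudoEMetricSpace α] [PseudoEMetricSpace β]
    (f : α → β) (x : α) : Prop :=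
  ∃ C, ∃ t ∈ 𝓝 x, LipschitzOnWith C f t

section

variable {α β γ : Type*} [PseudoEMetricSpace α] [PseudoEMetricSpace β] [PseudoEMetricSpace γ]

theorem LipschitzNear.prodMk {f : α → β} {g : α → γ} {x : α} (hf : LipschitzNear f x)
    (hg : LipschitzNear g x) : LipschitzNear (fun y => (f y, g y)) x := by
  obtain ⟨C, s, hs, hf⟩ := hf
  obtain ⟨D, t, ht, hg⟩ := hg
  exact ⟨_, s ∩ t, Filter.inter_mem hs ht,
    (hf.mono inter_subset_left).prodMk (hg.mono inter_subset_right)⟩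

theorem LipschitzNear.comp {f : α → β} {g : β → γ} {x : α} (hg : LipschitzNear g (f x))
    (hf : LipschitzNear f x) : LipschitzNear (fun y => g (f y)) x := by
  obtain ⟨C, s, hs, hf⟩ := hf
  obtain ⟨D, t, ht, hg⟩ := hg
  have hc : ContinuousAt f x := hf.continuousOn.continuousAt hs
  exact ⟨_, s ∩ f ⁻¹' t, Filter.inter_mem hs (hc ht),
    hg.comp (hf.mono inter_subset_left) fun y hy => hy.2⟩

theorem LipschitzNear.congr {f g : α → β} {x : α} (hf : LipschitzNear f x) (h : g =ᶠ[𝓝 x] f) :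
    LipschitzNear g x := by
  obtain ⟨C, s, hs, hf⟩ := hf
  refine ⟨C, s ∩ {y | g y = f y}, Filter.inter_mem hs h, fun y hy z hz => ?_⟩
  rw [hy.2, hz.2]
  exact hf hy.1 hz.1

end

/-- Rademacher's theorem for locally Lipschitz functions. -/
theorem ae_differentiableAt_of_lipschitzNear {E F : Type*} [NormedAddCommGroup E]
    [NormedSpace ℝ E] [NormedAddCommGroup F] [NormedSpace ℝ F] [FiniteDimensional ℝ E] [FiniteDimensional ℝ F]
    [MeasurableSpace E] [BorelSpace E] {μ : Measure E} [μ.IsAddHaarMeasure] {f : E → F} {U : Set E}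
    (hf : ∀ x ∈ U, LipschitzNear f x) : ∀ᵐ x ∂μ, x ∈ U → DifferentiableAt ℝ f x := by
  have h : μ {x | x ∈ U ∧ ¬DifferentiableAt ℝ f x} = 0 := by
    refine measure_null_of_locally_null _ fun x hx => ?_
    obtain ⟨C, t, ht, hL⟩ := hf x hx.1
    refine ⟨_, mem_nhdsWithin_of_mem_nhds (interior_mem_nhds.2 ht) |> fun h =>
      Filter.inter_mem h self_mem_nhdsWithin, ?_⟩
    refine measure_mono_null ?_ (ae_iff.1 ((hL.mono interior_subset).ae_differentiableWithinAt_of_mem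
      (μ := μ)))
    rintro y ⟨hy1, hy2⟩ h
    exact hy2.2 ((h hy1).differentiableAt (isOpen_interior.mem_nhds hy1))
  rw [ae_iff]
  simpa using h

/-- A locally Lipschitz function with compact support is Lipschitz. -/
theorem exists_lipschitzWith_of_hasCompactSupport {E F : Type*} [NormedAddCommGroup E]
    [NormedSpace ℝ E] [NormedAddCommGroup F] [FiniteDimensional ℝ E] {f : E → F}
    (hf : ∀ x, LipschitzNear f x) (hs : HasCompactSupport f) : ∃ C, LipschitzWith C f := by
  obtain ⟨R, hR⟩ := hs.isBounded.subset_closedBall 0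
  have hzero : ∀ y, R < ‖y‖ → f y = 0 := by
    intro y hy
    by_contra h
    have := hR (subset_tsupport f h)
    rw [mem_closedBall_zero_iff] at this
    linarith
  have hloc : LocallyLipschitzOn (Metric.closedBall 0 (R + 1)) f := by
    intro x _
    obtain ⟨C, t, ht, hL⟩ := hf x
    exact ⟨C, t, mem_nhdsWithin_of_mem_nhds ht, hL⟩
  obtain ⟨C, hC⟩ := hloc.exists_lipschitzOnWith_of_compact (isCompact_closedBall _ _)
  have hcont : Continuous f := continuous_iff_continuousAt.2 fun x => by
    obtain ⟨C, t, ht, hL⟩ := hf x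
    exact hL.continuousOn.continuousAt ht
  obtain ⟨D, hD⟩ := hs.exists_bound_of_continuous hcont
  have hD0 : 0 ≤ D := (norm_nonneg _).trans (hD 0)
  -- Two nearby points lie in a common ball, where compactness gives a Lipschitz constant. Otherwise
  -- their distance is at least 1 and the bound `D` on the values suffices.
  have key : ∀ x y, ‖x‖ ≤ R → dist (f x) (f y) ≤ max (C : ℝ) D * dist x y := by
    intro x y hx
    by_cases hy : ‖y‖ ≤ R + 1
    · refine (hC.dist_le_mul x (by simpa using hx.trans (by linarith)) y (by simpa using hy)).trans ?_
      gcongr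
      exact le_max_left _ _
    · push Not at hy
      rw [hzero y (by linarith), dist_zero_right]
      have h1 : 1 ≤ dist x y := by
        have := norm_sub_norm_le y x
        rw [dist_comm, dist_eq_norm]
        linarith
      calc ‖f x‖ ≤ D * 1 := by rw [mul_one]; exact hD x
        _ ≤ max (C : ℝ) D * dist x y := by gcongr; exact le_max_right _ _
  refine ⟨(.mk (max (C : ℝ) D) (le_max_of_le_right hD0)), LipschitzWith.of_dist_le_mul fun x y => ?_⟩
  change _ ≤ max (C : ℝ) D * dist x y
  by_cases hx : ‖x‖ ≤ R
  · exact key x y hx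
  · by_cases hy : ‖y‖ ≤ R
    · rw [dist_comm, dist_comm x]
      exact key y x hy
    · rw [hzero x (not_le.1 hx), hzero y (not_le.1 hy), dist_self]
      positivity

/-- The divergence of a compactly supported Lipschitz vector field has integral zero. -/
theorem integral_trace_fderiv_eq_zero {n : ℕ}
    {Ψ : EuclideanSpace ℝ (Fin n) → EuclideanSpace ℝ (Fin n)} {C : NNReal}
    (hΨ : LipschitzWith C Ψ) (hs : HasCompactSupport Ψ) :
    ∫ y, LinearMap.trace ℝ _ (fderiv ℝ Ψ y).toLinearMap = 0 := by
  set b := EuclideanSpace.basisFun (Fin n) ℝ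
  have hg : ∀ i, LipschitzWith _ fun y => ⟪b i, Ψ y⟫ := fun i =>
    (innerSL ℝ (b i)).lipschitz.comp hΨ
  have hgs : ∀ i, HasCompactSupport fun y => ⟪b i, Ψ y⟫ := fun i =>
    hs.comp_left (g := fun z => ⟪b i, z⟫) (inner_zero_right _)
  have hint : ∀ i, ∫ y, lineDeriv ℝ (fun y => ⟪b i, Ψ y⟫) y (b i) = 0 := by
    intro i
    -- Integration by parts against the constant function 1.
    have h := (LipschitzWith.const (α := EuclideanSpace ℝ (Fin n)) (1 : ℝ)).integral_lineDeriv_mul_eq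
      (μ := volume) (hg i) (hgs i) (-(b i))
    simpa [lineDeriv] using h.symm
  have hli : ∀ i, Integrable fun y => lineDeriv ℝ (fun y => ⟪b i, Ψ y⟫) y (b i) := by
    intro i
    have h0 : ∀ y, y ∉ tsupport (fun y => ⟪b i, Ψ y⟫) →
        lineDeriv ℝ (fun y => ⟪b i, Ψ y⟫) y (b i) = 0 := by
      intro y hy
      have h1 := (hasFDerivAt_const (𝕜 := ℝ) (0 : ℝ) y).congr_of_eventuallyEq
        (notMem_tsupport_iff_eventuallyEq.1 hy)
      simpa using (h1.hasLineDerivAt (b i)).lineDeriv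
    refine (integrableOn_iff_integrable_of_support_subset (s := tsupport _)
      (fun y hy => by_contra fun h => hy (h0 y h))).1 ?_
    exact (hg i).locallyIntegrable_lineDeriv (μ := volume) (b i) |>.integrableOn_isCompact (hgs i)
  have hsum : ∀ᵐ y, LinearMap.trace ℝ _ (fderiv ℝ Ψ y).toLinearMap =
      ∑ i, lineDeriv ℝ (fun y => ⟪b i, Ψ y⟫) y (b i) := by
    filter_upwards [hΨ.ae_differentiableAt (μ := volume)] with y hy
    rw [LinearMap.trace_eq_sum_inner _ b]
    refine Finset.sum_congr rfl fun i _ => ?_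
    have h1 : HasFDerivAt (fun y => ⟪b i, Ψ y⟫) ((innerSL ℝ (b i)).comp (fderiv ℝ Ψ y)) y :=
      (innerSL ℝ (b i)).hasFDerivAt.comp y hy.hasFDerivAt
    exact (h1.hasLineDerivAt (b i)).lineDeriv.symm
  rw [integral_congr_ae hsum, integral_finsetSum _ fun i _ => hli i]
  exact Finset.sum_eq_zero fun i _ => hint i

end LipschitzFields

/-! ### Divergence of homogeneous tangential fields. -/

section Divergence

variable {n : ℕ} {K : Set (EuclideanSpace ℝ (Fin n))}

/-- The divergence of a vector field on `ℝⁿ`. -/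
noncomputable def divergence (W : EuclideanSpace ℝ (Fin n) → EuclideanSpace ℝ (Fin n))
    (y : EuclideanSpace ℝ (Fin n)) : ℝ :=
  LinearMap.trace ℝ _ (fderiv ℝ W y).toLinearMap

theorem measurable_divergence (W : EuclideanSpace ℝ (Fin n) → EuclideanSpace ℝ (Fin n)) :
    Measurable (divergence W) := by
  have h : divergence W = fun y => ∑ i, ⟪EuclideanSpace.basisFun (Fin n) ℝ i,
      fderiv ℝ W y (EuclideanSpace.basisFun (Fin n) ℝ i)⟫ := by
    funext y
    exact LinearMap.trace_eq_sum_inner _ (EuclideanSpace.basisFun (Fin n) ℝ)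
  rw [h]
  have := fun i => measurable_fderiv_apply_const ℝ W (EuclideanSpace.basisFun (Fin n) ℝ i)
  fun_prop

/-- The divergence of a field of degree 0 has degree -1; the factor `gauge K` restores degree 0, as
polar integration requires. -/
theorem gauge_mul_divergence_smul {W : EuclideanSpace ℝ (Fin n) → EuclideanSpace ℝ (Fin n)}
    (hW : ∀ s : ℝ, 0 < s → ∀ y, W (s • y) = W y) {s : ℝ} (hs : 0 < s)
    (y : EuclideanSpace ℝ (Fin n)) :
    gauge K (s • y) * divergence W (s • y) = gauge K y * divergence W y := by
  have h1 : fderiv ℝ W y = s • fderiv ℝ W (s • y) := by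
    rw [← fderiv_comp_smul]
    congr 1
    funext z
    exact (hW s hs z).symm
  rw [gauge_smul_nonneg hs.le, divergence, divergence, h1, ContinuousLinearMap.toLinearMap_smul,
    map_smul, smul_eq_mul]
  ring

theorem LipschitzNear.bddAbove_divergence
    {W : EuclideanSpace ℝ (Fin n) → EuclideanSpace ℝ (Fin n)} {x : EuclideanSpace ℝ (Fin n)}
    (hW : LipschitzNear W x) : ∃ C, ∀ᶠ y in 𝓝 x, |divergence W y| ≤ C := by
  obtain ⟨C, t, ht, hL⟩ := hW
  refine ⟨∑ _i : Fin n, (C : ℝ), ?_⟩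
  filter_upwards [eventually_mem_nhds_iff.2 ht] with y hy
  rw [divergence, LinearMap.trace_eq_sum_inner _ (EuclideanSpace.basisFun (Fin n) ℝ)]
  refine (Finset.abs_sum_le_sum_abs _ _).trans (Finset.sum_le_sum fun i _ => ?_)
  have h1 := norm_fderiv_le_of_lipschitzOn ℝ hy hL
  refine (abs_real_inner_le_norm _ _).trans ?_
  have h2 := (fderiv ℝ W y).le_of_opNorm_le h1 (EuclideanSpace.basisFun (Fin n) ℝ i)
  simpa using h2

theorem IsSymmetricConvex.exists_bound_divergence (hK : IsSymmetricConvex K)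
    {W : EuclideanSpace ℝ (Fin n) → EuclideanSpace ℝ (Fin n)}
    (hWL : ∀ y ≠ 0, LipschitzNear W y) (hW : ∀ s : ℝ, 0 < s → ∀ y, W (s • y) = W y) :
    ∃ C, ∀ y, |gauge K y * divergence W y| ≤ C := by
  have hcomp : IsCompact (frontier K) :=
    Metric.isCompact_of_isClosed_isBounded isClosed_frontier
      (hK.bounded.closure.subset frontier_subset_closure)
  obtain ⟨C, hC⟩ : ∃ C, ∀ x ∈ frontier K, |divergence W x| ≤ C := by
    refine hcomp.induction_on (p := fun s => ∃ C, ∀ x ∈ s, |divergence W x| ≤ C) ⟨0, by simp⟩ ?_ ?_ ?_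
    · rintro s t hst ⟨C, hC⟩
      exact ⟨C, fun x hx => hC x (hst hx)⟩
    · rintro s t ⟨C, hC⟩ ⟨D, hD⟩
      refine ⟨max C D, ?_⟩
      rintro x (hx | hx)
      · exact (hC x hx).trans (le_max_left _ _)
      · exact (hD x hx).trans (le_max_right _ _)
    · intro x hx
      obtain ⟨C, hC⟩ := (hWL x (hK.ne_zero_of_mem_frontier hx)).bddAbove_divergence
      exact ⟨_, mem_nhdsWithin_of_mem_nhds hC, C, fun y hy => hy⟩
  refine ⟨max C 0, fun y => ?_⟩
  rcases eq_or_ne y 0 with rfl | hy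
  · simp
  · have hp := hK.gauge_pos.2 hy
    have h1 := gauge_mul_divergence_smul (K := K) hW (inv_pos.2 hp) y
    rw [← h1, ← radialProj, hK.gauge_radialProj hy, one_mul]
    exact (hC _ (hK.radialProj_mem_frontier hy)).trans (le_max_left _ _)

/-- The divergence theorem for homogeneous vector fields tangent to the level sets of the gauge. -/
theorem IsSymmetricConvex.integral_gauge_mul_divergence (hK : IsSymmetricConvex K) (hn : 1 ≤ n)
    {W : EuclideanSpace ℝ (Fin n) → EuclideanSpace ℝ (Fin n)}
    (hWL : ∀ y ≠ 0, LipschitzNear W y) (hW : ∀ s : ℝ, 0 < s → ∀ y, W (s • y) = W y)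
    (hWq : ∀ y ≠ 0, DifferentiableAt ℝ (gauge K) y → ⟪gaugeGradient K y, W y⟫ = 0) :
    ∫ y in K, gauge K y * divergence W y = 0 := by
  have : Nonempty (Fin n) := ⟨⟨0, hn⟩⟩
  -- A cut-off in the gauge that vanishes for p ≤ 1/2 and p ≥ 1: it avoids the origin, where `W` is
  -- singular, and makes ω(p) W compactly supported. By tangency the gradient of ω(p) is orthogonal
  -- to `W`, so only ω(p) div W survives.
  set ω : ContDiffBump (3 / 4 : ℝ) := ⟨1 / 8, 1 / 4, by norm_num, by norm_num⟩ with hω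
  have hω0 : ∀ r : ℝ, r ≤ 1 / 2 → ω r = 0 := fun r hr => ω.zero_of_le_dist (by
    rw [Real.dist_eq, abs_sub_comm]
    exact le_trans (by change (1 / 4 : ℝ) ≤ 3 / 4 - r; linarith) (le_abs_self _))
  have hω1 : ∀ r : ℝ, 1 ≤ r → ω r = 0 := fun r hr => ω.zero_of_le_dist (by
    rw [Real.dist_eq]
    exact le_trans (by change (1 / 4 : ℝ) ≤ r - 3 / 4; linarith) (le_abs_self _))
  obtain ⟨Cp, hCp⟩ := hK.convex.lipschitz_gauge hK.mem_nhds_zero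
  have hloc : ∀ y, LipschitzNear (fun z => ω (gauge K z) • W z) y := by
    intro y
    rcases eq_or_ne y 0 with rfl | hy
    · have h1 : ∀ᶠ z in 𝓝 (0 : EuclideanSpace ℝ (Fin n)), gauge K z < 1 / 2 :=
        (hK.continuous_gauge.tendsto 0).eventually_lt_const (by rw [gauge_zero]; norm_num)
      have h2 : LipschitzNear (fun _ : EuclideanSpace ℝ (Fin n) =>
          (0 : EuclideanSpace ℝ (Fin n))) 0 := ⟨0, univ, Filter.univ_mem,
        (LipschitzWith.const 0).lipschitzOnWith⟩
      refine h2.congr ?_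
      filter_upwards [h1] with z hz
      rw [hω0 _ hz.le, zero_smul]
    · have h1 : LipschitzNear (gauge K) y := ⟨Cp, univ, Filter.univ_mem, hCp.lipschitzOnWith⟩
      have h2 : LipschitzNear (fun a : ℝ × EuclideanSpace ℝ (Fin n) => ω a.1 • a.2)
          (gauge K y, W y) := by
        have : ContDiff ℝ 1 (fun a : ℝ × EuclideanSpace ℝ (Fin n) => ω a.1 • a.2) :=
          (ω.contDiff.comp contDiff_fst).smul contDiff_snd
        exact this.contDiffAt.exists_lipschitzOnWith
      exact h2.comp (f := fun z => (gauge K z, W z)) (h1.prodMk (hWL y hy))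
  have hsupp : HasCompactSupport (fun z => ω (gauge K z) • W z) := by
    refine HasCompactSupport.of_support_subset_isCompact hK.bounded.isCompact_closure ?_
    intro z hz
    rw [hK.mem_closure_iff]
    by_contra h
    exact hz (by simp only [hω1 _ (not_le.1 h).le, zero_smul])
  obtain ⟨C, hC⟩ := exists_lipschitzWith_of_hasCompactSupport hloc hsupp
  have h0 := integral_trace_fderiv_eq_zero hC hsupp
  have hae : ∀ᵐ y, LinearMap.trace ℝ _
      (fderiv ℝ (fun z => ω (gauge K z) • W z) y).toLinearMap =
      ω (gauge K y) * divergence W y := by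
    filter_upwards [hK.ae_differentiableAt_gauge, Measure.ae_ne volume 0,
      ae_differentiableAt_of_lipschitzNear (μ := volume) (U := {0}ᶜ) hWL] with y hy hy0 hWd
    have h1 : HasFDerivAt (fun z => ω (gauge K z)) _ y :=
      ((ω.contDiff (n := 1)).differentiable (by simp) (gauge K y)).hasDerivAt.comp_hasFDerivAt y
        hy.hasFDerivAt
    rw [(h1.fun_smul (hWd hy0).hasFDerivAt).fderiv]
    have h2 : fderiv ℝ (gauge K) y (W y) = ⟪gaugeGradient K y, W y⟫ := by
      simp [gaugeGradient, gradient]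
    rw [ContinuousLinearMap.toLinearMap_add, map_add, ContinuousLinearMap.toLinearMap_smul,
      map_smul, smul_eq_mul, ← divergence]
    have h3 := LinearMap.trace_smulRight
      ((deriv ω (gauge K y)) • (fderiv ℝ (gauge K) y)).toLinearMap (W y)
    have h4 : (deriv ω (gauge K y)) * (fderiv ℝ (gauge K) y (W y)) = 0 := by
      rw [h2, hWq y hy0 hy, mul_zero]
    refine add_eq_left.2 (h3.trans ?_)
    simpa using h4
  rw [integral_congr_ae hae, ← setIntegral_eq_integral_of_forall_compl_eq_zero (s := K)
    (fun y hy => by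
      rw [hω1 _ (one_le_gauge_of_notMem (hK.convex.starConvex
        (mem_of_mem_nhds hK.mem_nhds_zero))
        (hK.absorbent _) hy), zero_mul])] at h0
  obtain ⟨D, hD⟩ := hK.exists_bound_divergence hWL hW
  -- Only ω(r)/r matters; the maximum keeps the quotient continuous at 0 and changes nothing where ω
  -- is non-zero.
  have hη : Continuous fun r : ℝ => ω r / max r (1 / 4) :=
    ω.continuous.div (by fun_prop) fun r => by positivity
  have h1 := hK.integral_gauge_mul hn hD
    (hK.continuous_gauge.measurable.mul (measurable_divergence W))
    (fun s hs y => gauge_mul_divergence_smul hW hs y) hη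
  have h2 : ∀ y, ω (gauge K y) / max (gauge K y) (1 / 4) * (gauge K y * divergence W y) =
      ω (gauge K y) * divergence W y := by
    intro y
    by_cases hy : gauge K y ≤ 1 / 2
    · simp [hω0 _ hy]
    · rw [max_eq_left (by linarith)]
      have : gauge K y ≠ 0 := by linarith
      field_simp
  simp only [h2] at h1
  rw [h0] at h1
  -- Polar integration writes zero as a strictly positive radial factor times the wanted integral.
  refine (mul_eq_zero.1 h1.symm).resolve_left (ne_of_gt ?_)
  refine intervalIntegral.integral_pos (by norm_num) (by fun_prop) ?_ ⟨3 / 4, by norm_num, ?_⟩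
  · intro r hr
    have := ω.nonneg' r
    have := hr.1.le
    positivity
  · have h3 : 0 < ω (3 / 4) := ω.pos_of_mem_ball (Metric.mem_ball_self ω.rOut_pos)
    have : (0 : ℝ) < n := by exact_mod_cast hn
    positivity

end Divergence

/-! ### The curvature integrand as a divergence. -/

section LocalInequality

variable {n : ℕ} {K : Set (EuclideanSpace ℝ (Fin n))}

/-- The derivative of `|h|`, where it exists. -/
theorem exists_hasFDerivAt_abs {E : Type*} [NormedAddCommGroup E] [NormedSpace ℝ E] {h : E → ℝ}
    {h' : E →L[ℝ] ℝ} {y : E} (hh : HasFDerivAt h h' y)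
    (hd : DifferentiableAt ℝ (fun z => |h z|) y) :
    ∃ ε : ℝ, ε * ε = 1 ∧ |h y| = ε * h y ∧ HasFDerivAt (fun z => |h z|) (ε • h') y := by
  rcases lt_trichotomy (h y) 0 with h0 | h0 | h0
  · refine ⟨-1, by norm_num, by rw [abs_of_neg h0]; ring, ?_⟩
    exact (hasDerivAt_abs_neg h0).comp_hasFDerivAt y hh
  · have h1 : fderiv ℝ (fun z => |h z|) y = 0 := IsLocalMin.fderiv_eq_zero
      (Filter.Eventually.of_forall fun z => by simp [h0])
    have h2 := hd.hasFDerivAt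
    rw [h1] at h2
    have h3 : HasFDerivAt h (0 : E →L[ℝ] ℝ) y := by
      rw [hasFDerivAt_iff_isLittleO] at h2 ⊢
      simp only [h0, abs_zero, sub_zero, zero_apply] at h2 ⊢
      exact h2.of_abs_left
    rw [hh.unique h3]
    exact ⟨1, by norm_num, by simp [h0], by simpa using h2⟩
  · refine ⟨1, by norm_num, by rw [abs_of_pos h0, one_mul], ?_⟩
    exact (hasDerivAt_abs_pos h0).comp_hasFDerivAt y hh

/-- The vector field whose divergence produces the curvature terms of the local inequality. -/
noncomputable def curvatureField (K : Set (EuclideanSpace ℝ (Fin n))) (t : ℝ)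
    (v y : EuclideanSpace ℝ (Fin n)) : EuclideanSpace ℝ (Fin n) :=
  ((t ^ 2 + 2 * t * |⟪v, gaugeGradient K y⟫|) * (gauge K y)⁻¹) • y +
    ⟪v, gaugeGradient K y⟫ • v -
    ((t + |⟪v, gaugeGradient K y⟫|) ^ 2 * (‖gaugeGradient K y‖⁻¹) ^ 2) • gaugeGradient K y

theorem curvatureField_smul {t : ℝ} {v : EuclideanSpace ℝ (Fin n)} {s : ℝ} (hs : 0 < s)
    (y : EuclideanSpace ℝ (Fin n)) : curvatureField K t v (s • y) = curvatureField K t v y := by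
  rw [curvatureField, curvatureField, gaugeGradient_smul hs, gauge_smul_nonneg hs.le, smul_smul]
  congr 3
  field_simp

/-- The coefficients balance: t² + 2tφ + ⟪v, q⟫² = (t + φ)². On the frontier the field is (t + φ)w +
t(φx - εv), where w solves II w = ∇f and ε is the sign of ⟪v, q⟫. The second, also tangential,
summand removes the term tεv, which would jump where ⟪v, q⟫ changes sign. -/
theorem IsSymmetricConvex.inner_curvatureField (hK : IsSymmetricConvex K) {t : ℝ}
    {v y : EuclideanSpace ℝ (Fin n)} (hy : y ≠ 0) (hd : DifferentiableAt ℝ (gauge K) y) :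
    ⟪gaugeGradient K y, curvatureField K t v y⟫ = 0 := by
  have hp := (hK.gauge_pos.2 hy).ne'
  have hq := norm_ne_zero_iff.2 (hK.gaugeGradient_ne_zero hd hy)
  rw [curvatureField, inner_sub_right, inner_add_right, inner_smul_right, inner_smul_right,
    inner_smul_right, inner_gaugeGradient_self hd, real_inner_self_eq_norm_sq,
    real_inner_comm v (gaugeGradient K y)]
  field_simp
  nlinarith [sq_abs ⟪v, gaugeGradient K y⟫]

theorem IsSymmetricConvex.lipschitzNear_abs_inner (hK : IsSymmetricConvex K)
    (hC2 : HasC2Boundary K) (v : EuclideanSpace ℝ (Fin n)) {y : EuclideanSpace ℝ (Fin n)}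
    (hy : y ≠ 0) : LipschitzNear (fun z => |⟪v, gaugeGradient K z⟫|) y := by
  have h1 : LipschitzNear (fun z => ⟪v, gaugeGradient K z⟫) y :=
    (contDiffAt_const.inner ℝ (hK.contDiffAt_gaugeGradient hC2 hy)).exists_lipschitzOnWith
  have h2 : LipschitzNear (fun r : ℝ => |r|) ⟪v, gaugeGradient K y⟫ :=
    ⟨1, univ, Filter.univ_mem, lipschitzWith_one_norm.lipschitzOnWith⟩
  exact h2.comp (f := fun z => ⟪v, gaugeGradient K z⟫) h1

/-- The field is a C¹ function of |⟪v, q(z)⟫| and z, so the absolute value is its only source of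
non-smoothness. -/
theorem IsSymmetricConvex.lipschitzNear_curvatureField (hK : IsSymmetricConvex K)
    (hC2 : HasC2Boundary K) (t : ℝ) (v : EuclideanSpace ℝ (Fin n)) {y : EuclideanSpace ℝ (Fin n)}
    (hy : y ≠ 0) : LipschitzNear (curvatureField K t v) y := by
  have hp := (hK.gauge_pos.2 hy).ne'
  have hq := hK.gaugeGradient_ne_zero (hK.differentiableAt_gauge hC2 hy) hy
  have hid : LipschitzNear (fun z : EuclideanSpace ℝ (Fin n) => z) y :=
    ⟨1, univ, Filter.univ_mem, LipschitzWith.id.lipschitzOnWith⟩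
  have hsm : LipschitzNear (fun a : ℝ × EuclideanSpace ℝ (Fin n) =>
      ((t ^ 2 + 2 * t * a.1) * (gauge K a.2)⁻¹) • a.2 + ⟪v, gaugeGradient K a.2⟫ • v -
      ((t + a.1) ^ 2 * (‖gaugeGradient K a.2‖⁻¹) ^ 2) • gaugeGradient K a.2)
      (|⟪v, gaugeGradient K y⟫|, y) := by
    have h1 : ContDiffAt ℝ 1 (fun a : ℝ × EuclideanSpace ℝ (Fin n) => gauge K a.2)
        (|⟪v, gaugeGradient K y⟫|, y) :=
      ContDiffAt.comp (g := gauge K) _ ((hK.contDiffAt_gauge hC2 hy).of_le (by norm_num))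
        contDiffAt_snd
    have h2 : ContDiffAt ℝ 1 (fun a : ℝ × EuclideanSpace ℝ (Fin n) => gaugeGradient K a.2)
        (|⟪v, gaugeGradient K y⟫|, y) :=
      ContDiffAt.comp (g := gaugeGradient K) _ (hK.contDiffAt_gaugeGradient hC2 hy) contDiffAt_snd
    refine ContDiffAt.exists_lipschitzOnWith (𝕂 := ℝ) ?_
    refine ((((contDiffAt_const.add (contDiffAt_const.mul contDiffAt_fst)).mul (h1.inv hp)).smul
      contDiffAt_snd).add ((contDiffAt_const.inner ℝ h2).smul contDiffAt_const)).sub ?_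
    exact (((contDiffAt_const.add contDiffAt_fst).pow 2).mul
      (((h2.norm ℝ hq).inv (norm_ne_zero_iff.2 hq)).pow 2)).smul h2
  exact hsm.comp (f := fun z => (|⟪v, gaugeGradient K z⟫|, z))
    ((hK.lipschitzNear_abs_inner hC2 v hy).prodMk hid)

theorem trace_smul_add_smulRight {E : Type*} [NormedAddCommGroup E] [NormedSpace ℝ E]
    [FiniteDimensional ℝ E] (a : ℝ) (U : E →L[ℝ] E) (α : E →L[ℝ] ℝ) (u : E) :
    LinearMap.trace ℝ E (a • U + α.smulRight u).toLinearMap =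
      a * LinearMap.trace ℝ E U.toLinearMap + α u := by
  have h : (a • U + α.smulRight u).toLinearMap =
      a • U.toLinearMap + α.toLinearMap.smulRight u := rfl
  rw [h, map_add, map_smul, LinearMap.trace_smulRight]
  rfl

/-- The divergence of the curvature field at boundary points. -/
theorem IsSymmetricConvex.divergence_curvatureField (hK : IsSymmetricConvex K)
    (hC2 : HasC2Boundary K) {t ε : ℝ} {v x : EuclideanSpace ℝ (Fin n)} (hx : x ∈ frontier K)
    (hφ : HasFDerivAt (fun z => |⟪v, gaugeGradient K z⟫|)
      (ε • (innerSL ℝ v).comp (gaugeHessian K x)) x) :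
    divergence (curvatureField K t v) x =
      (t ^ 2 + 2 * t * |⟪v, gaugeGradient K x⟫|) * (n - 1) + ⟪v, gaugeHessian K x v⟫ -
      (2 * (t + |⟪v, gaugeGradient K x⟫|) * ε * ⟪v, gaugeHessian K x (gaugeGradient K x)⟫ /
        ‖gaugeGradient K x‖ ^ 2 +
      (t + |⟪v, gaugeGradient K x⟫|) ^ 2 * LinearMap.trace ℝ _ (gaugeHessian K x).toLinearMap /
        ‖gaugeGradient K x‖ ^ 2 -
      2 * (t + |⟪v, gaugeGradient K x⟫|) ^ 2 *
        ⟪gaugeGradient K x, gaugeHessian K x (gaugeGradient K x)⟫ /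
        ‖gaugeGradient K x‖ ^ 4) := by
  have hx0 := hK.ne_zero_of_mem_frontier hx
  have hpx := hK.mem_frontier_iff.1 hx
  have hd := hK.differentiableAt_gauge hC2 hx0
  have hq0 := hK.gaugeGradient_ne_zero hd hx0
  have hqn := norm_ne_zero_iff.2 hq0
  have hq := hK.hasFDerivAt_gaugeGradient hC2 hx0
  have hp := (hasGradientAt_gauge hd).hasFDerivAt
  have hvq : HasFDerivAt (fun z => ⟪v, gaugeGradient K z⟫)
      ((innerSL ℝ v).comp (gaugeHessian K x)) x :=
    ((innerSL ℝ v).hasFDerivAt (x := gaugeGradient K x)).comp x hq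
  have hpinv := (hasDerivAt_inv (x := gauge K x) (by rw [hpx]; norm_num)).comp_hasFDerivAt x hp
  have hninv := hasFDerivAt_norm_inv hq hq0
  have h1 := (((hφ.const_mul (2 * t)).const_add (t ^ 2)).fun_mul hpinv).fun_smul
    (hasFDerivAt_id (𝕜 := ℝ) x)
  have h2 := hvq.smul_const v
  have h3 := ((((hasDerivAt_pow 2 _).comp_hasFDerivAt x (hφ.const_add t))).fun_mul
    ((hasDerivAt_pow 2 _).comp_hasFDerivAt x hninv)).fun_smul hq
  have h4 : HasFDerivAt (curvatureField K t v) _ x := (h1.fun_add h2).fun_sub h3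
  have h5 : LinearMap.trace ℝ _
      (((innerSL ℝ v).comp (gaugeHessian K x)).smulRight v).toLinearMap =
      ⟪v, gaugeHessian K x v⟫ :=
    LinearMap.trace_smulRight ((innerSL ℝ v).comp (gaugeHessian K x)).toLinearMap v
  have hvx : gaugeHessian K x x = 0 := hK.gaugeHessian_self hC2 hx0
  rw [divergence, h4.fderiv, ContinuousLinearMap.toLinearMap_sub,
    ContinuousLinearMap.toLinearMap_add, map_sub, map_add, h5, trace_smul_add_smulRight,
    trace_smul_add_smulRight]
  simp [hvx, hpx, inner_gaugeGradient_self hd]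
  field_simp
  ring

theorem IsSymmetricConvex.radial_function_eq (hK : IsSymmetricConvex K)
    (hC2 : HasC2Boundary K) {t : ℝ} {v : EuclideanSpace ℝ (Fin n)}
    {f : EuclideanSpace ℝ (Fin n) → ℝ}
    (hf : ∀ x, f x = t * ⟪x, outerNormal K x⟫ + |⟪v, outerNormal K x⟫|)
    {x : EuclideanSpace ℝ (Fin n)} (hx : x ∈ frontier K) :
    f x = (t + |⟪v, gaugeGradient K x⟫|) * ‖gaugeGradient K x‖⁻¹ := by
  have hd := hK.differentiableAt_gauge hC2 (hK.ne_zero_of_mem_frontier hx)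
  rw [hf, hK.inner_outerNormal hx hd, hK.outerNormal_eq hx hd, inner_smul_right, abs_mul,
    abs_of_nonneg (by positivity)]
  ring

/-- The curvature integrand is a divergence, up to terms without derivatives. -/
theorem IsSymmetricConvex.localLogBMIntegrand_eq (hK : IsSymmetricConvex K)
    (hC2 : HasC2Boundary K) {t : ℝ} {v x : EuclideanSpace ℝ (Fin n)}
    {f : EuclideanSpace ℝ (Fin n) → ℝ}
    (hf : ∀ x, f x = t * ⟪x, outerNormal K x⟫ + |⟪v, outerNormal K x⟫|)
    (hx : x ∈ frontier K)
    (hφd : DifferentiableAt ℝ (fun z => |⟪v, gaugeGradient K z⟫|) x) :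
    ‖gaugeGradient K x‖ * localLogBMIntegrand K f x = -divergence (curvatureField K t v) x +
      ((n - 1) * (t ^ 2 + 2 * t * |⟪v, gaugeGradient K x⟫|) +
        (t + |⟪v, gaugeGradient K x⟫|) ^ 2) := by
  have hx0 := hK.ne_zero_of_mem_frontier hx
  have hpx := hK.mem_frontier_iff.1 hx
  have hd := hK.differentiableAt_gauge hC2 hx0
  have hq0 := hK.gaugeGradient_ne_zero hd hx0
  have hqn := norm_ne_zero_iff.2 hq0
  have hq := hK.hasFDerivAt_gaugeGradient hC2 hx0
  have hsymm := hK.inner_gaugeHessian_comm hC2 hx0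
  have hvq : HasFDerivAt (fun z => ⟪v, gaugeGradient K z⟫)
      ((innerSL ℝ v).comp (gaugeHessian K x)) x :=
    ((innerSL ℝ v).hasFDerivAt (x := gaugeGradient K x)).comp x hq
  obtain ⟨ε, hε, hφx, hφ⟩ := exists_hasFDerivAt_abs hvq hφd
  have hBx : gaugeHessian K x x = 0 := hK.gaugeHessian_self hC2 hx0
  rw [hK.divergence_curvatureField hC2 hx hφ]
  set a := t + |⟪v, gaugeGradient K x⟫| with ha
  -- The explicit preimage of ∇f under II. From f = a / ‖q‖ the derivative along τ is ‖q‖⁻¹ ⟪εv - (a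
  -- / ‖q‖²) q, Bτ⟫, with B the Hessian of the gauge. Adding tx costs nothing since Bx = 0, and it
  -- makes the vector tangent.
  set w := t • x + ε • v - (a / ‖gaugeGradient K x‖ ^ 2) • gaugeGradient K x with hw
  have hwT : w ∈ boundaryTangent K x := by
    rw [hK.mem_boundaryTangent hx hd, hw, inner_sub_right, inner_add_right, inner_smul_right,
      inner_smul_right, inner_smul_right, inner_gaugeGradient_self hd, hpx,
      real_inner_self_eq_norm_sq, real_inner_comm, ← hφx, ha]
    field_simp
    ring
  have hgrad : boundaryGradient K f x = secondFundamentalForm K x ⟨w, hwT⟩ := by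
    refine ext_inner_right ℝ fun τ => ?_
    have hτ := (hK.mem_boundaryTangent hx hd).1 τ.2
    have h1 : fderivWithin ℝ f (frontier K) x τ = _ :=
      hK.fderivWithin_frontier_apply hx hd
        (G := fun z => (t + |⟪v, gaugeGradient K z⟫|) * ‖gaugeGradient K z‖⁻¹)
        (fun z hz => hK.radial_function_eq hC2 hf hz)
        ((hφ.const_add t).fun_mul (hasFDerivAt_norm_inv hq hq0)) hτ
    rw [hK.inner_secondFundamentalForm hC2 hx, boundaryGradient,
      InnerProductSpace.toDual_symm_apply, ContinuousLinearMap.comp_apply,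
      Submodule.subtypeL_apply, h1, hsymm]
    change _ = _ * ⟪w, gaugeHessian K x τ⟫
    rw [hw, inner_sub_left, inner_add_left, inner_smul_left x, ← hsymm x, hBx]
    simp [inner_smul_left]
    field_simp
    ring
  have hinv : inverseForm (secondFundamentalForm K x) (boundaryGradient K f x) =
      ‖gaugeGradient K x‖⁻¹ * ⟪gaugeHessian K x w, w⟫ := by
    rw [hgrad, inverseForm_apply]
    · rw [real_inner_comm, hK.inner_secondFundamentalForm hC2 hx]
    · intro σ τ
      rw [real_inner_comm _ σ, hK.inner_secondFundamentalForm hC2 hx,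
        hK.inner_secondFundamentalForm hC2 hx, hsymm, real_inner_comm]
  have hBw : ⟪gaugeHessian K x w, w⟫ = ⟪v, gaugeHessian K x v⟫ -
      2 * ε * (a / ‖gaugeGradient K x‖ ^ 2) * ⟪v, gaugeHessian K x (gaugeGradient K x)⟫ +
      (a / ‖gaugeGradient K x‖ ^ 2) ^ 2 *
        ⟪gaugeGradient K x, gaugeHessian K x (gaugeGradient K x)⟫ := by
    have h1 : ⟪gaugeGradient K x, gaugeHessian K x v⟫ =
        ⟪v, gaugeHessian K x (gaugeGradient K x)⟫ := by rw [← hsymm, real_inner_comm]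
    have h2 : ∀ u, ⟪x, gaugeHessian K x u⟫ = 0 := fun u => by rw [← hsymm, hBx, inner_zero_left]
    rw [hsymm, hw]
    simp only [map_sub, map_add, map_smul, hBx, inner_sub_left, inner_add_left, inner_sub_right,
      inner_add_right, inner_smul_left, inner_smul_right, h1, h2, conj_trivial, smul_zero,
      inner_zero_right]
    linear_combination ⟪v, gaugeHessian K x v⟫ * hε
  rw [localLogBMIntegrand, hinv, hBw, hK.meanCurvature_eq hC2 hx, hK.inner_outerNormal hx hd,
    hK.radial_function_eq hC2 hf hx, ← ha]
  field_simp
  ring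

end LocalInequality

/-! ### Integration of the curvature identity. -/

section LocalLogBM

variable {n : ℕ} {K : Set (EuclideanSpace ℝ (Fin n))}

/-- Rademacher's theorem gives differentiability almost everywhere in the volume; as the function
has degree 0, this passes along rays to the boundary point. -/
theorem IsSymmetricConvex.ae_differentiableAt_abs_inner (hK : IsSymmetricConvex K) (hn : 1 ≤ n)
    (hC2 : HasC2Boundary K) (v : EuclideanSpace ℝ (Fin n)) :
    ∀ᵐ y ∂volume.restrict K, y ≠ 0 ∧
      DifferentiableAt ℝ (fun z => |⟪v, gaugeGradient K z⟫|) (radialProj K y) := by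
  have h1 := ae_differentiableAt_of_lipschitzNear (μ := volume) (U := {0}ᶜ)
    fun y hy => hK.lipschitzNear_abs_inner hC2 v hy
  filter_upwards [hK.ae_restrict_regular hn, ae_restrict_of_ae h1] with y hy hd
  refine ⟨hy.1, ?_⟩
  have hp := hK.gauge_pos.2 hy.1
  have h2 : (fun z => |⟪v, gaugeGradient K z⟫|) =
      fun z => |⟪v, gaugeGradient K (gauge K y • z)⟫| := by
    funext z
    rw [gaugeGradient_smul hp]
  rw [h2]
  refine DifferentiableAt.comp (g := fun z => |⟪v, gaugeGradient K z⟫|)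
    (f := fun z => gauge K y • z) _ ?_ (by fun_prop)
  rw [hK.gauge_smul_radialProj]
  exact hd hy.1

theorem IsSymmetricConvex.ae_boundaryMeasure_differentiableAt_abs_inner
    (hK : IsSymmetricConvex K) (hn : 1 ≤ n) (hC2 : HasC2Boundary K)
    (v : EuclideanSpace ℝ (Fin n)) : ∀ᵐ x ∂boundaryMeasure K, x ∈ frontier K ∧
      DifferentiableAt ℝ (fun z => |⟪v, gaugeGradient K z⟫|) x := by
  have h1 : ∀ᵐ x ∂boundaryMeasure K,
      DifferentiableAt ℝ (fun z => |⟪v, gaugeGradient K z⟫|) x := by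
    rw [hK.boundaryMeasure_eq_map hn, ae_map_iff hK.measurable_radialProj.aemeasurable
      (measurableSet_of_differentiableAt ℝ _)]
    refine (withDensity_absolutelyContinuous _ _).ae_le ?_
    filter_upwards [hK.ae_differentiableAt_abs_inner hn hC2 v] with y hy using hy.2
  filter_upwards [hK.ae_boundaryMeasure hn, h1] with x hx hd
  exact ⟨hx.1, hd⟩

/-- The integral of `f(x) = t⟨x, n_x⟩ + |⟨v, n_x⟩|` over the boundary. -/
theorem IsSymmetricConvex.integral_radial_function (hK : IsSymmetricConvex K) (hn : 1 ≤ n)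
    (hC2 : HasC2Boundary K) {t : ℝ} {v : EuclideanSpace ℝ (Fin n)}
    {f : EuclideanSpace ℝ (Fin n) → ℝ}
    (hf : ∀ x, f x = t * ⟪x, outerNormal K x⟫ + |⟪v, outerNormal K x⟫|) :
    Integrable f (boundaryMeasure K) ∧ ∫ x, f x ∂boundaryMeasure K =
      n * (t * volume.real K + ∫ y in K, |⟪gaugeGradient K y, v⟫|) := by
  have := hK.isFiniteMeasure_restrict
  have hφi := hK.integrableOn_abs_inner v
  have hti : IntegrableOn (fun _ => t) K := integrable_const t
  have hqm := measurable_gaugeGradient (K := K)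
  have hmeas : AEStronglyMeasurable f (boundaryMeasure K) := by
    have : Measurable fun x => (t + |⟪v, gaugeGradient K x⟫|) * ‖gaugeGradient K x‖⁻¹ := by
      fun_prop
    refine this.aestronglyMeasurable.congr ?_
    filter_upwards [hK.ae_boundaryMeasure hn] with x hx
    exact (hK.radial_function_eq hC2 hf hx.1).symm
  have hval : ∀ᵐ y ∂volume.restrict K, ‖gaugeGradient K y‖ * f (radialProj K y) =
      t + |⟪gaugeGradient K y, v⟫| := by
    filter_upwards [hK.ae_restrict_regular hn] with y hy
    rw [hK.radial_function_eq hC2 hf (hK.radialProj_mem_frontier hy.1),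
      hK.gaugeGradient_radialProj hy.1, real_inner_comm]
    have hq := norm_ne_zero_iff.2 (hK.gaugeGradient_ne_zero hy.2 hy.1)
    field_simp
  obtain ⟨h1, h2⟩ := hK.boundary_integral hn hmeas (hti.add hφi) hval
  refine ⟨h1, ?_⟩
  rw [h2]
  simp only [Pi.add_apply]
  rw [integral_add hti hφi, setIntegral_const, smul_eq_mul, mul_comm t]

/-- The integral of the curvature integrand over the boundary. -/
theorem IsSymmetricConvex.integral_localLogBMIntegrand (hK : IsSymmetricConvex K) (hn : 1 ≤ n)
    (hC2 : HasC2Boundary K) {t : ℝ} {v : EuclideanSpace ℝ (Fin n)}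
    {f : EuclideanSpace ℝ (Fin n) → ℝ}
    (hf : ∀ x, f x = t * ⟪x, outerNormal K x⟫ + |⟪v, outerNormal K x⟫|) :
    Integrable (localLogBMIntegrand K f) (boundaryMeasure K) ∧
    ∫ x, localLogBMIntegrand K f x ∂boundaryMeasure K =
      n * (n * (t ^ 2 * volume.real K + 2 * t * ∫ y in K, |⟪gaugeGradient K y, v⟫|) +
        ∫ y in K, ⟪gaugeGradient K y, v⟫ ^ 2) := by
  have := hK.isFiniteMeasure_restrict
  have hqm := measurable_gaugeGradient (K := K)
  have hpm := hK.continuous_gauge.measurable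
  have hdm := measurable_divergence (curvatureField K t v)
  have hdiv := hK.integral_gauge_mul_divergence hn (W := curvatureField K t v)
    (fun y hy => hK.lipschitzNear_curvatureField hC2 t v hy)
    (fun s hs y => curvatureField_smul hs y) (fun y hy hd => hK.inner_curvatureField hy hd)
  obtain ⟨C, hC⟩ := hK.exists_bound_divergence (W := curvatureField K t v)
    (fun y hy => hK.lipschitzNear_curvatureField hC2 t v hy)
    (fun s hs y => curvatureField_smul hs y)
  have hdi : IntegrableOn (fun y => gauge K y * divergence (curvatureField K t v) y) K :=
    hK.integrableOn_of_bounded (hpm.mul hdm).aestronglyMeasurable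
      (Filter.Eventually.of_forall hC)
  have hφi := (hK.integrableOn_abs_inner v).const_mul (2 * n * t)
  have hsi := hK.integrableOn_inner_sq v
  have hti : IntegrableOn (fun _ => n * t ^ 2) K := integrable_const _
  have hmeas : AEStronglyMeasurable (localLogBMIntegrand K f) (boundaryMeasure K) := by
    have : Measurable fun x => ‖gaugeGradient K x‖⁻¹ *
        (-divergence (curvatureField K t v) x +
          ((n - 1) * (t ^ 2 + 2 * t * |⟪v, gaugeGradient K x⟫|) +
            (t + |⟪v, gaugeGradient K x⟫|) ^ 2)) := by
      fun_prop
    refine this.aestronglyMeasurable.congr ?_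
    filter_upwards [hK.ae_boundaryMeasure_differentiableAt_abs_inner hn hC2 v] with x hx
    have hx0 := hK.ne_zero_of_mem_frontier hx.1
    have hq := norm_ne_zero_iff.2
      (hK.gaugeGradient_ne_zero (hK.differentiableAt_gauge hC2 hx0) hx0)
    rw [← hK.localLogBMIntegrand_eq hC2 hf hx.1 hx.2, inv_mul_cancel_left₀ hq]
  have hval : ∀ᵐ y ∂volume.restrict K,
      ‖gaugeGradient K y‖ * localLogBMIntegrand K f (radialProj K y) =
      -(gauge K y * divergence (curvatureField K t v) y) +
        (n * t ^ 2 + (2 * n * t * |⟪gaugeGradient K y, v⟫| + ⟪gaugeGradient K y, v⟫ ^ 2)) := by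
    filter_upwards [hK.ae_differentiableAt_abs_inner hn hC2 v] with y hy
    have hx := hK.radialProj_mem_frontier hy.1
    have h3 := gauge_mul_divergence_smul (K := K) (W := curvatureField K t v)
      (fun s hs y => curvatureField_smul hs y) (inv_pos.2 (hK.gauge_pos.2 hy.1)) y
    rw [← radialProj, hK.gauge_radialProj hy.1, one_mul] at h3
    have h4 := hK.localLogBMIntegrand_eq hC2 hf hx hy.2
    rw [hK.gaugeGradient_radialProj hy.1, h3, real_inner_comm] at h4
    rw [h4]
    linear_combination sq_abs ⟪gaugeGradient K y, v⟫
  obtain ⟨h1, h2⟩ := hK.boundary_integral hn hmeas (hdi.neg.add (hti.add (hφi.add hsi))) hval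
  refine ⟨h1, ?_⟩
  rw [h2, integral_add' hdi.neg (hti.add (hφi.add hsi)), integral_neg', hdiv,
    integral_add' hti (hφi.add hsi), integral_add' hφi hsi, setIntegral_const, smul_eq_mul,
    integral_const_mul]
  ring

/-- The local Log-Brunn–Minkowski inequality for the sum of the set and a segment. -/
theorem IsSymmetricConvex.local_logBM (hK : IsSymmetricConvex K) (hn : 1 ≤ n)
    (hC2 : HasC2Boundary K) {t : ℝ} {v : EuclideanSpace ℝ (Fin n)}
    {f : EuclideanSpace ℝ (Fin n) → ℝ}
    (hf : ∀ x, f x = t * ⟪x, outerNormal K x⟫ + |⟪v, outerNormal K x⟫|) :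
    ∫ x, localLogBMIntegrand K f x ∂boundaryMeasure K
      ≤ 1 / volume.real K * (∫ x, f x ∂boundaryMeasure K) ^ 2 := by
  rw [(hK.integral_localLogBMIntegrand hn hC2 hf).2, (hK.integral_radial_function hn hC2 hf).2]
  have hV := hK.volume_pos
  have h1 := hK.integral_inner_sq_le v
  have h2 := hK.gauge_mul_volume_le_integral hn v
  have hS : 0 ≤ ∫ y in K, |⟪gaugeGradient K y, v⟫| := integral_nonneg fun y => abs_nonneg _
  set V := volume.real K
  set S := ∫ y in K, |⟪gaugeGradient K y, v⟫|
  set A := ∫ y in K, ⟪gaugeGradient K y, v⟫ ^ 2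
  have h3 : A * V ≤ n * S ^ 2 := by
    calc A * V ≤ gauge K v * S * V := by gcongr
      _ = gauge K v * V * S := by ring
      _ ≤ n * S * S := by gcongr
      _ = n * S ^ 2 := by ring
  have h4 : (n : ℝ) * (A * V) ≤ n * (n * S ^ 2) := by gcongr
  -- After multiplication by |K| the terms in t agree on both sides; what remains is `h4`.
  rw [one_div, inv_mul_eq_div, le_div_iff₀ hV]
  nlinarith

end LocalLogBM

end LogBM

theorem mainTheorem2 (n : ℕ) (hn : 1 ≤ n) :
    -- the inequality with curvatures, for smooth sets
    (∀ K : Set (EuclideanSpace ℝ (Fin n)), LogBM.IsSymmetricConvex K →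
      StrictConvex ℝ (closure K) → LogBM.HasC2Boundary K →
      ∀ (t : ℝ) (v : EuclideanSpace ℝ (Fin n)) (f : EuclideanSpace ℝ (Fin n) → ℝ),
        (∀ x, f x = t * ⟪x, LogBM.outerNormal K x⟫ + |⟪v, LogBM.outerNormal K x⟫|) →
        Integrable f (LogBM.boundaryMeasure K) ∧
        Integrable (LogBM.localLogBMIntegrand K f) (LogBM.boundaryMeasure K) ∧
        ∫ x, LogBM.localLogBMIntegrand K f x ∂LogBM.boundaryMeasure K
          ≤ 1 / volume.real K * (∫ x, f x ∂LogBM.boundaryMeasure K) ^ 2) ∧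
    -- the inequality with mixed volumes, for all sets, and its equality case
    (∀ K : Set (EuclideanSpace ℝ (Fin n)), LogBM.IsSymmetricConvex K →
      ∀ (v : EuclideanSpace ℝ (Fin n)) (M : Set (EuclideanSpace ℝ (Fin n))),
        M = segment ℝ (-v) v →
        ContDiffOn ℝ 2 (fun t : ℝ => volume.real (K + t • M)) (Ici 0) ∧
        Integrable (fun x => LogBM.supportFunction M (LogBM.outerNormal K x) ^ 2 /
          ⟪x, LogBM.outerNormal K x⟫) (LogBM.boundaryMeasure K) ∧
        n * (n - 1) * LogBM.mixedVolume 2 K M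
          + ∫ x, LogBM.supportFunction M (LogBM.outerNormal K x) ^ 2 /
              ⟪x, LogBM.outerNormal K x⟫ ∂LogBM.boundaryMeasure K
          ≤ n ^ 2 * LogBM.mixedVolume 1 K M ^ 2 / volume.real K ∧
        (n * (n - 1) * LogBM.mixedVolume 2 K M
          + ∫ x, LogBM.supportFunction M (LogBM.outerNormal K x) ^ 2 /
              ⟪x, LogBM.outerNormal K x⟫ ∂LogBM.boundaryMeasure K
          = n ^ 2 * LogBM.mixedVolume 1 K M ^ 2 / volume.real K ↔
          v = 0 ∨ ∃ (s : ℝ) (C : Set (EuclideanSpace ℝ (Fin n))), 0 < s ∧ Convex ℝ C ∧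
            (∀ x ∈ C, -x ∈ C) ∧ Module.finrank ℝ (vectorSpan ℝ C) = n - 1 ∧
            closure K = C + segment ℝ (-(s • v)) (s • v))) := by
  refine ⟨fun K hK _ hC2 t v f hf => ⟨(hK.integral_radial_function hn hC2 hf).1,
    (hK.integral_localLogBMIntegrand hn hC2 hf).1, hK.local_logBM hn hC2 hf⟩, ?_⟩
  rintro K hK v M rfl
  obtain ⟨hint, hval⟩ := hK.integral_support_sq_div hn v
  refine ⟨hK.contDiffOn_volume v, hint, ?_⟩
  rw [hval, hK.mixedVolume_two v, mul_zero, zero_add, ← mul_pow, hK.mixedVolume_one hn v]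
  exact hK.mixedVolume_inequality hn v
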